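/- **Setting.** Let $G$ be a connected bipartite graph with $n\ge 2$ vertices, $m$ edges and shores $X,Y$, which is distance hereditary (the distance between two vertices is the same in every connected induced subgraph containing them); such a graph is called BDH. The reverse of a pruning sequence of $G$ is a sequence of triples $(v_i,C_i,v_{k_i})$, $2\le i\le n$, where $v_1,\dots,v_n$ are the vertices of $G$, each once, $k_i<i$, and, in the subgraph $G_i$ induced by $v_1,\dots,v_i$, the vertex $v_i$ is either a pending vertex whose only neighbor is $v_{k_i}$, or a false twin of $v_{k_i}$ (that is, $v_i$ and $v_{k_i}$ have the same neighborhood in $G_i$ and are not adjacent), as specified by $C_i$. Without loss of generality $v_1\in X$. A biclique is a pair $B=(X(B),Y(B))$ with $\emptyset\ne X(B)\subseteq X$, $\emptyset\ne Y(B)\subseteq Y$ such that every vertex of $X(B)$ is adjacent to every vertex of $Y(B)$; it is maximal if it is not properly contained in another biclique. The maximal bicliques are ordered by $B\preceq B'\Leftrightarrow X(B)\subseteq X(B')$, and $\mathbf H^\circ(G)$ is the Hasse diagram of this poset. The introducer of a vertex $v\in X$ (resp. $v\in Y$) is the lowest (resp. highest) maximal biclique containing $v$. **Algorithm ComputeBDHDiagram.**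 Start with the single biclique $(\{v_1\},\{v_2\})$, introducer of $v_1$ and $v_2$. For $i=3,\dots,n$ let $B$ be the current introducer of $v_{k_i}$, and suppose $v_i\in X$ (for $v_i\in Y$ exchange the shores and reverse the order). If $v_i$ is a twin of $v_{k_i}$, add $v_i$ to $X(B)$ and to $X(B')$ for every $B'\succ B$, found by traversing the diagram upwards from $B$; the introducer of $v_i$ is $B$. If $v_i$ is pending and $|Y(B)|=1$, add $v_i$ to $X(B)$; the introducer of $v_i$ is $B$. If $v_i$ is pending and $|Y(B)|>1$, create a new biclique $B'=(X(B)\cup\{v_i\},\{v_{k_i}\})$ with the cover pair $B\prec B'$; it becomes the introducer of $v_i$ and of $v_{k_i}$. The algorithm is implemented with linked lists on a random access machine whose registers and array entries hold natural numbers and whose only arithmetic operation is the successor, each elementary operation taking one unit of time. The vertices are numbered $0,\dots,n-1$, the memory initially holds $n$ and the triples, and nothing is assumed about the rest of the memory. **Theorem.** There is a constant $c$ such that, for every $G$ as above and every reverse of a pruning sequence of $G$, algorithm ComputeBDHDiagram halts within $c\cdot m$ units of time, and its output is an explicit description of $\mathbf H^\circ(G)$: every maximal biclique $B$ of $G$ is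 represented exactly once, with the lists of the vertices of $X(B)$ and of $Y(B)$, the list of the maximal bicliques that cover $B$ and the list of those that $B$ covers (each list without repetitions); moreover, for every vertex there is a reference to its introducer. -/

import Mathlib

namespace BDH

/-! ### Graphs and maximal bicliques -/

section Graphs

variable {V : Type*}

/-- Distances between vertices are the same in every connected induced subgraph containing them
(as in the whole graph). -/
def IsDistanceHereditary (G : SimpleGraph V) : Prop :=
  ∀ s : Set V, (G.induce s).Connected → ∀ u w : s, (G.induce s).dist u w = G.dist u w

/-- Bipartite distance hereditary graphs. -/
def IsBDH (G : SimpleGraph V) : Prop :=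
  G.IsBipartite ∧ IsDistanceHereditary G

/-- `B = (X(B), Y(B))` is a biclique of the bipartite graph `G` with shores `X` and `Y`. -/
structure IsBiclique (G : SimpleGraph V) (X Y : Set V) (B : Set V × Set V) : Prop where
  left_subset : B.1 ⊆ X
  right_subset : B.2 ⊆ Y
  left_nonempty : B.1.Nonempty
  right_nonempty : B.2.Nonempty
  adj : ∀ x ∈ B.1, ∀ y ∈ B.2, G.Adj x y

/-- The maximal bicliques of the bipartite graph `G` with shores `X` and `Y`; maximality is with
respect to inclusion of both shores. -/
def MaxBiclique (G : SimpleGraph V) (X Y : Set V) : Type _ :=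
  {B : Set V × Set V // Maximal (IsBiclique G X Y) B}

namespace MaxBiclique

variable {G : SimpleGraph V} {X Y : Set V}

/-- The shore `X(B)`. -/
def left (B : MaxBiclique G X Y) : Set V := B.1.1

/-- The shore `Y(B)`. -/
def right (B : MaxBiclique G X Y) : Set V := B.1.2

theorem right_subset_of_left_eq {B B' : MaxBiclique G X Y} (h : B.left = B'.left) :
    B'.right ⊆ B.right := by
  have hB := B.2.prop
  have hB' := B'.2.prop
  have key : IsBiclique G X Y (B.1.1, B.1.2 ∪ B'.1.2) :=
    { left_subset := hB.left_subset
      right_subset := Set.union_subset hB.right_subset hB'.right_subset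
      left_nonempty := hB.left_nonempty
      right_nonempty := hB.right_nonempty.mono Set.subset_union_left
      adj := by
        rintro x hx y (hy | hy)
        · exact hB.adj x hx y hy
        · exact hB'.adj x (h ▸ hx : x ∈ B'.left) y hy }
  have hle := B.2.le_of_ge key ⟨le_rfl, Set.subset_union_left⟩
  exact fun y hy => hle.2 (Or.inr hy)

theorem left_injective : Function.Injective (left : MaxBiclique G X Y → Set V) := fun _ _ h =>
  Subtype.ext (Prod.ext h
    (Set.Subset.antisymm (right_subset_of_left_eq h.symm) (right_subset_of_left_eq h)))

/-- The order of the Galois lattice without its top and bottom: `B ≤ B'` iff `X(B) ⊆ X(B')`. -/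
instance : PartialOrder (MaxBiclique G X Y) := PartialOrder.lift left left_injective

end MaxBiclique

/-- `B` is the introducer of the vertex `v`: the lowest maximal biclique containing `v` if
`v ∈ X`, the highest one if `v ∈ Y`. -/
def IsIntroducer {G : SimpleGraph V} {X Y : Set V} (v : V) (B : MaxBiclique G X Y) : Prop :=
  (v ∈ X ∧ IsLeast {B' : MaxBiclique G X Y | v ∈ B'.left} B) ∨
    (v ∈ Y ∧ IsGreatest {B' : MaxBiclique G X Y | v ∈ B'.right} B)

end Graphs

/-! ### Reverses of pruning sequences -/

/-- The kind of a vertex addition: a pending vertex or a (false) twin. -/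
inductive StepKind
  | pending
  | twin

/-- The neighborhood of `u` among the vertices `v 0, …, v i`. -/
def stageNbhd {n : ℕ} (G : SimpleGraph (Fin n)) (v : Fin n → Fin n) (i : Fin n) (u : Fin n) :
    Set (Fin n) :=
  {w | G.Adj u w ∧ ∃ j ≤ i, v j = w}

/-- The triples `(v i, C i, v (k i))`, for `0 < i`, form the reverse of a pruning sequence of `G`:
the vertices `v 0, …, v (n - 1)` are all the vertices of `G`, each once, and, for every `0 < i`, in
the subgraph induced by `v 0, …, v i` the vertex `v i` is a pending vertex adjacent to `v (k i)` or
a false twin of `v (k i)`, as specified by `C i`. The values `C 0` and `k 0` play no role. -/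
structure IsReversePruningSequence {n : ℕ} (G : SimpleGraph (Fin n)) (v : Fin n → Fin n)
    (C : Fin n → StepKind) (k : Fin n → Fin n) : Prop where
  bijective : Function.Bijective v
  anchor_lt : ∀ i : Fin n, 0 < i.val → k i < i
  pending : ∀ i : Fin n, 0 < i.val → C i = StepKind.pending →
    stageNbhd G v i (v i) = {v (k i)}
  twin : ∀ i : Fin n, 0 < i.val → C i = StepKind.twin →
    stageNbhd G v i (v i) = stageNbhd G v i (v (k i)) ∧ v i ∉ stageNbhd G v i (v (k i))

/-! ### The machine model

A random access machine with finitely many registers (indexed by `R`) and finitely many arrays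
(indexed by `A`) of natural numbers. The only arithmetic operation is the successor, so that the
numbers in memory grow by at most one per unit of time. Every elementary operation (a constant, a
register access, an array access, a successor, a comparison, an assignment, a branch) takes one
unit of time. -/

/-- A memory state. -/
structure Memory (R A : Type) where
  reg : R → ℕ
  arr : A → ℕ → ℕ

/-- Expressions. -/
inductive Expr (R A : Type)
  | const (c : ℕ)
  | reg (x : R)
  | get (a : A) (e : Expr R A)
  | succ (e : Expr R A)

namespace Expr

variable {R A : Type}

/-- The value of an expression. -/
def eval (σ : Memory R A) : Expr R A → ℕ
  | const c => c
  | reg x => σ.reg x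
  | get a e => σ.arr a (e.eval σ)
  | succ e => e.eval σ + 1

/-- The time needed to evaluate an expression: the number of operations in it. -/
def cost : Expr R A → ℕ
  | const _ => 1
  | reg _ => 1
  | get _ e => e.cost + 1
  | succ e => e.cost + 1

end Expr

/-- Programs. -/
inductive Prog (R A : Type)
  | skip
  | assign (x : R) (e : Expr R A)
  | write (a : A) (i e : Expr R A)
  | seq (P Q : Prog R A)
  | ifEq (e e' : Expr R A) (P Q : Prog R A)
  | whileNe (e e' : Expr R A) (P : Prog R A)

/-- A sequence of programs, executed one after the other. -/
def Prog.block {R A : Type} : List (Prog R A) → Prog R A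
  | [] => Prog.skip
  | P :: Ps => Prog.seq P (Prog.block Ps)

section Semantics

variable {R A : Type} [DecidableEq R] [DecidableEq A]

/-- Setting a register. -/
def Memory.setReg (σ : Memory R A) (x : R) (c : ℕ) : Memory R A :=
  { σ with reg := Function.update σ.reg x c }

/-- Setting an array entry. -/
def Memory.setArr (σ : Memory R A) (a : A) (i c : ℕ) : Memory R A :=
  { σ with arr := Function.update σ.arr a (Function.update (σ.arr a) i c) }

/-- `Runs P σ σ' t`: started in `σ`, the program `P` halts in `σ'` after exactly `t` units of
time. -/
inductive Runs : Prog R A → Memory R A → Memory R A → ℕ → Prop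
  | skip (σ : Memory R A) : Runs Prog.skip σ σ 1
  | assign (σ : Memory R A) (x : R) (e : Expr R A) :
      Runs (Prog.assign x e) σ (σ.setReg x (e.eval σ)) (e.cost + 1)
  | write (σ : Memory R A) (a : A) (i e : Expr R A) :
      Runs (Prog.write a i e) σ (σ.setArr a (i.eval σ) (e.eval σ)) (i.cost + e.cost + 1)
  | seq {P Q : Prog R A} {σ σ' σ'' : Memory R A} {t t' : ℕ} :
      Runs P σ σ' t → Runs Q σ' σ'' t' → Runs (Prog.seq P Q) σ σ'' (t + t')
  | ifEq_true {e e' : Expr R A} {P Q : Prog R A} {σ σ' : Memory R A} {t : ℕ} :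
      e.eval σ = e'.eval σ → Runs P σ σ' t →
        Runs (Prog.ifEq e e' P Q) σ σ' (e.cost + e'.cost + 1 + t)
  | ifEq_false {e e' : Expr R A} {P Q : Prog R A} {σ σ' : Memory R A} {t : ℕ} :
      e.eval σ ≠ e'.eval σ → Runs Q σ σ' t →
        Runs (Prog.ifEq e e' P Q) σ σ' (e.cost + e'.cost + 1 + t)
  | whileNe_done {e e' : Expr R A} {P : Prog R A} {σ : Memory R A} :
      e.eval σ = e'.eval σ → Runs (Prog.whileNe e e' P) σ σ (e.cost + e'.cost + 1)
  | whileNe_step {e e' : Expr R A} {P : Prog R A} {σ σ' σ'' : Memory R A} {t t' : ℕ} :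
      e.eval σ ≠ e'.eval σ → Runs P σ σ' t → Runs (Prog.whileNe e e' P) σ' σ'' t' →
        Runs (Prog.whileNe e e' P) σ σ'' (e.cost + e'.cost + 1 + t + t')

/-- The machine is deterministic, so that its final state and its running time are well defined. -/
theorem Runs.deterministic {P : Prog R A} {σ σ₁ σ₂ : Memory R A} {t₁ t₂ : ℕ}
    (h₁ : Runs P σ σ₁ t₁) (h₂ : Runs P σ σ₂ t₂) : σ₁ = σ₂ ∧ t₁ = t₂ := by
  induction h₁ generalizing σ₂ t₂ with
  | skip | assign | write => cases h₂; exact ⟨rfl, rfl⟩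
  | seq _ _ ih ih' =>
    cases h₂ with
    | seq g g' =>
      obtain ⟨rfl, rfl⟩ := ih g
      obtain ⟨rfl, rfl⟩ := ih' g'
      exact ⟨rfl, rfl⟩
  | ifEq_true h _ ih =>
    cases h₂ with
    | ifEq_true _ g => obtain ⟨rfl, rfl⟩ := ih g; exact ⟨rfl, rfl⟩
    | ifEq_false h' _ => exact absurd h h'
  | ifEq_false h _ ih =>
    cases h₂ with
    | ifEq_true h' _ => exact absurd h' h
    | ifEq_false _ g => obtain ⟨rfl, rfl⟩ := ih g; exact ⟨rfl, rfl⟩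
  | whileNe_done h =>
    cases h₂ with
    | whileNe_done _ => exact ⟨rfl, rfl⟩
    | whileNe_step h' _ _ => exact absurd h h'
  | whileNe_step h _ _ ih ih' =>
    cases h₂ with
    | whileNe_done h' => exact absurd h' h
    | whileNe_step _ g g' =>
      obtain ⟨rfl, rfl⟩ := ih g
      obtain ⟨rfl, rfl⟩ := ih' g'
      exact ⟨rfl, rfl⟩

end Semantics

/-! ### The algorithm -/

/-- The registers: `n` is the number of vertices, `i` the main loop counter, `v` and `k` the
current vertex and the vertex it is attached to, `b` and `c` references to bicliques, `p` the
number of bicliques created so far, `qh` and `qt` the ends of the queue, `cur` a reference into a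
linked list and `free` the next unused list cell. -/
inductive Reg
  | n | i | v | k | b | c | p | qh | qt | cur | free
  deriving DecidableEq

/-- The arrays: the input triples `inV`, `inC`, `inK`; for each vertex its shore (`0` for `X` and
`1` for `Y`) and a reference `introd` to its introducer; for each biclique `B` the heads `xs`, `ys`
of the lists of the vertices in `X(B)` and in `Y(B)`, and the heads `ups`, `downs` of the lists of
the bicliques that cover `B` and that are covered by `B`; the contents `item` and successors `link`
of the cells of all these lists (the reference `0` being the empty list); and a queue. -/
inductive Arr
  | inV | inC | inK | shore | introd | xs | ys | ups | downs | item | link | queue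
  deriving DecidableEq

/-- Add `e` to the list whose head is entry `b` of the array `hd`. -/
def push (hd : Arr) (b e : Expr Reg Arr) : Prog Reg Arr :=
  .block [
    .write .item (.reg .free) e,
    .write .link (.reg .free) (.get hd b),
    .write hd b (.reg .free),
    .assign .free (.succ (.reg .free))]

/-- Make all four lists of the biclique `b` empty. -/
def newBiclique (b : Expr Reg Arr) : Prog Reg Arr :=
  .block [
    .write .xs b (.const 0),
    .write .ys b (.const 0),
    .write .ups b (.const 0),
    .write .downs b (.const 0)]

/-- Lines 1 to 3: `H` is the single biclique `({v₁}, {v₂})`, introducer of `v₁` and of `v₂`, where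
`(v₂, C₂, v₁)` is the first triple. -/
def startPhase : Prog Reg Arr :=
  .block [
    .assign .k (.get .inK (.const 1)),
    .assign .v (.get .inV (.const 1)),
    .write .shore (.reg .k) (.const 0),
    .write .shore (.reg .v) (.const 1),
    .assign .free (.const 1),
    newBiclique (.const 0),
    .assign .p (.const 1),
    push .xs (.const 0) (.reg .k),
    push .ys (.const 0) (.reg .v),
    .write .introd (.reg .k) (.const 0),
    .write .introd (.reg .v) (.const 0)]

/-- Addition of a twin `v` of `k`: starting from `b`, the introducer of `k`, the diagram is
traversed along the arcs in `fwd`, and `v` is added to the shore `own` of each biclique met. -/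
def addTwin (own fwd : Arr) : Prog Reg Arr :=
  .block [
    .write .queue (.const 0) (.reg .b),
    .assign .qh (.const 0),
    .assign .qt (.const 1),
    .whileNe (.reg .qh) (.reg .qt) (.block [
      .assign .c (.get .queue (.reg .qh)),
      .assign .qh (.succ (.reg .qh)),
      push own (.reg .c) (.reg .v),
      .assign .cur (.get fwd (.reg .c)),
      .whileNe (.reg .cur) (.const 0) (.block [
        .write .queue (.reg .qt) (.get .item (.reg .cur)),
        .assign .qt (.succ (.reg .qt)),
        .assign .cur (.get .link (.reg .cur))])]),
    .write .introd (.reg .v) (.get .introd (.reg .k))]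

/-- Addition of a pending vertex `v` adjacent to `k`, where `b` is the introducer of `k`. If the
shore `other` of `b` has only one element, `v` is added to the shore `own` of `b`. Otherwise a new
biclique `c` is created, whose shore `own` is that of `b` with `v` added and whose shore `other` is
`{k}`; it is linked to `b` by an arc of type `fwd` from `b` to `c`. -/
def addPending (own other fwd bwd : Arr) : Prog Reg Arr :=
  .ifEq (.get .link (.get other (.reg .b))) (.const 0)
    (.block [
      push own (.reg .b) (.reg .v),
      .write .introd (.reg .v) (.get .introd (.reg .k))])
    (.block [
      .assign .c (.reg .p),
      .assign .p (.succ (.reg .p)),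
      newBiclique (.reg .c),
      .assign .cur (.get own (.reg .b)),
      .whileNe (.reg .cur) (.const 0) (.block [
        push own (.reg .c) (.get .item (.reg .cur)),
        .assign .cur (.get .link (.reg .cur))]),
      push own (.reg .c) (.reg .v),
      push other (.reg .c) (.reg .k),
      push fwd (.reg .b) (.reg .c),
      push bwd (.reg .c) (.reg .b),
      .write .introd (.reg .k) (.reg .c),
      .write .introd (.reg .v) (.reg .c)])

/-- The body of the main loop. The shore of the new vertex `v` is that of `k` if `v` is a twin of
`k` (kind `1`), and the opposite one if `v` is pending (kind `0`); the two shores are treated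
symmetrically, with upward and downward arcs exchanged. -/
def loopBody : Prog Reg Arr :=
  .block [
    .assign .v (.get .inV (.reg .i)),
    .assign .k (.get .inK (.reg .i)),
    .assign .b (.get .introd (.reg .k)),
    .ifEq (.get .inC (.reg .i)) (.const 1)
      (.ifEq (.get .shore (.reg .k)) (.const 0)
        (.block [.write .shore (.reg .v) (.const 0), addTwin .xs .ups])
        (.block [.write .shore (.reg .v) (.const 1), addTwin .ys .downs]))
      (.ifEq (.get .shore (.reg .k)) (.const 0)
        (.block [.write .shore (.reg .v) (.const 1), addPending .ys .xs .downs .ups])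
        (.block [.write .shore (.reg .v) (.const 0), addPending .xs .ys .ups .downs])),
    .assign .i (.succ (.reg .i))]

/-- The algorithm ComputeBDHDiagram. -/
def computeBDHDiagram : Prog Reg Arr :=
  .block [
    startPhase,
    .assign .i (.const 2),
    .whileNe (.reg .i) (.reg .n) loopBody]

/-! ### Input and output -/

/-- The code of the kind of an addition. -/
def StepKind.code : StepKind → ℕ
  | .pending => 0
  | .twin => 1

/-- The memory `σ` contains the number of vertices and the triples `(v i, C i, v (k i))` for
`0 < i < n`. Nothing is assumed about the rest of the memory. -/
structure HoldsInput {n : ℕ} (v : Fin n → Fin n) (C : Fin n → StepKind) (k : Fin n → Fin n)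
    (σ : Memory Reg Arr) : Prop where
  size : σ.reg .n = n
  vertex : ∀ i : Fin n, 0 < i.val → σ.arr .inV i = v i
  kind : ∀ i : Fin n, 0 < i.val → σ.arr .inC i = (C i).code
  anchor : ∀ i : Fin n, 0 < i.val → σ.arr .inK i = v (k i)

/-- The linked list starting from reference `a` in `σ` has the entries `l`. -/
inductive IsLinkedList (σ : Memory Reg Arr) : ℕ → List ℕ → Prop
  | nil : IsLinkedList σ 0 []
  | cons {a : ℕ} {l : List ℕ} : a ≠ 0 → IsLinkedList σ (σ.arr .link a) l →
      IsLinkedList σ a (σ.arr .item a :: l)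

/-- The linked list starting from reference `a` in `σ` lists the elements of `S`, each once. -/
def ListsSet (σ : Memory Reg Arr) (a : ℕ) (S : Set ℕ) : Prop :=
  ∃ l : List ℕ, IsLinkedList σ a l ∧ l.Nodup ∧ ∀ s, s ∈ l ↔ s ∈ S

/-- The memory `σ` contains an explicit description of the Hasse diagram of the poset of maximal
bicliques of `G`: the maximal bicliques are numbered, each once, by `0, …, p - 1`, and for each of
them there are lists of the vertices of its two shores, of the maximal bicliques that cover it and
of those it covers; moreover, for each vertex, there is the number of its introducer. -/
def HoldsDiagram {n : ℕ} (G : SimpleGraph (Fin n)) (X Y : Set (Fin n)) (σ : Memory Reg Arr) :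
    Prop :=
  ∃ β : Fin (σ.reg .p) ≃ MaxBiclique G X Y,
    (∀ b : Fin (σ.reg .p), ListsSet σ (σ.arr .xs b) (Fin.val '' (β b).left)) ∧
    (∀ b : Fin (σ.reg .p), ListsSet σ (σ.arr .ys b) (Fin.val '' (β b).right)) ∧
    (∀ b : Fin (σ.reg .p), ListsSet σ (σ.arr .ups b) (Fin.val '' {c | β b ⋖ β c})) ∧
    (∀ b : Fin (σ.reg .p), ListsSet σ (σ.arr .downs b) (Fin.val '' {c | β c ⋖ β b})) ∧
    (∀ v : Fin n, ∃ b : Fin (σ.reg .p), σ.arr .introd v = b ∧ IsIntroducer v (β b))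

end BDH

/-! The proof follows the graphs G_i and maintains three things: the correctness of the diagram, the
shape of its order, and an account of the time spent.

Correctness is the invariant `IsDiagram`. The listed pairs of shores determine each other as common
neighborhoods (`closed`), every biclique lies in a listed pair (`complete`), there are no
repetitions, and the introducer of u is the pair whose opposite shore is the whole neighborhood
N(u). Shores are indexed by a Boolean; flipping it reverses the order, so one argument serves X and
Y. A twin v of k joins every biclique that contains k. The shores opposite to v do not change, hence
neither do the order and the covers (`IsDiagram.twin`, `IsDiagram.cov_twin`). A vertex v pending at
k produces the biclique with shores N(k) ∪ {v} and {k}. The only old biclique that can cease to be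
maximal is one with shore {k}, which must be the introducer of k and is then overwritten; otherwise
the new biclique is an extreme element of the order, joined by a cover to the introducer of k only
(`IsDiagram.pending`, `IsDiagram.cov_pending_new`).

The shape of the order is the field `chain`: every interval is a chain. Both operations preserve it.
It implies that a biclique cannot be reached from a fixed one along two different sequences of
covers, so the traversal for a twin needs no marks and still meets every biclique once
(`IsQueue.step`).

For the time, a twin of k costs a multiple of the number of bicliques containing k, and brings deg k
new edges. A pending vertex brings a single edge, but may cost a copy of N(k). This copy is paid in
advance: the vertices in a set F hold a credit proportional to their degree, and a vertex outside F
has an introducer with shore {k}, for which nothing is copied. After a copy, k leaves F; it returns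
when it acquires a twin, whose edges pay for the new credits. The same set F bounds the traversals,
by the invariant that the number of bicliques containing u plus |N(u) ∩ F| is at most 2 deg u: a
copy puts each neighbor of k in one more biclique, but removes k from its credited neighbors
(`IsCredit.twin`, `IsCredit.pending`). With the potential 22 times the degree sum of F, each
addition is paid for by the increase of the degree sum of the graph (`halts_addVertex`), which ends
at 2m. -/

namespace BDH

set_option linter.unusedSectionVars false

/-! ### Diagrams of stages, on natural numbers -/

section Stages

/-- The neighborhood of `u` in the subgraph induced by `W`. -/
def nb (adj : ℕ → ℕ → Prop) [DecidableRel adj] (W : Finset ℕ) (u : ℕ) : Finset ℕ :=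
  W.filter (adj u)

/-- `side` tells the shores of a bipartition of the graph with adjacency `adj`. -/
structure IsShoring (adj : ℕ → ℕ → Prop) (side : ℕ → Bool) : Prop where
  symm : ∀ {u w}, adj u w → adj w u
  side_adj : ∀ {u w}, adj u w → side w = !side u

/-- `mem s 0, …, mem s (p - 1)` are the shores of kind `s` of the maximal bicliques of the graph
induced by `W`, in which each interval is a chain, and `I` gives the introducers. -/
structure IsDiagram (adj : ℕ → ℕ → Prop) [DecidableRel adj] (side : ℕ → Bool) (W : Finset ℕ)
    (p : ℕ) (mem : Bool → ℕ → Finset ℕ) (I : ℕ → ℕ) : Prop where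
  subset : ∀ s, ∀ b < p, mem s b ⊆ W
  side_eq : ∀ s, ∀ b < p, ∀ u ∈ mem s b, side u = s
  nonempty : ∀ s, ∀ b < p, (mem s b).Nonempty
  closed : ∀ s, ∀ b < p, ∀ w, w ∈ mem s b ↔ w ∈ W ∧ ∀ u ∈ mem (!s) b, adj u w
  complete : ∀ s (A B : Finset ℕ), A.Nonempty → B.Nonempty → A ⊆ W → B ⊆ W →
    (∀ a ∈ A, side a = s) → (∀ a ∈ A, ∀ b ∈ B, adj a b) →
      ∃ b < p, A ⊆ mem s b ∧ B ⊆ mem (!s) b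
  inj : ∀ s, ∀ b < p, ∀ c < p, mem s b = mem s c → b = c
  introd_lt : ∀ u ∈ W, I u < p
  introd_opp : ∀ u ∈ W, mem (!side u) (I u) = nb adj W u
  chain : ∀ s, ∀ b < p, ∀ c₁ < p, ∀ c₂ < p, ∀ d < p, mem s b ⊆ mem s c₁ → mem s b ⊆ mem s c₂ →
    mem s c₁ ⊆ mem s d → mem s c₂ ⊆ mem s d → mem s c₁ ⊆ mem s c₂ ∨ mem s c₂ ⊆ mem s c₁

/-- In the order of the shores of kind `s`, the biclique `c` covers the biclique `b`. -/
def Cov (p : ℕ) (mem : Bool → ℕ → Finset ℕ) (s : Bool) (b c : ℕ) : Prop :=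
  b < p ∧ c < p ∧ mem s b ⊂ mem s c ∧ ∀ d < p, mem s b ⊂ mem s d → ¬ mem s d ⊂ mem s c

/-- The vertex `v` outside `W` is pending at `k`. -/
structure PendingAt (adj : ℕ → ℕ → Prop) (W : Finset ℕ) (v k : ℕ) : Prop where
  notMem : v ∉ W
  mem : k ∈ W
  adj_iff : ∀ w ∈ W, adj v w ↔ w = k

/-- The vertex `v` outside `W` is a twin of `k`. -/
structure TwinAt (adj : ℕ → ℕ → Prop) (W : Finset ℕ) (v k : ℕ) : Prop where
  notMem : v ∉ W
  mem : k ∈ W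
  adj_iff : ∀ w ∈ W, adj v w ↔ adj k w

variable {adj : ℕ → ℕ → Prop} [DecidableRel adj] {side : ℕ → Bool} {W F : Finset ℕ} {p : ℕ}
  {mem : Bool → ℕ → Finset ℕ} {I : ℕ → ℕ} {v k : ℕ}

theorem mem_nb {u w : ℕ} : w ∈ nb adj W u ↔ w ∈ W ∧ adj u w := by simp [nb]

theorem IsShoring.irrefl (hS : IsShoring adj side) (u : ℕ) : ¬ adj u u := fun h => by
  have := hS.side_adj h
  simp at this

/-- Enlarging a set shrinks its common neighborhood: `closed` makes the two shores a Galois pair, so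
either of them determines the order. It is stated from `closed` alone because it is needed while an
`IsDiagram` is still being built. -/
theorem opp_subset_of_closed
    (hc : ∀ s, ∀ b < p, ∀ w, w ∈ mem s b ↔ w ∈ W ∧ ∀ u ∈ mem (!s) b, adj u w) (s : Bool)
    {b c : ℕ} (hb : b < p) (hcp : c < p) (h : mem s b ⊆ mem s c) :
    mem (!s) c ⊆ mem (!s) b := by
  intro w hw
  rw [hc _ _ hcp] at hw
  rw [hc _ _ hb]
  refine ⟨hw.1, fun u hu => hw.2 u ?_⟩
  rw [Bool.not_not] at hu ⊢
  exact h hu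

theorem opp_subset_iff_of_closed
    (hc : ∀ s, ∀ b < p, ∀ w, w ∈ mem s b ↔ w ∈ W ∧ ∀ u ∈ mem (!s) b, adj u w) (s : Bool)
    {b c : ℕ} (hb : b < p) (hcp : c < p) : mem (!s) c ⊆ mem (!s) b ↔ mem s b ⊆ mem s c := by
  refine ⟨fun h => ?_, opp_subset_of_closed hc s hb hcp⟩
  have := opp_subset_of_closed hc (!s) hcp hb h
  rwa [Bool.not_not] at this

theorem IsDiagram.opp_subset_iff (h : IsDiagram adj side W p mem I) (s : Bool) {b c : ℕ}
    (hb : b < p) (hc : c < p) : mem (!s) c ⊆ mem (!s) b ↔ mem s b ⊆ mem s c :=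
  opp_subset_iff_of_closed h.closed s hb hc

theorem IsDiagram.opp_ssubset_iff (h : IsDiagram adj side W p mem I) (s : Bool) {b c : ℕ}
    (hb : b < p) (hc : c < p) : mem (!s) c ⊂ mem (!s) b ↔ mem s b ⊂ mem s c := by
  rw [ssubset_iff_subset_not_subset, ssubset_iff_subset_not_subset, h.opp_subset_iff s hb hc,
    h.opp_subset_iff s hc hb]

/-- The Galois duality carries covers to reversed covers. Hence the upward and downward lists of the
machine are the two instances of one notion. -/
theorem IsDiagram.cov_not (h : IsDiagram adj side W p mem I) (s : Bool) {b c : ℕ} :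
    Cov p mem (!s) b c ↔ Cov p mem s c b := by
  constructor
  · rintro ⟨hb, hc, hbc, hd⟩
    refine ⟨hc, hb, (h.opp_ssubset_iff s hc hb).1 hbc, fun d hdp h1 h2 => hd d hdp ?_ ?_⟩
    · exact (h.opp_ssubset_iff s hdp hb).2 h2
    · exact (h.opp_ssubset_iff s hc hdp).2 h1
  · rintro ⟨hc, hb, hbc, hd⟩
    refine ⟨hb, hc, (h.opp_ssubset_iff s hc hb).2 hbc, fun d hdp h1 h2 => hd d hdp ?_ ?_⟩
    · exact (h.opp_ssubset_iff s hc hdp).1 h2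
    · exact (h.opp_ssubset_iff s hdp hb).1 h1

/-- It suffices to check the symmetric properties of a diagram for one of the shores. -/
theorem IsDiagram.of_side (s : Bool)
    (subset : ∀ s, ∀ b < p, mem s b ⊆ W)
    (side_eq : ∀ s, ∀ b < p, ∀ u ∈ mem s b, side u = s)
    (nonempty : ∀ s, ∀ b < p, (mem s b).Nonempty)
    (closed : ∀ s, ∀ b < p, ∀ w, w ∈ mem s b ↔ w ∈ W ∧ ∀ u ∈ mem (!s) b, adj u w)
    (hS : IsShoring adj side)
    (complete : ∀ (A B : Finset ℕ), A.Nonempty → B.Nonempty → A ⊆ W → B ⊆ W →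
      (∀ a ∈ A, side a = s) → (∀ a ∈ A, ∀ b ∈ B, adj a b) →
        ∃ b < p, A ⊆ mem s b ∧ B ⊆ mem (!s) b)
    (inj : ∀ b < p, ∀ c < p, mem s b = mem s c → b = c)
    (introd_lt : ∀ u ∈ W, I u < p)
    (introd_opp : ∀ u ∈ W, mem (!side u) (I u) = nb adj W u)
    (chain : ∀ b < p, ∀ c₁ < p, ∀ c₂ < p, ∀ d < p, mem s b ⊆ mem s c₁ → mem s b ⊆ mem s c₂ →
      mem s c₁ ⊆ mem s d → mem s c₂ ⊆ mem s d → mem s c₁ ⊆ mem s c₂ ∨ mem s c₂ ⊆ mem s c₁) :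
    IsDiagram adj side W p mem I := by
  have hop := fun {b c : ℕ} (hb : b < p) (hc : c < p) => opp_subset_iff_of_closed closed s hb hc
  refine ⟨subset, side_eq, nonempty, closed, fun t => ?_, fun t => ?_, introd_lt, introd_opp,
    fun t => ?_⟩
  · rcases Bool.eq_or_eq_not t s with rfl | rfl
    · exact complete
    · intro A B hA hB hAW hBW hs hadj
      obtain ⟨a, ha⟩ := hA
      obtain ⟨b, hb, h1, h2⟩ := complete B A hB ⟨a, ha⟩ hBW hAW
        (fun b hb => by rw [hS.side_adj (hadj a ha b hb), hs a ha, Bool.not_not])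
        (fun b hb a ha => hS.symm (hadj a ha b hb))
      exact ⟨b, hb, h2, by rwa [Bool.not_not]⟩
  · rcases Bool.eq_or_eq_not t s with rfl | rfl
    · exact inj
    · intro b hb c hc h
      exact inj b hb c hc (Finset.Subset.antisymm ((hop hb hc).1 h.ge) ((hop hc hb).1 h.le))
  · rcases Bool.eq_or_eq_not t s with rfl | rfl
    · exact chain
    · intro b hb c₁ h₁ c₂ h₂ d hd hb1 hb2 h1d h2d
      rw [hop h₁ hb] at hb1
      rw [hop h₂ hb] at hb2
      rw [hop hd h₁] at h1d
      rw [hop hd h₂] at h2d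
      rw [hop h₂ h₁, hop h₁ h₂]
      exact (chain d hd c₁ h₁ c₂ h₂ b hb h1d h2d hb1 hb2).symm

theorem IsDiagram.mem_introd (h : IsDiagram adj side W p mem I) (hS : IsShoring adj side) {u : ℕ}
    (hu : u ∈ W) : u ∈ mem (side u) (I u) := by
  rw [h.closed _ _ (h.introd_lt u hu), h.introd_opp u hu]
  exact ⟨hu, fun w hw => hS.symm (mem_nb.1 hw).2⟩

theorem IsDiagram.nb_nonempty (h : IsDiagram adj side W p mem I) {u : ℕ}
    (hu : u ∈ W) : (nb adj W u).Nonempty := by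
  rw [← h.introd_opp u hu]
  exact h.nonempty _ _ (h.introd_lt u hu)

/-- The introducer of `u` is the lowest biclique containing `u`. -/
theorem IsDiagram.introd_subset_iff (h : IsDiagram adj side W p mem I) (hS : IsShoring adj side)
    {u b : ℕ} (hu : u ∈ W) (hb : b < p) :
    mem (side u) (I u) ⊆ mem (side u) b ↔ u ∈ mem (side u) b := by
  refine ⟨fun h' => h' (h.mem_introd hS hu), fun h' => ?_⟩
  rw [← h.opp_subset_iff _ (h.introd_lt u hu) hb, h.introd_opp u hu]
  intro w hw
  rw [mem_nb]
  refine ⟨h.subset _ _ hb hw, ?_⟩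
  rw [h.closed _ _ hb] at hw
  exact hw.2 u (by rwa [Bool.not_not])

/-- Every pair of comparable bicliques is joined by a chain of covers. -/
theorem IsDiagram.closure_cov (h : IsDiagram adj side W p mem I) (s : Bool) {S : ℕ → Prop}
    {b c : ℕ} (hb : b < p) (hc : c < p) (hbc : mem s b ⊆ mem s c) (hSb : S b)
    (hS : ∀ c d, S c → Cov p mem s c d → S d) : S c := by
  induction hm : (mem s c).card using Nat.strong_induction_on generalizing c with
  | _ m ih =>
    by_cases hne : b = c
    · rwa [← hne]
    have hlt : mem s b ⊂ mem s c :=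
      hbc.ssubset_of_ne fun he => hne (h.inj s b hb c hc he)
    -- A biclique of largest shore among those from `b` up to, but not including, `c` is covered by
    -- `c`; the induction hypothesis reaches it.
    obtain ⟨d, hd, hmax⟩ := ((Finset.range p).filter
      (fun d => mem s b ⊆ mem s d ∧ mem s d ⊂ mem s c)).exists_max_image
        (fun d => (mem s d).card) ⟨b, by simp [hb, hlt]⟩
    simp only [Finset.mem_filter, Finset.mem_range] at hd hmax
    obtain ⟨hdp, hbd, hdc⟩ := hd
    refine hS d c (ih _ (hm ▸ Finset.card_lt_card hdc) hdp hbd rfl) ⟨hdp, hc, hdc, ?_⟩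
    intro e he hde hec
    exact absurd (hmax e ⟨he, hbd.trans hde.subset, hec⟩)
      (not_le.2 (Finset.card_lt_card hde))

/-- Diagrams which agree on one shore have the same covers. -/
theorem IsDiagram.cov_congr {W' : Finset ℕ} {mem' : Bool → ℕ → Finset ℕ} {I' : ℕ → ℕ}
    (h : IsDiagram adj side W p mem I)
    (h' : IsDiagram adj side W' p mem' I') (s : Bool) (he : ∀ b < p, mem' s b = mem s b)
    (t : Bool) (b c : ℕ) : Cov p mem' t b c ↔ Cov p mem t b c := by
  have key : ∀ b c, Cov p mem' s b c ↔ Cov p mem s b c := by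
    intro b c
    unfold Cov
    refine and_congr_right fun hb => and_congr_right fun hc => ?_
    rw [he b hb, he c hc]
    refine and_congr_right fun _ => forall_congr' fun d => imp_congr_right fun hd => ?_
    rw [he d hd]
  rcases Bool.eq_or_eq_not t s with rfl | rfl
  · exact key b c
  · rw [h.cov_not, h'.cov_not, key]

/-! #### Addition of a twin -/

/-- A common neighbor fixes both sides. It exists because the introducer of `k` has a nonempty
opposite shore, so no vertex of a stage is isolated. -/
theorem TwinAt.side_eq (hT : TwinAt adj W v k) (hS : IsShoring adj side)
    (h : IsDiagram adj side W p mem I) : side v = side k := by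
  obtain ⟨w, hw⟩ := h.nb_nonempty hT.mem
  rw [mem_nb] at hw
  have h1 := hS.side_adj hw.2
  have h2 := hS.side_adj ((hT.adj_iff w hw.1).2 hw.2)
  rw [h1] at h2
  exact (Bool.not_inj h2).symm

/-- The shores of the bicliques after the addition of a twin `v` of `k`. -/
def twinMem (mem : Bool → ℕ → Finset ℕ) (v k : ℕ) (t : Bool) (b : ℕ) : Finset ℕ :=
  if k ∈ mem t b then insert v (mem t b) else mem t b

theorem mem_twinMem {t : Bool} {b x : ℕ} :
    x ∈ twinMem mem v k t b ↔ x ∈ mem t b ∨ x = v ∧ k ∈ mem t b := by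
  unfold twinMem
  split_ifs with hk <;> simp [hk, or_comm]

theorem TwinAt.nb_self (hT : TwinAt adj W v k) (hS : IsShoring adj side) :
    nb adj (insert v W) v = nb adj W k := by
  ext w
  simp only [mem_nb, Finset.mem_insert]
  constructor
  · rintro ⟨rfl | hw, ha⟩
    · exact absurd ha (hS.irrefl _)
    · exact ⟨hw, (hT.adj_iff w hw).1 ha⟩
  · rintro ⟨hw, ha⟩
    exact ⟨Or.inr hw, (hT.adj_iff w hw).2 ha⟩

theorem TwinAt.not_adj (hT : TwinAt adj W v k) (hS : IsShoring adj side) : ¬ adj k v := fun ha =>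
  hS.irrefl k ((hT.adj_iff k hT.mem).1 (hS.symm ha))

theorem TwinAt.adj_iff' (hT : TwinAt adj W v k) (hS : IsShoring adj side) {u : ℕ} (hu : u ∈ W) :
    adj u v ↔ adj u k :=
  ⟨fun h => hS.symm ((hT.adj_iff u hu).1 (hS.symm h)),
    fun h => hS.symm ((hT.adj_iff u hu).2 (hS.symm h))⟩

theorem TwinAt.nb_anchor (hT : TwinAt adj W v k) (hS : IsShoring adj side) :
    nb adj (insert v W) k = nb adj W k := by
  rw [nb, Finset.filter_insert, if_neg (hT.not_adj hS), nb]

/-- Replacing `v` by `k` maps the new graph onto the old one and preserves adjacency, so bicliques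
correspond. Inclusions between shores are the same before and after, and `inj` and `chain` carry
over. -/
theorem IsDiagram.twin (h : IsDiagram adj side W p mem I) (hS : IsShoring adj side)
    (hT : TwinAt adj W v k) :
    IsDiagram adj side (insert v W) p (twinMem mem v k) (Function.update I v (I k)) := by
  have hsv := hT.side_eq hS h
  have hvm : ∀ s, ∀ b < p, v ∉ mem s b := fun s b hb hv => hT.notMem (h.subset s b hb hv)
  have hclosed : ∀ s, ∀ b < p, ∀ w, w ∈ twinMem mem v k s b ↔
      w ∈ insert v W ∧ ∀ u ∈ twinMem mem v k (!s) b, adj u w := by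
    intro s b hb w
    simp only [mem_twinMem, Finset.mem_insert]
    by_cases hw : w = v
    · subst hw
      have h1 : w ∉ mem s b := hvm s b hb
      simp only [h1, false_or, true_and, true_or]
      rw [h.closed s b hb]
      constructor
      · rintro ⟨hk, hu⟩ u (hu' | ⟨rfl, hk'⟩)
        · exact (hT.adj_iff' hS (h.subset _ b hb hu')).2 (hu u hu')
        · exact absurd (hu k hk') (hS.irrefl k)
      · intro hu
        exact ⟨hT.mem, fun u hu' => (hT.adj_iff' hS (h.subset _ b hb hu')).1 (hu u (Or.inl hu'))⟩
    · simp only [hw, false_and, or_false, false_or]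
      rw [h.closed s b hb]
      refine and_congr_right fun hwW => ⟨?_, fun hu u hu' => hu u (Or.inl hu')⟩
      rintro hu u (hu' | ⟨rfl, hk⟩)
      · exact hu u hu'
      · exact (hT.adj_iff w hwW).2 (hu k hk)
  have hsub : ∀ s, ∀ b < p, ∀ c < p, twinMem mem v k s b ⊆ twinMem mem v k s c →
      mem s b ⊆ mem s c := by
    intro s b hb c hc hsub x hx
    rcases mem_twinMem.1 (hsub (mem_twinMem.2 (Or.inl hx))) with h1 | ⟨rfl, -⟩
    · exact h1
    · exact absurd hx (hvm s b hb)
  have hsub' : ∀ s b c, mem s b ⊆ mem s c → twinMem mem v k s b ⊆ twinMem mem v k s c := by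
    intro s b c hbc x hx
    rcases mem_twinMem.1 hx with h1 | ⟨h1, h2⟩
    · exact mem_twinMem.2 (Or.inl (hbc h1))
    · exact mem_twinMem.2 (Or.inr ⟨h1, hbc h2⟩)
  refine ⟨?_, ?_, ?_, hclosed, ?_, ?_, ?_, ?_, ?_⟩
  · intro s b hb x hx
    rcases mem_twinMem.1 hx with h1 | ⟨rfl, -⟩
    · exact Finset.mem_insert_of_mem (h.subset s b hb h1)
    · exact Finset.mem_insert_self _ _
  · intro s b hb x hx
    rcases mem_twinMem.1 hx with h1 | ⟨rfl, h2⟩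
    · exact h.side_eq s b hb x h1
    · rw [hsv, h.side_eq s b hb k h2]
  · intro s b hb
    exact (h.nonempty s b hb).mono fun x hx => mem_twinMem.2 (Or.inl hx)
  · intro s A B hA hB hAW hBW hs hadj
    -- The retraction onto the old graph: an arbitrary biclique is pushed down by `f`, enclosed in
    -- an old maximal one, and pulled back.
    set f : ℕ → ℕ := fun x => if x = v then k else x with hf
    have hfW : ∀ x ∈ insert v W, f x ∈ W := by
      intro x hx
      simp only [hf]
      split_ifs with hxv
      · exact hT.mem
      · exact (Finset.mem_insert.1 hx).resolve_left hxv
    have hfm : ∀ t b x, f x ∈ mem t b → x ∈ twinMem mem v k t b := by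
      intro t b x hx
      simp only [hf] at hx
      rw [mem_twinMem]
      split_ifs at hx with hxv
      · exact Or.inr ⟨hxv, hx⟩
      · exact Or.inl hx
    obtain ⟨b, hb, h1, h2⟩ := h.complete s (A.image f) (B.image f) (hA.image f) (hB.image f)
      (fun x hx => by
        obtain ⟨a, ha, rfl⟩ := Finset.mem_image.1 hx
        exact hfW a (hAW ha))
      (fun x hx => by
        obtain ⟨a, ha, rfl⟩ := Finset.mem_image.1 hx
        exact hfW a (hBW ha))
      (fun x hx => by
        obtain ⟨a, ha, rfl⟩ := Finset.mem_image.1 hx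
        simp only [hf]
        split_ifs with hav
        · rw [← hsv, ← hav, hs a ha]
        · exact hs a ha)
      (fun x hx y hy => by
        obtain ⟨a, ha, rfl⟩ := Finset.mem_image.1 hx
        obtain ⟨c, hc, rfl⟩ := Finset.mem_image.1 hy
        have hac := hadj a ha c hc
        simp only [hf]
        split_ifs with h1 h2 h2
        · rw [h1, h2] at hac
          exact absurd hac (hS.irrefl v)
        · rw [h1] at hac
          exact (hT.adj_iff c ((Finset.mem_insert.1 (hBW hc)).resolve_left h2)).1 hac
        · rw [h2] at hac
          exact (hT.adj_iff' hS ((Finset.mem_insert.1 (hAW ha)).resolve_left h1)).1 hac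
        · exact hac)
    exact ⟨b, hb, fun a ha => hfm _ _ _ (h1 (Finset.mem_image_of_mem f ha)),
      fun a ha => hfm _ _ _ (h2 (Finset.mem_image_of_mem f ha))⟩
  · intro s b hb c hc he
    exact h.inj s b hb c hc (Finset.Subset.antisymm (hsub s b hb c hc he.le)
      (hsub s c hc b hb he.ge))
  · intro u hu
    rcases eq_or_ne u v with rfl | huv
    · simpa using h.introd_lt k hT.mem
    · rw [Function.update_of_ne huv]
      exact h.introd_lt u ((Finset.mem_insert.1 hu).resolve_left huv)
  · intro u hu
    rcases eq_or_ne u v with rfl | huv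
    · rw [Function.update_self, hT.nb_self hS, hsv, ← h.introd_opp k hT.mem, twinMem, if_neg]
      intro hk
      have := h.side_eq _ _ (h.introd_lt k hT.mem) k hk
      simp at this
    · have huW := (Finset.mem_insert.1 hu).resolve_left huv
      rw [Function.update_of_ne huv]
      ext w
      rw [mem_twinMem, h.introd_opp u huW]
      simp only [mem_nb, Finset.mem_insert]
      constructor
      · rintro (h1 | ⟨rfl, h1⟩)
        · exact ⟨Or.inr h1.1, h1.2⟩
        · exact ⟨Or.inl rfl, (hT.adj_iff' hS huW).2 h1.2⟩
      · rintro ⟨rfl | h1, h2⟩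
        · exact Or.inr ⟨rfl, hT.mem, (hT.adj_iff' hS huW).1 h2⟩
        · exact Or.inl ⟨h1, h2⟩
  · intro s b hb c₁ h₁ c₂ h₂ d hd hb1 hb2 h1d h2d
    exact (h.chain s b hb c₁ h₁ c₂ h₂ d hd (hsub _ _ hb _ h₁ hb1) (hsub _ _ hb _ h₂ hb2)
      (hsub _ _ h₁ _ hd h1d) (hsub _ _ h₂ _ hd h2d)).imp (hsub' _ _ _) (hsub' _ _ _)

/-- The shores of the side opposite to `k` are unchanged, and one side suffices to determine the
covers. -/
theorem IsDiagram.cov_twin (h : IsDiagram adj side W p mem I) (hS : IsShoring adj side)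
    (hT : TwinAt adj W v k) (t : Bool) (b c : ℕ) :
    Cov p (twinMem mem v k) t b c ↔ Cov p mem t b c := by
  refine h.cov_congr (h.twin hS hT) (!side k) (fun b hb => ?_) t b c
  rw [twinMem, if_neg]
  intro hk
  have := h.side_eq _ _ hb k hk
  simp at this

/-! #### Addition of a pending vertex -/

/-- The shores of the bicliques after the addition of a vertex `v` pending at `k`, where `b₁` is the
number of the introducer of `v`, and `N` is the old neighborhood of `k`. -/
def pendingMem (side : ℕ → Bool) (mem : Bool → ℕ → Finset ℕ) (N : Finset ℕ) (v k b₁ : ℕ) (t : Bool)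
    (b : ℕ) : Finset ℕ :=
  if b = b₁ then (if t = side v then insert v N else {k}) else mem t b

/-- `b₁ < p'` is a number for the introducer of a vertex pending at `k`: the number of the introducer
of `k` if the latter has the shore `{k}` and a new number otherwise. -/
structure IsSlot (side : ℕ → Bool) (p : ℕ) (mem : Bool → ℕ → Finset ℕ) (k p' b₁ : ℕ) : Prop where
  lt : b₁ < p'
  le : p ≤ p'
  iff : ∀ b, b < p' ∧ b ≠ b₁ ↔ b < p ∧ mem (side k) b ≠ {k}

theorem IsSlot.eq_singleton {p' b₁ : ℕ} (hb₁ : IsSlot side p mem k p' b₁) (hb : b₁ < p) :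
    mem (side k) b₁ = {k} := by
  by_contra hne
  exact ((hb₁.iff b₁).2 ⟨hb, hne⟩).2 rfl

theorem IsDiagram.isSlot_introd (h : IsDiagram adj side W p mem I) (hk : k ∈ W)
    (he : mem (side k) (I k) = {k}) : IsSlot side p mem k p (I k) where
  lt := h.introd_lt k hk
  le := le_rfl
  iff b := and_congr_right fun hb => not_congr
    ⟨fun h' => h' ▸ he, fun h' => h.inj _ b hb _ (h.introd_lt k hk) (h'.trans he.symm)⟩

/-- The shore {k} forces the opposite shore to be N(k), as for the introducer. Thus at most one old
biclique can be superseded by a vertex pending at `k`, and its number is known. -/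
theorem IsDiagram.eq_introd_of_eq_singleton (h : IsDiagram adj side W p mem I) (hk : k ∈ W) {b : ℕ} (hb : b < p) (he : mem (side k) b = {k}) :
    b = I k := by
  refine h.inj (!side k) b hb _ (h.introd_lt k hk) ?_
  ext w
  rw [h.introd_opp k hk, h.closed _ _ hb, Bool.not_not, he, mem_nb]
  simp

theorem IsDiagram.isSlot_new (h : IsDiagram adj side W p mem I)
    (hk : k ∈ W) (he : mem (side k) (I k) ≠ {k}) : IsSlot side p mem k (p + 1) p where
  lt := p.lt_succ_self
  le := p.le_succ
  iff b := by
    constructor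
    · rintro ⟨h1, h2⟩
      have hb : b < p := by omega
      refine ⟨hb, fun h' => he ?_⟩
      rwa [← h.eq_introd_of_eq_singleton hk hb h']
    · rintro ⟨h1, -⟩
      omega

theorem PendingAt.adj_anchor (hP : PendingAt adj W v k) : adj v k := (hP.adj_iff k hP.mem).2 rfl

theorem PendingAt.side_eq (hP : PendingAt adj W v k) (hS : IsShoring adj side) :
    side k = !side v :=
  hS.side_adj hP.adj_anchor

theorem PendingAt.adj_iff' (hP : PendingAt adj W v k) (hS : IsShoring adj side) {u : ℕ}
    (hu : u ∈ W) : adj u v ↔ u = k :=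
  ⟨fun h => (hP.adj_iff u hu).1 (hS.symm h), fun h => hS.symm ((hP.adj_iff u hu).2 h)⟩

theorem PendingAt.nb_self (hP : PendingAt adj W v k) (hS : IsShoring adj side) :
    nb adj (insert v W) v = {k} := by
  ext w
  simp only [mem_nb, Finset.mem_insert, Finset.mem_singleton]
  constructor
  · rintro ⟨rfl | hw, ha⟩
    · exact absurd ha (hS.irrefl _)
    · exact (hP.adj_iff w hw).1 ha
  · rintro rfl
    exact ⟨Or.inr hP.mem, hP.adj_anchor⟩

theorem PendingAt.nb_anchor (hP : PendingAt adj W v k) (hS : IsShoring adj side) :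
    nb adj (insert v W) k = insert v (nb adj W k) := by
  rw [nb, Finset.filter_insert, if_pos (hS.symm hP.adj_anchor), nb]

theorem PendingAt.nb_of_ne (hP : PendingAt adj W v k) (hS : IsShoring adj side) {u : ℕ}
    (hu : u ∈ W) (huk : u ≠ k) : nb adj (insert v W) u = nb adj W u := by
  rw [nb, Finset.filter_insert, if_neg (fun h => huk ((hP.adj_iff' hS hu).1 h)), nb]

/-- The cases of reuse and of a new number are treated together through `IsSlot`: everything outside
`b₁` is an old biclique with a shore other than {k}, and is unchanged. On the side of `v`, the
biclique `b₁` is maximal, since it alone contains `v`. -/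
theorem IsDiagram.pending (h : IsDiagram adj side W p mem I) (hS : IsShoring adj side)
    (hP : PendingAt adj W v k) {p' b₁ : ℕ} (hb₁ : IsSlot side p mem k p' b₁) :
    IsDiagram adj side (insert v W) p' (pendingMem side mem (nb adj W k) v k b₁)
      (Function.update (Function.update I k b₁) v b₁) := by
  have hsk := hP.side_eq hS
  have hvk : v ≠ k := fun he => hP.notMem (he ▸ hP.mem)
  have hkv : (!side k) = side v := by rw [hsk, Bool.not_not]
  have hvm : ∀ s, ∀ b < p, v ∉ mem s b := fun s b hb hv => hP.notMem (h.subset s b hb hv)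
  have hold : ∀ b < p', b ≠ b₁ → b < p ∧ mem (side k) b ≠ {k} := fun b hb hne =>
    (hb₁.iff b).1 ⟨hb, hne⟩
  have hother : ∀ t b, b ≠ b₁ → pendingMem side mem (nb adj W k) v k b₁ t b = mem t b :=
    fun t b hb => by rw [pendingMem, if_neg hb]
  have hnew : pendingMem side mem (nb adj W k) v k b₁ (side v) b₁ = insert v (nb adj W k) := by
    simp [pendingMem]
  have hnew' : pendingMem side mem (nb adj W k) v k b₁ (!side v) b₁ = {k} := by
    simp [pendingMem]
  have hvN : v ∉ nb adj W k := fun hv => hP.notMem (mem_nb.1 hv).1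
  have hclosed : ∀ s, ∀ b < p', ∀ w, w ∈ pendingMem side mem (nb adj W k) v k b₁ s b ↔
      w ∈ insert v W ∧ ∀ u ∈ pendingMem side mem (nb adj W k) v k b₁ (!s) b, adj u w := by
    intro s b hb w
    by_cases hbb : b = b₁
    · subst hbb
      rcases Bool.eq_or_eq_not s (side v) with rfl | rfl
      · rw [hnew, hnew', ← hP.nb_anchor hS, mem_nb]
        simp
      · rw [hnew', Bool.not_not, hnew]
        simp only [Finset.mem_singleton, Finset.mem_insert]
        constructor
        · rintro rfl
          refine ⟨Or.inr hP.mem, ?_⟩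
          rintro u (rfl | hu)
          · exact hP.adj_anchor
          · exact hS.symm (mem_nb.1 hu).2
        · rintro ⟨rfl | hw, hu⟩
          · exact absurd (hu w (Or.inl rfl)) (hS.irrefl w)
          · exact (hP.adj_iff w hw).1 (hu v (Or.inl rfl))
    · obtain ⟨hbp, hne⟩ := hold b hb hbb
      rw [hother _ _ hbb, hother _ _ hbb, h.closed s b hbp, Finset.mem_insert]
      constructor
      · rintro ⟨h1, h2⟩
        exact ⟨Or.inr h1, h2⟩
      · rintro ⟨rfl | hw, hu⟩
        -- An old biclique could absorb `v` only if its opposite shore were {k}, and such a biclique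
        -- is exactly what the slot has removed.
        · exfalso
          have hall : ∀ u ∈ mem (!s) b, u = k := fun u hu' =>
            (hP.adj_iff' hS (h.subset _ b hbp hu')).1 (hu u hu')
          have hs1 : mem (!s) b = {k} :=
            Finset.eq_singleton_iff_nonempty_unique_mem.2 ⟨h.nonempty _ b hbp, hall⟩
          have := h.side_eq _ b hbp k (by rw [hs1]; simp)
          rw [← this] at hs1
          exact hne hs1
        · exact ⟨hw, hu⟩
  refine IsDiagram.of_side (side v) ?_ ?_ ?_ hclosed hS ?_ ?_ ?_ ?_ ?_
  · intro s b hb x hx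
    exact ((hclosed s b hb x).1 hx).1
  · intro s b hb x hx
    by_cases hbb : b = b₁
    · subst hbb
      rcases Bool.eq_or_eq_not s (side v) with rfl | rfl
      · rw [hnew, Finset.mem_insert] at hx
        rcases hx with rfl | hx
        · rfl
        · rw [hS.side_adj (mem_nb.1 hx).2, hkv]
      · rw [hnew', Finset.mem_singleton] at hx
        rw [hx, hsk]
    · rw [hother _ _ hbb] at hx
      exact h.side_eq s b (hold b hb hbb).1 x hx
  · intro s b hb
    by_cases hbb : b = b₁
    · subst hbb
      rcases Bool.eq_or_eq_not s (side v) with rfl | rfl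
      · rw [hnew]; simp
      · rw [hnew']; simp
    · rw [hother _ _ hbb]
      exact h.nonempty s b (hold b hb hbb).1
  · intro A B hA hB hAW hBW hs hadj
    have hvB : v ∉ B := by
      intro hv
      obtain ⟨a, ha⟩ := hA
      have := hS.side_adj (hadj a ha v hv)
      rw [hs a ha] at this
      simp at this
    have hBW' : B ⊆ W := fun x hx =>
      (Finset.mem_insert.1 (hBW hx)).resolve_left fun he => hvB (he ▸ hx)
    -- Bicliques that involve only `k` on its side fit into `b₁`. This covers both those containing
    -- `v` and those whose old enclosing biclique was overwritten.
    have hlast : B ⊆ {k} → ∃ b < p', A ⊆ pendingMem side mem (nb adj W k) v k b₁ (side v) b ∧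
        B ⊆ pendingMem side mem (nb adj W k) v k b₁ (!side v) b := by
      intro hBk
      refine ⟨b₁, hb₁.lt, ?_, by rwa [hnew']⟩
      rw [hnew, ← hP.nb_anchor hS]
      intro a ha
      obtain ⟨b, hb⟩ := hB
      have hbk := Finset.mem_singleton.1 (hBk hb)
      exact mem_nb.2 ⟨hAW ha, hS.symm (hbk ▸ hadj a ha b hb)⟩
    by_cases hvA : v ∈ A
    · refine hlast fun x hx => ?_
      rw [Finset.mem_singleton]
      exact (hP.adj_iff x (hBW' hx)).1 (hadj v hvA x hx)
    · have hAW' : A ⊆ W := fun x hx =>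
        (Finset.mem_insert.1 (hAW hx)).resolve_left fun he => hvA (he ▸ hx)
      obtain ⟨b, hb, h1, h2⟩ := h.complete (side v) A B hA hB hAW' hBW' hs hadj
      by_cases hbk : mem (side k) b = {k}
      · rw [← hsk, hbk] at h2
        exact hlast h2
      · obtain ⟨hb', hbb⟩ := (hb₁.iff b).2 ⟨hb, hbk⟩
        exact ⟨b, hb', by rwa [hother _ _ hbb], by rwa [hother _ _ hbb]⟩
  · intro b hb c hc he
    by_contra hbc
    by_cases hbb : b = b₁
    · have hcb : c ≠ b₁ := fun hc => hbc (hbb.trans hc.symm)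
      rw [hbb, hnew, hother _ _ hcb] at he
      exact hvm _ c (hold c hc hcb).1 (he ▸ Finset.mem_insert_self _ _)
    · by_cases hcb : c = b₁
      · rw [hcb, hnew, hother _ _ hbb] at he
        exact hvm _ b (hold b hb hbb).1 (he ▸ Finset.mem_insert_self _ _)
      · rw [hother _ _ hbb, hother _ _ hcb] at he
        exact hbc (h.inj _ b (hold b hb hbb).1 c (hold c hc hcb).1 he)
  · intro u hu
    rcases eq_or_ne u v with rfl | huv
    · simpa using hb₁.lt
    rw [Function.update_of_ne huv]
    rcases eq_or_ne u k with rfl | huk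
    · simpa using hb₁.lt
    rw [Function.update_of_ne huk]
    exact (h.introd_lt u ((Finset.mem_insert.1 hu).resolve_left huv)).trans_le hb₁.le
  · intro u hu
    rcases eq_or_ne u v with rfl | huv
    · rw [Function.update_self, hP.nb_self hS, hnew']
    rw [Function.update_of_ne huv]
    rcases eq_or_ne u k with rfl | huk
    · rw [Function.update_self, hkv, hP.nb_anchor hS, hnew]
    rw [Function.update_of_ne huk]
    have huW := (Finset.mem_insert.1 hu).resolve_left huv
    rw [hP.nb_of_ne hS huW huk, ← h.introd_opp u huW]
    -- An overwritten biclique had shore {k}, so apart from `k` it introduces only vertices on the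
    -- side of `v`; for them the relevant opposite shore {k} is kept.
    by_cases hIb : I u = b₁
    · have hs1 := hb₁.eq_singleton (hIb ▸ h.introd_lt u huW)
      rcases Bool.eq_or_eq_not (side u) (side v) with hs | hs
      · rw [hs, hIb, hnew', ← hsk, hs1]
      · have hmu := h.mem_introd hS huW
        rw [hIb, hs, ← hsk, hs1, Finset.mem_singleton] at hmu
        exact absurd hmu huk
    · rw [hother _ _ hIb]
  · intro b hb c₁ h₁ c₂ h₂ d hd hb1 hb2 h1d h2d
    have hmax : ∀ c < p', ∀ c' < p', c = b₁ →
        pendingMem side mem (nb adj W k) v k b₁ (side v) c ⊆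
          pendingMem side mem (nb adj W k) v k b₁ (side v) c' → c' = c := by
      rintro c hc c' hc' rfl hcc
      by_contra hne
      rw [hnew, hother _ _ hne] at hcc
      exact hvm _ c' (hold c' hc' hne).1 (hcc (Finset.mem_insert_self _ _))
    by_cases hc1 : c₁ = b₁
    · have := hmax c₁ h₁ d hd hc1 h1d
      subst this
      exact Or.inr h2d
    by_cases hc2 : c₂ = b₁
    · have := hmax c₂ h₂ d hd hc2 h2d
      subst this
      exact Or.inl h1d
    have hbb : b ≠ b₁ := fun hbb => hc1 ((hmax b hb c₁ h₁ hbb hb1).trans hbb)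
    rw [hother _ _ hbb, hother _ _ hc1] at hb1
    rw [hother _ _ hbb, hother _ _ hc2] at hb2
    rw [hother _ _ hc1] at h1d ⊢
    rw [hother _ _ hc2] at h2d ⊢
    have hb' := (hold b hb hbb).1
    have h₁' := (hold c₁ h₁ hc1).1
    have h₂' := (hold c₂ h₂ hc2).1
    -- Without `v`, the top `b₁` of the interval has the same shore as the old introducer of `k`, so
    -- the chain condition is applied to the old interval ending there.
    by_cases hdb : d = b₁
    · rw [hdb, hnew] at h1d h2d
      refine h.chain (side v) b hb' c₁ h₁' c₂ h₂' (I k) (h.introd_lt k hP.mem) hb1 hb2 ?_ ?_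
      · rw [← hkv, h.introd_opp k hP.mem, hkv]
        exact (Finset.subset_insert_iff_of_notMem (hvm _ _ h₁')).1 h1d
      · rw [← hkv, h.introd_opp k hP.mem, hkv]
        exact (Finset.subset_insert_iff_of_notMem (hvm _ _ h₂')).1 h2d
    · rw [hother _ _ hdb] at h1d h2d
      exact h.chain (side v) b hb' c₁ h₁' c₂ h₂' d (hold d hd hdb).1 hb1 hb2 h1d h2d

/-- A pending vertex which goes into an old biclique does not change the covers. -/
theorem IsDiagram.cov_pending_introd (h : IsDiagram adj side W p mem I) (hS : IsShoring adj side)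
    (hP : PendingAt adj W v k) (he : mem (side k) (I k) = {k}) (t : Bool) (b c : ℕ) :
    Cov p (pendingMem side mem (nb adj W k) v k (I k)) t b c ↔ Cov p mem t b c := by
  refine h.cov_congr (h.pending hS hP (h.isSlot_introd hP.mem he)) (side k) (fun b hb => ?_) t b c
  rw [pendingMem]
  split_ifs with h1 h2
  · have := hP.side_eq hS
    rw [h2] at this
    simp at this
  · rw [h1, he]
  · rfl

/-- The covers after the addition of a pending vertex which creates a new biclique. -/
theorem IsDiagram.cov_pending_new (h : IsDiagram adj side W p mem I) (hS : IsShoring adj side)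
    (hP : PendingAt adj W v k) (b c : ℕ) :
    Cov (p + 1) (pendingMem side mem (nb adj W k) v k p) (side v) b c ↔
      Cov p mem (side v) b c ∨ b = I k ∧ c = p := by
  have hkv : (!side k) = side v := by rw [hP.side_eq hS, Bool.not_not]
  have hIk : mem (side v) (I k) = nb adj W k := by rw [← hkv, h.introd_opp k hP.mem]
  have hvm : ∀ s, ∀ b < p, v ∉ mem s b := fun s b hb hv => hP.notMem (h.subset s b hb hv)
  have hother : ∀ b < p, pendingMem side mem (nb adj W k) v k p (side v) b = mem (side v) b :=
    fun b hb => by rw [pendingMem, if_neg hb.ne]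
  have hnew : pendingMem side mem (nb adj W k) v k p (side v) p = insert v (nb adj W k) := by
    simp [pendingMem]
  have hmax : ∀ d < p, ¬ insert v (nb adj W k) ⊂ mem (side v) d := fun d hd hs =>
    hvm _ d hd (hs.subset (Finset.mem_insert_self _ _))
  -- Below the new biclique lies exactly the old down-set generated by `I k`; this makes `I k` the
  -- only element it covers.
  have hle : ∀ d < p, mem (side v) d ⊂ insert v (nb adj W k) ↔
      mem (side v) d ⊆ mem (side v) (I k) := by
    intro d hd
    rw [hIk]
    constructor
    · intro hs
      exact (Finset.subset_insert_iff_of_notMem (hvm _ _ hd)).1 hs.subset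
    · intro hs
      refine (hs.trans (Finset.subset_insert _ _)).ssubset_of_ne fun he => ?_
      exact hvm _ d hd (he ▸ Finset.mem_insert_self _ _)
  have hIp := h.introd_lt k hP.mem
  unfold Cov
  rcases lt_trichotomy b p with hb | hb | hb
  · rcases lt_trichotomy c p with hc | hc | hc
    · rw [hother b hb, hother c hc]
      simp only [hb, hc, hb.trans p.lt_succ_self, hc.trans p.lt_succ_self, true_and, hc.ne,
        and_false, or_false]
      refine and_congr_right fun _ => ⟨fun h' d hd => ?_, fun h' d hd => ?_⟩
      · have := h' d (hd.trans p.lt_succ_self)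
        rwa [hother d hd] at this
      · rcases Nat.lt_succ_iff_lt_or_eq.1 hd with hd | rfl
        · rw [hother d hd]
          exact h' d hd
        · rw [hnew]
          exact fun _ => hmax c hc
    · subst hc
      rw [hother b hb, hnew, hle b hb]
      simp only [hb, hb.trans c.lt_succ_self, c.lt_succ_self, lt_irrefl, true_and, false_and,
        and_false, false_or, and_true]
      constructor
      · rintro ⟨h1, h2⟩
        by_contra hne
        refine h2 (I k) (hIp.trans c.lt_succ_self) ?_ ?_
        · rw [hother _ hIp]
          exact h1.ssubset_of_ne fun h' => hne (h.inj _ b hb _ hIp h')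
        · rw [hother _ hIp, hle _ hIp]
      · rintro rfl
        refine ⟨subset_rfl, fun d hd h1 h2 => ?_⟩
        rcases Nat.lt_succ_iff_lt_or_eq.1 hd with hd | rfl
        · rw [hother d hd] at h1 h2
          rw [hle d hd] at h2
          exact h1.not_subset h2
        · rw [hnew] at h2
          exact h2.ne rfl
    · have h1 : ¬ c < p + 1 := by omega
      have h2 : ¬ c < p := by omega
      simp [h1, h2, hc.ne']
  · subst hb
    constructor
    · rintro ⟨-, hc, h1, -⟩
      rcases Nat.lt_succ_iff_lt_or_eq.1 hc with hc | rfl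
      · rw [hother c hc, hnew] at h1
        exact absurd h1 (hmax c hc)
      · exact absurd rfl h1.ne
    · rintro (⟨h1, -⟩ | ⟨h1, -⟩)
      · exact absurd h1 (lt_irrefl _)
      · omega
  · constructor
    · rintro ⟨h1, -⟩
      omega
    · rintro (⟨h1, -⟩ | ⟨h1, -⟩) <;> omega

end Stages

section Credits

variable {adj : ℕ → ℕ → Prop} [DecidableRel adj] {side : ℕ → Bool} {W F : Finset ℕ} {p : ℕ}
  {mem : Bool → ℕ → Finset ℕ} {I : ℕ → ℕ} {v k : ℕ}

/-! #### Traversals -/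

/-- State of the traversal of the diagram from `b`: the bicliques in the list `Q` have been found,
and the first `h` of them have been treated. -/
structure IsQueue (p : ℕ) (mem : Bool → ℕ → Finset ℕ) (s : Bool) (b h : ℕ) (Q : List ℕ) :
    Prop where
  le : h ≤ Q.length
  nodup : Q.Nodup
  above : ∀ c ∈ Q, c < p ∧ mem s b ⊆ mem s c
  root : b ∈ Q
  closed : ∀ c ∈ Q.take h, ∀ d, Cov p mem s c d → d ∈ Q
  origin : ∀ d ∈ Q, d = b ∨ ∃ c ∈ Q.take h, Cov p mem s c d

theorem isQueue_singleton (s : Bool) {b : ℕ} (hb : b < p) : IsQueue p mem s b 0 [b] where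
  le := by simp
  nodup := by simp
  above := by simp [hb]
  root := by simp
  closed := by simp
  origin := by simp

/-- The point is that no new entry is already in the queue. The root is not strictly above a
biclique that lies above it. Any other old entry `d` covers some treated `c`, distinct from the
current biclique; both belong to the interval from `b` to `d`, so they are comparable by `chain`,
and the larger would lie strictly between the smaller and `d`, which covers both. -/
theorem IsQueue.step (hD : IsDiagram adj side W p mem I) {s : Bool} {b h : ℕ} {Q D : List ℕ}
    (hQ : IsQueue p mem s b h Q) (hh : h < Q.length) (hDn : D.Nodup)
    (hDm : ∀ d, d ∈ D ↔ Cov p mem s Q[h] d) : IsQueue p mem s b (h + 1) (Q ++ D) := by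
  have htake : (Q ++ D).take (h + 1) = Q.take h ++ [Q[h]] := by
    rw [List.take_append_of_le_length hh, List.take_succ_eq_append_getElem hh]
  have hm : Q[h] ∈ Q := List.getElem_mem hh
  have hfresh : Q[h] ∉ Q.take h := by
    intro hc
    have := hQ.nodup
    rw [← List.take_append_drop (h + 1) Q, List.take_succ_eq_append_getElem hh] at this
    have := (List.nodup_append.1 this).1
    exact (List.nodup_append.1 this).2.2 _ hc _ (by simp) rfl
  refine ⟨by simp; omega, ?_, ?_, by simp [hQ.root], ?_, ?_⟩
  · rw [List.nodup_append]
    refine ⟨hQ.nodup, hDn, ?_⟩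
    rintro d hd e he rfl
    rw [hDm] at he
    obtain ⟨hcp, hdp, hlt, hmin⟩ := he
    have hbc := (hQ.above _ hm).2
    rcases hQ.origin d hd with rfl | ⟨c, hc, hcp', -, hlt', hmin'⟩
    · exact (hbc.trans_ssubset hlt).ne rfl
    · have hbc' := (hQ.above c (List.mem_of_mem_take hc)).2
      have hne : c ≠ Q[h] := fun he => hfresh (he ▸ hc)
      rcases hD.chain s b (hQ.above b hQ.root).1 c hcp' _ hcp d hdp hbc' hbc hlt'.subset hlt.subset
        with h1 | h1
      · exact hmin' _ hcp (h1.ssubset_of_ne fun he => hne (hD.inj s _ hcp' _ hcp he)) hlt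
      · exact hmin _ hcp' (h1.ssubset_of_ne fun he => hne (hD.inj s _ hcp _ hcp' he).symm) hlt'
  · intro c hc
    rcases List.mem_append.1 hc with hc | hc
    · exact hQ.above c hc
    · obtain ⟨-, h1, h2, -⟩ := (hDm c).1 hc
      exact ⟨h1, (hQ.above _ hm).2.trans h2.subset⟩
  · intro c hc d hd
    rw [htake, List.mem_append, List.mem_singleton] at hc
    rcases hc with hc | rfl
    · exact List.mem_append_left _ (hQ.closed c hc d hd)
    · exact List.mem_append_right _ ((hDm d).2 hd)
  · intro d hd
    rw [htake]
    rcases List.mem_append.1 hd with hd | hd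
    · refine (hQ.origin d hd).imp_right ?_
      rintro ⟨c, hc, hcd⟩
      exact ⟨c, List.mem_append_left _ hc, hcd⟩
    · exact Or.inr ⟨Q[h], List.mem_append_right _ (List.mem_singleton_self _), (hDm d).1 hd⟩

/-- Once all entries are treated, the queue is closed under covers, and covers generate the order.
-/
theorem IsQueue.mem_iff (hD : IsDiagram adj side W p mem I) {s : Bool} {b : ℕ} {Q : List ℕ}
    (hQ : IsQueue p mem s b Q.length Q) (c : ℕ) : c ∈ Q ↔ c < p ∧ mem s b ⊆ mem s c := by
  refine ⟨hQ.above c, fun ⟨hc, hbc⟩ => ?_⟩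
  refine hD.closure_cov s (S := (· ∈ Q)) (hQ.above b hQ.root).1 hc hbc hQ.root ?_
  intro c d hc
  exact hQ.closed c (by simpa using hc) d

/-! #### Amortization -/

/-- The bicliques containing the vertex `u`. -/
def bicliquesAt (side : ℕ → Bool) (p : ℕ) (mem : Bool → ℕ → Finset ℕ) (u : ℕ) : Finset ℕ :=
  (Finset.range p).filter (u ∈ mem (side u) ·)

/-- The vertices in `F` hold a credit which pays for the next copy of their neighborhoods. -/
structure IsCredit (adj : ℕ → ℕ → Prop) [DecidableRel adj] (side : ℕ → Bool) (W : Finset ℕ)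
    (p : ℕ) (mem : Bool → ℕ → Finset ℕ) (I : ℕ → ℕ) (F : Finset ℕ) : Prop where
  subset : F ⊆ W
  eq_singleton : ∀ u ∈ W, u ∉ F → mem (side u) (I u) = {u}
  mem_of_card_le : ∀ u ∈ W, (nb adj W u).card ≤ 1 → u ∈ F
  count : ∀ u ∈ W, (bicliquesAt side p mem u).card + (nb adj W u ∩ F).card ≤ 2 * (nb adj W u).card

theorem mem_bicliquesAt {u b : ℕ} : b ∈ bicliquesAt side p mem u ↔ b < p ∧ u ∈ mem (side u) b := by
  simp [bicliquesAt]

theorem nb_mono {W' : Finset ℕ} (h : W ⊆ W') (u : ℕ) : nb adj W u ⊆ nb adj W' u :=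
  Finset.filter_subset_filter _ h

/-- No old vertex enters a new biclique, and `v` inherits the count of `k`. Both twins must enter F,
since the shore of their introducer now contains the two of them. -/
theorem IsCredit.twin (hF : IsCredit adj side W p mem I F) (h : IsDiagram adj side W p mem I)
    (hS : IsShoring adj side) (hT : TwinAt adj W v k) :
    IsCredit adj side (insert v W) p (twinMem mem v k) (Function.update I v (I k))
      (insert v (insert k F)) := by
  have hsv := hT.side_eq hS h
  have hvm : ∀ s, ∀ b < p, v ∉ mem s b := fun s b hb hv => hT.notMem (h.subset s b hb hv)
  have hat : ∀ u, u ≠ v → bicliquesAt side p (twinMem mem v k) u = bicliquesAt side p mem u := by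
    intro u hu
    ext b
    simp [mem_bicliquesAt, mem_twinMem, hu]
  refine ⟨?_, ?_, ?_, ?_⟩
  · refine Finset.insert_subset_insert _ (Finset.insert_subset hT.mem hF.subset)
  · intro u hu hnF
    simp only [Finset.mem_insert, not_or] at hu hnF
    obtain ⟨huv, huk, huF⟩ := hnF
    have huW := hu.resolve_left huv
    rw [Function.update_of_ne huv, twinMem, hF.eq_singleton u huW huF, if_neg]
    simpa using fun he => huk he.symm
  · intro u hu hcard
    by_cases huv : u = v
    · simp [huv]
    · have huW := (Finset.mem_insert.1 hu).resolve_left huv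
      have := hF.mem_of_card_le u huW
        ((Finset.card_le_card (nb_mono (Finset.subset_insert v W) u)).trans hcard)
      simp [this]
  · intro u hu
    by_cases huv : u = v
    · subst huv
      have h1 : bicliquesAt side p (twinMem mem u k) u = bicliquesAt side p mem k := by
        ext b
        simp only [mem_bicliquesAt, mem_twinMem, hsv, true_and]
        exact and_congr_right fun hb => ⟨fun h' => h'.resolve_left (hvm _ b hb), Or.inr⟩
      have h2 : nb adj W k ∩ insert u (insert k F) = nb adj W k ∩ F := by
        ext w
        simp only [Finset.mem_inter, Finset.mem_insert]
        refine and_congr_right fun hw => ⟨?_, fun h' => Or.inr (Or.inr h')⟩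
        rintro (rfl | rfl | hw')
        · exact absurd (mem_nb.1 hw).1 hT.notMem
        · exact absurd (mem_nb.1 hw).2 (hS.irrefl _)
        · exact hw'
      rw [h1, hT.nb_self hS, h2]
      exact hF.count k hT.mem
    · have huW := (Finset.mem_insert.1 hu).resolve_left huv
      rw [hat u huv]
      have hold := hF.count u huW
      by_cases huk : adj u k
      · have h1 : nb adj (insert v W) u = insert v (nb adj W u) := by
          rw [nb, Finset.filter_insert, if_pos ((hT.adj_iff' hS huW).2 huk), nb]
        have h2 : v ∉ nb adj W u := fun hv => hT.notMem (mem_nb.1 hv).1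
        -- A neighbor of `k` gains the neighbor `v`, hence two units on the right; these pay for `v`
        -- and, possibly, `k` becoming credited neighbors.
        have h3 : insert v (nb adj W u) ∩ insert v (insert k F) ⊆
            insert v (insert k (nb adj W u ∩ F)) := by
          intro w hw
          simp only [Finset.mem_inter, Finset.mem_insert] at hw ⊢
          tauto
        have h4 := (Finset.card_le_card h3).trans ((Finset.card_insert_le _ _).trans
          (Nat.succ_le_succ (Finset.card_insert_le _ _)))
        rw [h1, Finset.card_insert_of_notMem h2]
        omega
      · have h1 : nb adj (insert v W) u = nb adj W u := by
          rw [nb, Finset.filter_insert, if_neg (fun h' => huk ((hT.adj_iff' hS huW).1 h')), nb]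
        have h2 : nb adj W u ∩ insert v (insert k F) ⊆ nb adj W u ∩ F := by
          intro w hw
          simp only [Finset.mem_inter, Finset.mem_insert] at hw ⊢
          obtain ⟨hw, rfl | rfl | hw'⟩ := hw
          · exact absurd (mem_nb.1 hw).1 hT.notMem
          · exact absurd (mem_nb.1 hw).2 huk
          · exact ⟨hw, hw'⟩
        rw [h1]
        exact (Nat.add_le_add_left (Finset.card_le_card h2) _).trans hold

/-- For `u = k` the new edge gives two units, one for the biclique `b₁` and one for the credited
neighbor `v`. The remaining vertices that enter an additional biclique are paid for by `k` losing
its credit. -/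
theorem IsCredit.pending (hF : IsCredit adj side W p mem I F) (h : IsDiagram adj side W p mem I)
    (hS : IsShoring adj side) (hP : PendingAt adj W v k) {p' b₁ : ℕ}
    (hb₁ : IsSlot side p mem k p' b₁) (hk : k ∈ F ∨ I k = b₁) :
    IsCredit adj side (insert v W) p' (pendingMem side mem (nb adj W k) v k b₁)
      (Function.update (Function.update I k b₁) v b₁) (insert v (F.erase k)) := by
  have hsk := hP.side_eq hS
  have hvk : v ≠ k := fun he => hP.notMem (he ▸ hP.mem)
  have hkv : (!side k) = side v := by rw [hsk, Bool.not_not]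
  have hvm : ∀ s, ∀ b < p, v ∉ mem s b := fun s b hb hv => hP.notMem (h.subset s b hb hv)
  have hold : ∀ b < p', b ≠ b₁ → b < p ∧ mem (side k) b ≠ {k} := fun b hb hne =>
    (hb₁.iff b).1 ⟨hb, hne⟩
  have hother : ∀ t b, b ≠ b₁ → pendingMem side mem (nb adj W k) v k b₁ t b = mem t b :=
    fun t b hb => by rw [pendingMem, if_neg hb]
  have hnew : pendingMem side mem (nb adj W k) v k b₁ (side v) b₁ = insert v (nb adj W k) := by
    simp [pendingMem]
  have hnew' : pendingMem side mem (nb adj W k) v k b₁ (!side v) b₁ = {k} := by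
    simp [pendingMem]
  have hvN : ∀ u, v ∉ nb adj W u := fun u hv => hP.notMem (mem_nb.1 hv).1
  have hsub : ∀ u, u ≠ v → bicliquesAt side p' (pendingMem side mem (nb adj W k) v k b₁) u ⊆
      insert b₁ (bicliquesAt side p mem u) := by
    intro u hu b hb
    rw [mem_bicliquesAt] at hb
    rw [Finset.mem_insert, mem_bicliquesAt]
    by_cases hbb : b = b₁
    · exact Or.inl hbb
    · rw [hother _ _ hbb] at hb
      exact Or.inr ⟨(hold b hb.1 hbb).1, hb.2⟩
  refine ⟨?_, ?_, ?_, ?_⟩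
  · exact Finset.insert_subset_insert _ ((Finset.erase_subset _ _).trans hF.subset)
  · intro u hu hnF
    simp only [Finset.mem_insert, Finset.mem_erase, not_or, not_and] at hu hnF
    obtain ⟨huv, hnF⟩ := hnF
    have huW := hu.resolve_left huv
    rw [Function.update_of_ne huv]
    by_cases huk : u = k
    · subst huk
      rw [Function.update_self, hsk, hnew']
    · have huF := hnF huk
      have hs1 := hF.eq_singleton u huW huF
      rw [Function.update_of_ne huk]
      -- If the introducer of `u` were overwritten, then either `u` would be `k`, or N(u) = {k}. The
      -- latter is why vertices of degree at most one are required to be in F.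
      by_cases hIb : I u = b₁
      · exfalso
        have hs2 := hb₁.eq_singleton (hIb ▸ h.introd_lt u huW)
        rcases Bool.eq_or_eq_not (side u) (side k) with hs | hs
        · rw [hs, hIb, hs2, Finset.singleton_inj] at hs1
          exact huk hs1.symm
        · refine huF (hF.mem_of_card_le u huW ?_)
          rw [← h.introd_opp u huW, hs, Bool.not_not, hIb, hs2, Finset.card_singleton]
      · rw [hother _ _ hIb, hs1]
  · intro u hu hcard
    by_cases huv : u = v
    · simp [huv]
    · have huW := (Finset.mem_insert.1 hu).resolve_left huv
      by_cases huk : u = k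
      · subst huk
        rw [hP.nb_anchor hS, Finset.card_insert_of_notMem (hvN u)] at hcard
        have := (h.nb_nonempty huW).card_pos
        omega
      · rw [hP.nb_of_ne hS huW huk] at hcard
        simp [hF.mem_of_card_le u huW hcard, huk]
  · intro u hu
    by_cases huv : u = v
    · subst huv
      have h1 : bicliquesAt side p' (pendingMem side mem (nb adj W k) u k b₁) u ⊆ {b₁} := by
        intro b hb
        rw [mem_bicliquesAt] at hb
        rw [Finset.mem_singleton]
        by_contra hbb
        rw [hother _ _ hbb] at hb
        exact hvm _ b (hold b hb.1 hbb).1 hb.2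
      have h2 : ({k} : Finset ℕ) ∩ insert u (F.erase k) = ∅ := by
        ext w
        simp only [Finset.mem_inter, Finset.mem_singleton, Finset.mem_insert, Finset.mem_erase,
          Finset.notMem_empty, iff_false]
        rintro ⟨rfl, rfl | h'⟩
        · exact hvk rfl
        · exact h'.1 rfl
      have h3 := Finset.card_le_card h1
      rw [hP.nb_self hS, h2]
      simp only [Finset.card_singleton, Finset.card_empty] at h3 ⊢
      omega
    · have huW := (Finset.mem_insert.1 hu).resolve_left huv
      have hcount := hF.count u huW
      by_cases huk : u = k
      · subst huk
        have h1 := (Finset.card_le_card (hsub u huv)).trans (Finset.card_insert_le _ _)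
        have h2 : insert v (nb adj W u) ∩ insert v (F.erase u) ⊆ insert v (nb adj W u ∩ F) := by
          intro w hw
          simp only [Finset.mem_inter, Finset.mem_insert, Finset.mem_erase] at hw ⊢
          tauto
        have h3 := (Finset.card_le_card h2).trans (Finset.card_insert_le _ _)
        rw [hP.nb_anchor hS, Finset.card_insert_of_notMem (hvN u)]
        omega
      · rw [hP.nb_of_ne hS huW huk]
        have h2 : nb adj W u ∩ insert v (F.erase k) = (nb adj W u ∩ F).erase k := by
          ext w
          simp only [Finset.mem_inter, Finset.mem_insert, Finset.mem_erase]
          constructor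
          · rintro ⟨h1, rfl | h2⟩
            · exact absurd h1 (hvN u)
            · exact ⟨h2.1, h1, h2.2⟩
          · rintro ⟨h1, h2, h3⟩
            exact ⟨h2, Or.inr ⟨h1, h3⟩⟩
        rw [h2]
        have h3 : ((nb adj W u ∩ F).erase k).card ≤ (nb adj W u ∩ F).card :=
          Finset.card_le_card (Finset.erase_subset _ _)
        -- If the number of the introducer of `k` is reused, the neighbors of `k` were already in
        -- that biclique. Otherwise `k` was a credited neighbor of each of them.
        have hcase : bicliquesAt side p' (pendingMem side mem (nb adj W k) v k b₁) u ⊆ bicliquesAt side p mem u ∨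
            k ∈ nb adj W u ∩ F := by
          by_cases huk' : adj u k
          · rcases hk with hk | hk
            · exact Or.inr (Finset.mem_inter.2 ⟨mem_nb.2 ⟨hP.mem, huk'⟩, hk⟩)
            · left
              intro b hb
              rcases Finset.mem_insert.1 (hsub u huv hb) with rfl | h'
              · rw [mem_bicliquesAt, ← hk, hS.side_adj (hS.symm huk'), h.introd_opp k hP.mem, mem_nb]
                exact ⟨h.introd_lt k hP.mem, huW, hS.symm huk'⟩
              · exact h'
          · left
            intro b hb
            rcases Finset.mem_insert.1 (hsub u huv hb) with rfl | h'
            · exfalso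
              rw [mem_bicliquesAt] at hb
              rcases Bool.eq_or_eq_not (side u) (side v) with hs | hs
              · rw [hs, hnew, Finset.mem_insert] at hb
                exact huk' (hS.symm (mem_nb.1 (hb.2.resolve_left huv)).2)
              · rw [hs, hnew', Finset.mem_singleton] at hb
                exact huk hb.2
            · exact h'
        rcases hcase with h1 | h1
        · have := Finset.card_le_card h1
          omega
        · have h4 := Finset.card_erase_add_one h1
          have h5 := (Finset.card_le_card (hsub u huv)).trans (Finset.card_insert_le _ _)
          omega

/-- The sum of the degrees of the vertices in `F`. -/
def degSum (adj : ℕ → ℕ → Prop) [DecidableRel adj] (W F : Finset ℕ) : ℕ :=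
  ∑ u ∈ F, (nb adj W u).card

/-- Only the end at `v` of each new edge is counted. The gain at the old vertices is discarded, at
the price of a larger constant. -/
theorem degSum_insert_self (hv : v ∉ W) :
    degSum adj W W + (nb adj (insert v W) v).card ≤ degSum adj (insert v W) (insert v W) := by
  rw [degSum, degSum, Finset.sum_insert hv, add_comm]
  exact Nat.add_le_add_left (Finset.sum_le_sum fun u _ =>
    Finset.card_le_card (nb_mono (Finset.subset_insert v W) u)) _

theorem degSum_insert_le (u : ℕ) : degSum adj W (insert u F) ≤ (nb adj W u).card + degSum adj W F := by
  by_cases h : u ∈ F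
  · rw [Finset.insert_eq_of_mem h]
    exact Nat.le_add_left _ _
  · rw [degSum, Finset.sum_insert h, degSum]

theorem PendingAt.degSum_le (hP : PendingAt adj W v k) (hS : IsShoring adj side) (hF : F ⊆ W) :
    degSum adj (insert v W) (insert v (F.erase k)) ≤ degSum adj W F + 1 := by
  refine (degSum_insert_le v).trans ?_
  rw [hP.nb_self hS, Finset.card_singleton, add_comm]
  refine Nat.add_le_add_right ?_ 1
  rw [degSum, Finset.sum_congr rfl fun u hu => by
    rw [hP.nb_of_ne hS (hF (Finset.mem_of_mem_erase hu)) (Finset.ne_of_mem_erase hu)]]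
  exact Finset.sum_le_sum_of_subset (Finset.erase_subset _ _)

/-- The vertex `k` leaves F, releasing its whole old degree for the copy, while `v` enters with
degree one; the other degrees in F are unchanged. -/
theorem PendingAt.degSum_add_le (hP : PendingAt adj W v k) (hS : IsShoring adj side) (hF : F ⊆ W)
    (hk : k ∈ F) :
    degSum adj (insert v W) (insert v (F.erase k)) + (nb adj W k).card ≤ degSum adj W F + 1 := by
  have h1 := (degSum_insert_le (adj := adj) (W := insert v W) (F := F.erase k) v)
  rw [hP.nb_self hS, Finset.card_singleton] at h1
  have h2 : degSum adj (insert v W) (F.erase k) = degSum adj W (F.erase k) :=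
    Finset.sum_congr rfl fun u hu => by
      rw [hP.nb_of_ne hS (hF (Finset.mem_of_mem_erase hu)) (Finset.ne_of_mem_erase hu)]
  have h3 : degSum adj W (F.erase k) + (nb adj W k).card = degSum adj W F :=
    Finset.sum_erase_add _ _ hk
  omega

/-- The three terms are the degree of `v`, the degree of `k` if it returns to F, and one unit for
each neighbor of `k` in F. -/
theorem TwinAt.degSum_le (hT : TwinAt adj W v k) (hS : IsShoring adj side) (hF : F ⊆ W) :
    degSum adj (insert v W) (insert v (insert k F)) ≤ degSum adj W F + 3 * (nb adj W k).card := by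
  have h1 := (degSum_insert_le (adj := adj) (W := insert v W) (F := insert k F) v)
  have h2 := (degSum_insert_le (adj := adj) (W := insert v W) (F := F) k)
  rw [hT.nb_self hS] at h1
  rw [hT.nb_anchor hS] at h2
  have h3 : degSum adj (insert v W) F ≤ degSum adj W F + (nb adj W k).card := by
    have h4 : ∀ u ∈ F, (nb adj (insert v W) u).card ≤
        (nb adj W u).card + if u ∈ nb adj W k then 1 else 0 := by
      intro u hu
      rw [nb, Finset.filter_insert]
      split_ifs with h5 h6 h6
      · exact Finset.card_insert_le _ _
      · exact absurd (mem_nb.2 ⟨hF hu, hS.symm ((hT.adj_iff' hS (hF hu)).1 h5)⟩) h6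
      · exact Nat.le_add_right _ _
      · exact Nat.le_add_right _ _
    refine (Finset.sum_le_sum h4).trans ?_
    rw [Finset.sum_add_distrib, ← degSum]
    refine Nat.add_le_add_left ?_ _
    rw [← Finset.card_filter]
    exact Finset.card_le_card fun u hu => (Finset.mem_filter.1 hu).2
  omega

/-- Whatever lies above the introducer of `k` contains `k`, so the count in `IsCredit` bounds the
whole traversal by the degree that the twin is about to receive. -/
theorem IsQueue.length_le_degree (hF : IsCredit adj side W p mem I F)
    (hS : IsShoring adj side) (hD : IsDiagram adj side W p mem I) (hk : k ∈ W) {h : ℕ} {Q : List ℕ}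
    (hQ : IsQueue p mem (side k) (I k) h Q) : Q.length ≤ 2 * (nb adj W k).card := by
  rw [← List.toFinset_card_of_nodup hQ.nodup]
  refine (Finset.card_le_card ?_).trans ((Nat.le_add_right _ _).trans (hF.count k hk))
  intro c hc
  rw [List.mem_toFinset] at hc
  obtain ⟨h1, h2⟩ := hQ.above c hc
  exact mem_bicliquesAt.2 ⟨h1, (hD.introd_subset_iff hS hk h1).1 h2⟩

end Credits

/-! ### Execution of the machine -/

section Machine

/-- Started in `σ`, the program `P` halts within `T` units of time in a state satisfying `Q`. -/
def Halts (P : Prog Reg Arr) (σ : Memory Reg Arr) (T : ℕ) (Q : Memory Reg Arr → Prop) : Prop :=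
  ∃ σ' t, Runs P σ σ' t ∧ t ≤ T ∧ Q σ'

variable {σ σ' τ : Memory Reg Arr} {T T' : ℕ} {P P' : Prog Reg Arr} {Q Q' : Memory Reg Arr → Prop}

theorem Halts.mono (h : Halts P σ T Q) (hT : T ≤ T') (hQ : ∀ σ', Q σ' → Q' σ') :
    Halts P σ T' Q' := by
  obtain ⟨σ', t, h1, h2, h3⟩ := h
  exact ⟨σ', t, h1, h2.trans hT, hQ _ h3⟩

theorem Halts.skip (hQ : Q σ) : Halts .skip σ (T + 1) Q :=
  ⟨σ, 1, .skip σ, Nat.le_add_left _ _, hQ⟩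

theorem Halts.seq (h : Halts P σ T Q) (h' : ∀ σ', Q σ' → Halts P' σ' T' Q') :
    Halts (.seq P P') σ (T + T') Q' := by
  obtain ⟨σ₁, t₁, h1, h2, h3⟩ := h
  obtain ⟨σ₂, t₂, h4, h5, h6⟩ := h' σ₁ h3
  exact ⟨σ₂, t₁ + t₂, .seq h1 h4, Nat.add_le_add h2 h5, h6⟩

theorem Halts.seq_eq (h : Halts P σ T (· = τ)) (h' : Halts P' τ T' Q) :
    Halts (.seq P P') σ (T + T') Q :=
  h.seq (by rintro _ rfl; exact h')

theorem Halts.assign_seq {x : Reg} {e : Expr Reg Arr} {c : ℕ} (he : e.eval σ = c)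
    (h : Halts P (σ.setReg x c) T Q) : Halts (.seq (.assign x e) P) σ (e.cost + 1 + T) Q := by
  subst he
  exact Halts.seq_eq ⟨_, _, .assign σ x e, le_rfl, rfl⟩ h

theorem Halts.write_seq {a : Arr} {i e : Expr Reg Arr} {j c : ℕ} (hi : i.eval σ = j)
    (he : e.eval σ = c) (h : Halts P (σ.setArr a j c) T Q) :
    Halts (.seq (.write a i e) P) σ (i.cost + e.cost + 1 + T) Q := by
  subst hi he
  exact Halts.seq_eq ⟨_, _, .write σ a i e, le_rfl, rfl⟩ h

theorem Halts.ifEq_pos {e e' : Expr Reg Arr} (he : e.eval σ = e'.eval σ) (h : Halts P σ T Q) :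
    Halts (.ifEq e e' P P') σ (e.cost + e'.cost + 1 + T) Q := by
  obtain ⟨σ', t, h1, h2, h3⟩ := h
  exact ⟨σ', _, .ifEq_true he h1, Nat.add_le_add_left h2 _, h3⟩

theorem Halts.ifEq_neg {e e' : Expr Reg Arr} (he : e.eval σ ≠ e'.eval σ) (h : Halts P' σ T Q) :
    Halts (.ifEq e e' P P') σ (e.cost + e'.cost + 1 + T) Q := by
  obtain ⟨σ', t, h1, h2, h3⟩ := h
  exact ⟨σ', _, .ifEq_false he h1, Nat.add_le_add_left h2 _, h3⟩

theorem Halts.whileNe_done {e e' : Expr Reg Arr} (he : e.eval σ = e'.eval σ) (hQ : Q σ) :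
    Halts (.whileNe e e' P) σ (e.cost + e'.cost + 1) Q :=
  ⟨σ, _, .whileNe_done he, le_rfl, hQ⟩

theorem Halts.whileNe_step {e e' : Expr Reg Arr} (he : e.eval σ ≠ e'.eval σ) (h : Halts P σ T Q)
    (h' : ∀ σ', Q σ' → Halts (.whileNe e e' P) σ' T' Q') :
    Halts (.whileNe e e' P) σ (e.cost + e'.cost + 1 + T + T') Q' := by
  obtain ⟨σ₁, t₁, h1, h2, h3⟩ := h
  obtain ⟨σ₂, t₂, h4, h5, h6⟩ := h' σ₁ h3
  exact ⟨σ₂, _, .whileNe_step he h1 h4, by omega, h6⟩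

@[simp] theorem Memory.setReg_reg_self (x : Reg) (c : ℕ) : (σ.setReg x c).reg x = c := by
  simp [Memory.setReg]

theorem Memory.setReg_reg_of_ne {x y : Reg} (h : y ≠ x) (c : ℕ) :
    (σ.setReg x c).reg y = σ.reg y := by
  simp [Memory.setReg, h]

@[simp] theorem Memory.setReg_arr (x : Reg) (c : ℕ) : (σ.setReg x c).arr = σ.arr := rfl

@[simp] theorem Memory.setArr_reg (a : Arr) (i c : ℕ) : (σ.setArr a i c).reg = σ.reg := rfl

theorem Memory.setArr_arr_of_ne {a a' : Arr} (h : a' ≠ a) (i c : ℕ) :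
    (σ.setArr a i c).arr a' = σ.arr a' := by
  simp [Memory.setArr, h]

@[simp] theorem Memory.setArr_arr_self (a : Arr) (i c : ℕ) :
    (σ.setArr a i c).arr a = Function.update (σ.arr a) i c := by
  simp [Memory.setArr]

/-! #### Linked lists -/

/-- The linked list starting from reference `a` has the entries `l` and consists of used cells. -/
def IsChain (σ : Memory Reg Arr) : ℕ → List ℕ → Prop
  | a, [] => a = 0
  | a, x :: l => a ≠ 0 ∧ a < σ.reg .free ∧ σ.arr .item a = x ∧ IsChain σ (σ.arr .link a) l

theorem IsChain.isLinkedList {l : List ℕ} : ∀ {a : ℕ}, IsChain σ a l → IsLinkedList σ a l := by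
  induction l with
  | nil =>
    rintro a rfl
    exact .nil
  | cons x l ih =>
    rintro a ⟨h1, -, rfl, h2⟩
    exact .cons h1 (ih h2)

/-- The used cells of `σ` are unchanged in `σ'`. -/
structure KeepsCells (σ σ' : Memory Reg Arr) : Prop where
  free : σ.reg .free ≤ σ'.reg .free
  item : ∀ a < σ.reg .free, σ'.arr .item a = σ.arr .item a
  link : ∀ a < σ.reg .free, σ'.arr .link a = σ.arr .link a

/-- A chain visits only cells below `free`, and the algorithm writes cells only at `free`. All
existing lists therefore survive, with no argument about their being disjoint. -/
theorem IsChain.mono (h : KeepsCells σ σ') {l : List ℕ} :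
    ∀ {a : ℕ}, IsChain σ a l → IsChain σ' a l := by
  induction l with
  | nil => exact id
  | cons x l ih =>
    rintro a ⟨h1, h2, h3, h4⟩
    refine ⟨h1, h2.trans_le h.free, ?_, ?_⟩
    · rw [h.item a h2, h3]
    · rw [h.link a h2]
      exact ih h4

theorem KeepsCells.of_eq (h1 : σ'.reg .free = σ.reg .free) (h2 : σ'.arr .item = σ.arr .item)
    (h3 : σ'.arr .link = σ.arr .link) : KeepsCells σ σ' where
  free := h1.ge
  item a _ := by rw [h2]
  link a _ := by rw [h3]

/-- The arrays of heads of lists. -/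
def IsHead : Arr → Prop
  | .xs | .ys | .ups | .downs => True
  | _ => False

/-- The lists of the bicliques `0, …, p - 1` are given by `L`. -/
structure HoldsLists (σ : Memory Reg Arr) (p : ℕ) (L : Arr → ℕ → List ℕ) : Prop where
  free_pos : 0 < σ.reg .free
  chain : ∀ a, IsHead a → ∀ b < p, IsChain σ (σ.arr a b) (L a b)

theorem HoldsLists.congr {p : ℕ} {L : Arr → ℕ → List ℕ} (h : HoldsLists σ p L)
    (hc : KeepsCells σ σ') (hh : ∀ a, IsHead a → σ'.arr a = σ.arr a) : HoldsLists σ' p L where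
  free_pos := h.free_pos.trans_le hc.free
  chain a ha b hb := by
    rw [hh a ha]
    exact (h.chain a ha b hb).mono hc

/-- The memory after `e` is added to the list whose head is entry `b` of the array `hd`. -/
def pushed (σ : Memory Reg Arr) (hd : Arr) (b e : ℕ) : Memory Reg Arr :=
  (((σ.setArr .item (σ.reg .free) e).setArr .link (σ.reg .free) (σ.arr hd b)).setArr hd b
    (σ.reg .free)).setReg .free (σ.reg .free + 1)

theorem IsHead.ne {a a' : Arr} (h : IsHead a) (h' : ¬ IsHead a') : a ≠ a' := fun he => h' (he ▸ h)

@[simp] theorem not_isHead_item : ¬ IsHead .item := id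
@[simp] theorem not_isHead_link : ¬ IsHead .link := id

/-- The expression `b` is evaluated twice, after writes to `item` and `link`; it is therefore
required to depend on the registers only, which are not touched before the last assignment. -/
theorem halts_push {hd : Arr} (hhd : IsHead hd) {b e : Expr Reg Arr} {b₀ : ℕ}
    (hb : ∀ τ : Memory Reg Arr, τ.reg = σ.reg → b.eval τ = b₀) :
    Halts (push hd b e) σ (2 * b.cost + e.cost + 11) (· = pushed σ hd b₀ (e.eval σ)) := by
  refine ⟨_, _, .seq (.write ..) (.seq (.write ..) (.seq (.write ..) (.seq (.assign ..) (.skip _)))),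
    ?_, ?_⟩
  · simp only [Expr.cost]
    omega
  · have h1 : hd ≠ .item := hhd.ne not_isHead_item
    have h2 : hd ≠ .link := hhd.ne not_isHead_link
    simp only [Expr.eval, Memory.setArr_reg, pushed]
    rw [hb (σ.setArr _ _ _) rfl, hb ((σ.setArr _ _ _).setArr _ _ _) rfl,
      Memory.setArr_arr_of_ne h1]

theorem pushed_reg {hd : Arr} {b e : ℕ} {r : Reg} (hr : r ≠ .free) :
    (pushed σ hd b e).reg r = σ.reg r := by
  rw [pushed, Memory.setReg_reg_of_ne hr]
  rfl

@[simp] theorem pushed_reg_free {hd : Arr} {b e : ℕ} :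
    (pushed σ hd b e).reg .free = σ.reg .free + 1 := by
  simp [pushed]

theorem pushed_arr {hd : Arr} {b e : ℕ} {a : Arr} (h : a ≠ hd) (h1 : a ≠ .item) (h2 : a ≠ .link) :
    (pushed σ hd b e).arr a = σ.arr a := by
  rw [pushed, Memory.setReg_arr, Memory.setArr_arr_of_ne h, Memory.setArr_arr_of_ne h2,
    Memory.setArr_arr_of_ne h1]

theorem pushed_arr_self {hd : Arr} {b e : ℕ} (h : IsHead hd) :
    (pushed σ hd b e).arr hd = Function.update (σ.arr hd) b (σ.reg .free) := by
  rw [pushed, Memory.setReg_arr, Memory.setArr_arr_self,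
    Memory.setArr_arr_of_ne (h.ne not_isHead_link), Memory.setArr_arr_of_ne (h.ne not_isHead_item)]

theorem pushed_arr_item {hd : Arr} {b e : ℕ} (h : IsHead hd) :
    (pushed σ hd b e).arr .item = Function.update (σ.arr .item) (σ.reg .free) e := by
  rw [pushed, Memory.setReg_arr, Memory.setArr_arr_of_ne (h.ne not_isHead_item).symm,
    Memory.setArr_arr_of_ne (by decide), Memory.setArr_arr_self]

theorem pushed_arr_link {hd : Arr} {b e : ℕ} (h : IsHead hd) :
    (pushed σ hd b e).arr .link = Function.update (σ.arr .link) (σ.reg .free) (σ.arr hd b) := by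
  rw [pushed, Memory.setReg_arr, Memory.setArr_arr_of_ne (h.ne not_isHead_link).symm,
    Memory.setArr_arr_self, Memory.setArr_arr_of_ne (by decide)]

theorem keepsCells_pushed {hd : Arr} {b e : ℕ} (h : IsHead hd) :
    KeepsCells σ (pushed σ hd b e) where
  free := by simp
  item a ha := by rw [pushed_arr_item h, Function.update_of_ne ha.ne]
  link a ha := by rw [pushed_arr_link h, Function.update_of_ne ha.ne]

/-- The lists after `e` is added to the list `L hd b`. -/
def pushList (L : Arr → ℕ → List ℕ) (hd : Arr) (b e : ℕ) (a : Arr) (c : ℕ) : List ℕ :=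
  if a = hd ∧ c = b then e :: L a c else L a c

theorem HoldsLists.pushed {p : ℕ} {L : Arr → ℕ → List ℕ} (h : HoldsLists σ p L) {hd : Arr}
    (hhd : IsHead hd) (b e : ℕ) : HoldsLists (pushed σ hd b e) p (pushList L hd b e) where
  free_pos := by simp
  chain a ha c hc := by
    have hcell := keepsCells_pushed (σ := σ) (b := b) (e := e) hhd
    unfold pushList
    split_ifs with h1
    · obtain ⟨rfl, rfl⟩ := h1
      rw [pushed_arr_self hhd, Function.update_self]
      refine ⟨h.free_pos.ne', by simp, by rw [pushed_arr_item hhd, Function.update_self], ?_⟩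
      rw [pushed_arr_link hhd, Function.update_self]
      exact (h.chain a ha c hc).mono hcell
    · have : (BDH.pushed σ hd b e).arr a c = σ.arr a c := by
        by_cases hah : a = hd
        · subst hah
          rw [pushed_arr_self hhd, Function.update_of_ne (fun hcb => h1 ⟨rfl, hcb⟩)]
        · rw [pushed_arr hah (ha.ne not_isHead_item) (ha.ne not_isHead_link)]
      rw [this]
      exact (h.chain a ha c hc).mono hcell

/-- The lists after the creation of the biclique `p` with empty lists. -/
def newList (L : Arr → ℕ → List ℕ) (p : ℕ) (a : Arr) (c : ℕ) : List ℕ :=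
  if c = p then [] else L a c

/-- The memory after the creation of the biclique `b` with empty lists. -/
def created (σ : Memory Reg Arr) (b : ℕ) : Memory Reg Arr :=
  (((σ.setArr .xs b 0).setArr .ys b 0).setArr .ups b 0).setArr .downs b 0

theorem halts_newBiclique {b : Expr Reg Arr} {b₀ : ℕ}
    (hb : ∀ τ : Memory Reg Arr, τ.reg = σ.reg → b.eval τ = b₀) :
    Halts (newBiclique b) σ (4 * b.cost + 9) (· = created σ b₀) := by
  refine ⟨_, _, .seq (.write ..) (.seq (.write ..) (.seq (.write ..) (.seq (.write ..) (.skip _)))),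
    ?_, ?_⟩
  · simp only [Expr.cost]
    omega
  · simp only [Expr.eval, created]
    rw [hb (σ.setArr _ _ _) rfl, hb ((σ.setArr _ _ _).setArr _ _ _) rfl,
      hb (((σ.setArr _ _ _).setArr _ _ _).setArr _ _ _) rfl, hb σ rfl]

@[simp] theorem created_reg (b : ℕ) : (created σ b).reg = σ.reg := rfl

theorem created_arr {a : Arr} (ha : ¬ IsHead a) (b : ℕ) : (created σ b).arr a = σ.arr a := by
  unfold created
  rw [Memory.setArr_arr_of_ne, Memory.setArr_arr_of_ne, Memory.setArr_arr_of_ne,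
    Memory.setArr_arr_of_ne] <;> (rintro rfl; exact ha trivial)

theorem created_arr_head {a : Arr} (ha : IsHead a) (b : ℕ) :
    (created σ b).arr a = Function.update (σ.arr a) b 0 := by
  unfold created
  cases a <;> first | exact ha.elim | simp [Memory.setArr]

theorem keepsCells_created (b : ℕ) : KeepsCells σ (created σ b) :=
  .of_eq rfl (created_arr not_isHead_item b) (created_arr not_isHead_link b)

/-- Nothing is assumed about entry `p` of the head arrays beforehand; the explicit zeros are what
makes the new lists empty. -/
theorem HoldsLists.created {p : ℕ} {L : Arr → ℕ → List ℕ} (h : HoldsLists σ p L) :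
    HoldsLists (created σ p) (p + 1) (newList L p) where
  free_pos := h.free_pos
  chain a ha c hc := by
    rw [created_arr_head ha, newList]
    split_ifs with hcp
    · rw [hcp, Function.update_self]
      rfl
    · rw [Function.update_of_ne hcp]
      exact (h.chain a ha c (by omega)).mono (keepsCells_created p)

/-! #### Loops -/

/-- The registers and arrays which are not changed by the loops of the algorithm. -/
structure Agree (σ σ' : Memory Reg Arr) : Prop where
  n : σ'.reg .n = σ.reg .n
  i : σ'.reg .i = σ.reg .i
  v : σ'.reg .v = σ.reg .v
  k : σ'.reg .k = σ.reg .k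
  b : σ'.reg .b = σ.reg .b
  p : σ'.reg .p = σ.reg .p
  inV : σ'.arr .inV = σ.arr .inV
  inC : σ'.arr .inC = σ.arr .inC
  inK : σ'.arr .inK = σ.arr .inK
  shore : σ'.arr .shore = σ.arr .shore
  introd : σ'.arr .introd = σ.arr .introd

theorem Agree.trans {σ'' : Memory Reg Arr} (h : Agree σ σ') (h' : Agree σ' σ'') : Agree σ σ'' :=
  ⟨h'.n.trans h.n, h'.i.trans h.i, h'.v.trans h.v, h'.k.trans h.k, h'.b.trans h.b, h'.p.trans h.p,
    h'.inV.trans h.inV, h'.inC.trans h.inC, h'.inK.trans h.inK, h'.shore.trans h.shore,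
    h'.introd.trans h.introd⟩

theorem Agree.of_eq (hr : ∀ r, r ≠ Reg.free → r ≠ .qh → r ≠ .qt → r ≠ .cur → r ≠ .c →
      σ'.reg r = σ.reg r)
    (ha : ∀ a, ¬ IsHead a → a ≠ .item → a ≠ .link → a ≠ .queue → σ'.arr a = σ.arr a) :
    Agree σ σ' := by
  constructor
  all_goals first
    | exact hr _ (by decide) (by decide) (by decide) (by decide) (by decide)
    | exact ha _ id (by decide) (by decide) (by decide)

theorem agree_pushed {hd : Arr} (hhd : IsHead hd) (b e : ℕ) : Agree σ (pushed σ hd b e) :=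
  .of_eq (fun _ hr _ _ _ _ => pushed_reg hr) fun _ ha h1 h2 _ => pushed_arr (hhd.ne ha).symm h1 h2

/-- The queue starts with the entries of `l`. -/
def HoldsQueue (σ : Memory Reg Arr) (l : List ℕ) : Prop :=
  ∀ j (hj : j < l.length), σ.arr .queue j = l[j]

/-- Adding the entries of a linked list to the queue. -/
theorem halts_enqueue (l : List ℕ) : ∀ (σ : Memory Reg Arr) (l' : List ℕ),
    IsChain σ (σ.reg .cur) l → HoldsQueue σ l' → σ.reg .qt = l'.length →
    Halts (.whileNe (.reg .cur) (.const 0) (.block [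
        .write .queue (.reg .qt) (.get .item (.reg .cur)),
        .assign .qt (.succ (.reg .qt)),
        .assign .cur (.get .link (.reg .cur))])) σ (14 * l.length + 3)
      (fun σ' => HoldsQueue σ' (l' ++ l) ∧ σ'.reg .qt = (l' ++ l).length ∧
        (∀ r, r ≠ .qt → r ≠ .cur → σ'.reg r = σ.reg r) ∧
        ∀ a, a ≠ .queue → σ'.arr a = σ.arr a) := by
  induction l with
  | nil =>
    intro σ l' hc hq ht
    have hc0 : σ.reg .cur = 0 := hc
    refine .whileNe_done (by simpa [Expr.eval] using hc0) ?_
    rw [List.append_nil]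
    exact ⟨hq, ht, fun _ _ _ => rfl, fun _ _ => rfl⟩
  | cons x l ih =>
    rintro σ l' ⟨hc0, hcf, hx, hc⟩ hq ht
    set σ₁ := ((σ.setArr .queue (σ.reg .qt) (σ.arr .item (σ.reg .cur))).setReg .qt
      (σ.reg .qt + 1)).setReg .cur (σ.arr .link (σ.reg .cur)) with hσ₁
    have hreg : ∀ r, r ≠ .qt → r ≠ .cur → σ₁.reg r = σ.reg r := by
      intro r h1 h2
      rw [hσ₁, Memory.setReg_reg_of_ne h2, Memory.setReg_reg_of_ne h1, Memory.setArr_reg]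
    have harr : ∀ a, a ≠ .queue → σ₁.arr a = σ.arr a := by
      intro a ha
      rw [hσ₁, Memory.setReg_arr, Memory.setReg_arr, Memory.setArr_arr_of_ne ha]
    have hbody : Halts (.block [
        .write .queue (.reg .qt) (.get .item (.reg .cur)),
        .assign .qt (.succ (.reg .qt)),
        .assign .cur (.get .link (.reg .cur))]) σ 11 (· = σ₁) :=
      Halts.mono (Q := (· = σ₁))
        (Halts.write_seq rfl rfl (Halts.assign_seq rfl (Halts.assign_seq rfl
          (Halts.skip (T := 0) rfl))))
        (by simp [Expr.cost]) fun _ h => h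
    have hrec := ih σ₁ (l' ++ [x]) ?_ ?_ ?_
    · refine (Halts.whileNe_step (by simpa [Expr.eval] using hc0) hbody
        (by rintro _ rfl; exact hrec)).mono ?_ ?_
      · simp only [Expr.cost, List.length_cons]
        omega
      · rintro σ' ⟨h1, h2, h3, h4⟩
        rw [List.append_assoc, List.singleton_append] at h1 h2
        exact ⟨h1, h2, fun r hr hr' => (h3 r hr hr').trans (hreg r hr hr'),
          fun a ha => (h4 a ha).trans (harr a ha)⟩
    · have : σ₁.reg .cur = σ.arr .link (σ.reg .cur) := by simp [hσ₁]
      rw [this]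
      exact hc.mono (.of_eq (hreg _ (by decide) (by decide)) (harr _ (by decide))
        (harr _ (by decide)))
    · intro j hj
      have : σ₁.arr .queue = Function.update (σ.arr .queue) l'.length x := by
        rw [hσ₁, Memory.setReg_arr, Memory.setReg_arr, Memory.setArr_arr_self, ht, hx]
      rw [this]
      rw [List.length_append, List.length_singleton] at hj
      rcases Nat.lt_succ_iff_lt_or_eq.1 hj with hj' | rfl
      · rw [Function.update_of_ne hj'.ne, List.getElem_append_left hj', hq j hj']
      · simp
    · have : σ₁.reg .qt = σ.reg .qt + 1 := by
        rw [hσ₁, Memory.setReg_reg_of_ne (by decide), Memory.setReg_reg_self]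
      rw [this, ht]
      simp

/-- Copying a linked list into the list whose head is entry `c` of the array `hd`. -/
theorem halts_copy {hd : Arr} (hhd : IsHead hd) {p : ℕ} (l : List ℕ) :
    ∀ (σ : Memory Reg Arr) (L : Arr → ℕ → List ℕ), IsChain σ (σ.reg .cur) l → HoldsLists σ p L →
    Halts (.whileNe (.reg .cur) (.const 0) (.block [
        push hd (.reg .c) (.get .item (.reg .cur)),
        .assign .cur (.get .link (.reg .cur))])) σ (22 * l.length + 3)
      (fun σ' => Agree σ σ' ∧ σ'.reg .c = σ.reg .c ∧ HoldsLists σ' p (fun a d =>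
        if a = hd ∧ d = σ.reg .c then l.reverse ++ L a d else L a d)) := by
  induction l with
  | nil =>
    intro σ L hc hL
    have hc0 : σ.reg .cur = 0 := hc
    refine .whileNe_done (by simpa [Expr.eval] using hc0) ⟨.of_eq (fun _ _ _ _ _ _ => rfl)
      fun _ _ _ _ _ => rfl, rfl, ?_⟩
    simpa using hL
  | cons x l ih =>
    rintro σ L ⟨hc0, hcf, hx, hc⟩ hL
    set σ₁ := (pushed σ hd (σ.reg .c) x).setReg .cur (σ.arr .link (σ.reg .cur)) with hσ₁
    -- The cell being copied is in use, so the push has not overwritten the link that is read next.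
    have hlink : (pushed σ hd (σ.reg .c) x).arr .link (σ.reg .cur) = σ.arr .link (σ.reg .cur) :=
      (keepsCells_pushed hhd).link _ hcf
    have hcells : KeepsCells (pushed σ hd (σ.reg .c) x) σ₁ :=
      .of_eq (by rw [hσ₁, Memory.setReg_reg_of_ne (by decide)]) rfl rfl
    have hbody : Halts (.block [
        push hd (.reg .c) (.get .item (.reg .cur)),
        .assign .cur (.get .link (.reg .cur))]) σ (15 + 4) (· = σ₁) := by
      refine Halts.seq (halts_push hhd (b := .reg .c) (e := .get .item (.reg .cur))
        (b₀ := σ.reg .c) (fun τ hτ => by simp [Expr.eval, hτ])) ?_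
      rintro _ rfl
      refine Halts.assign_seq rfl (Halts.skip (T := 0) ?_)
      simp only [Expr.eval]
      rw [pushed_reg (by decide), hx, hlink]
    have hcur : σ₁.reg .cur = σ.arr .link (σ.reg .cur) := by simp [hσ₁]
    have hcc : σ₁.reg .c = σ.reg .c := by
      rw [hσ₁, Memory.setReg_reg_of_ne (by decide), pushed_reg (by decide)]
    have hrec := ih σ₁ (pushList L hd (σ.reg .c) x)
      (by rw [hcur]; exact (hc.mono (keepsCells_pushed hhd)).mono hcells)
      ((hL.pushed hhd _ _).congr hcells fun _ _ => rfl)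
    refine (Halts.whileNe_step (by simpa [Expr.eval] using hc0) hbody
      (by rintro _ rfl; exact hrec)).mono ?_ ?_
    · simp only [Expr.cost, List.length_cons]
      omega
    · rintro σ' ⟨h1, h2, h3⟩
      have hag : Agree (pushed σ hd (σ.reg .c) x) σ₁ :=
        .of_eq (fun _ _ _ _ h _ => Memory.setReg_reg_of_ne h _) fun _ _ _ _ _ => rfl
      refine ⟨((agree_pushed hhd _ _).trans hag).trans h1, h2.trans hcc, ?_⟩
      · rw [hcc] at h3
        convert h3 using 3 with a d
        unfold pushList
        split_ifs <;> simp

end Machine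

/-! ### Representation of a diagram in memory, and execution of the additions -/

section Steps

variable {adj : ℕ → ℕ → Prop} [DecidableRel adj] {side : ℕ → Bool} {W F : Finset ℕ} {p : ℕ}
  {mem : Bool → ℕ → Finset ℕ} {I : ℕ → ℕ} {v k : ℕ} {σ σ' : Memory Reg Arr}
  {L : Arr → ℕ → List ℕ}

/-- The heads of the lists of vertices of a shore. -/
def own : Bool → Arr
  | false => .xs
  | true => .ys

/-- The heads of the lists of covers in the order of the shores of a kind. -/
def fwd : Bool → Arr
  | false => .ups
  | true => .downs

theorem isHead_own (s : Bool) : IsHead (own s) := by cases s <;> trivial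

theorem isHead_fwd (s : Bool) : IsHead (fwd s) := by cases s <;> trivial

theorem fwd_ne_own (s t : Bool) : fwd s ≠ own t := by revert s t; decide

theorem own_inj {s t : Bool} : own s = own t ↔ s = t := by revert s t; decide

theorem fwd_inj {s t : Bool} : fwd s = fwd t ↔ s = t := by revert s t; decide

/-- The lists `L` describe the diagram with the shores `mem`. -/
structure Describes (L : Arr → ℕ → List ℕ) (p : ℕ) (mem : Bool → ℕ → Finset ℕ) : Prop where
  nodup_own : ∀ s, ∀ b < p, (L (own s) b).Nodup
  mem_own : ∀ s, ∀ b < p, ∀ u, u ∈ L (own s) b ↔ u ∈ mem s b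
  nodup_fwd : ∀ s, ∀ b < p, (L (fwd s) b).Nodup
  mem_fwd : ∀ s, ∀ b < p, ∀ c, c ∈ L (fwd s) b ↔ Cov p mem s b c

/-- The memory holds the diagram of the subgraph induced by `W`. -/
structure Holds (side : ℕ → Bool) (W : Finset ℕ) (p : ℕ) (mem : Bool → ℕ → Finset ℕ) (I : ℕ → ℕ)
    (σ : Memory Reg Arr) : Prop where
  p_eq : σ.reg .p = p
  lists : ∃ L, HoldsLists σ p L ∧ Describes L p mem
  introd : ∀ u ∈ W, σ.arr .introd u = I u
  shore : ∀ u ∈ W, σ.arr .shore u = (side u).toNat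

/-- The input and the loop counter are unchanged. -/
structure SameInput (σ σ' : Memory Reg Arr) : Prop where
  n : σ'.reg .n = σ.reg .n
  i : σ'.reg .i = σ.reg .i
  inV : σ'.arr .inV = σ.arr .inV
  inC : σ'.arr .inC = σ.arr .inC
  inK : σ'.arr .inK = σ.arr .inK

theorem SameInput.trans {σ'' : Memory Reg Arr} (h : SameInput σ σ') (h' : SameInput σ' σ'') :
    SameInput σ σ'' :=
  ⟨h'.n.trans h.n, h'.i.trans h.i, h'.inV.trans h.inV, h'.inC.trans h.inC, h'.inK.trans h.inK⟩

/-! #### Twins -/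

/-- The lists after `v` is added to the shores of kind `s` of the bicliques in `l`. -/
def addToAll (L : Arr → ℕ → List ℕ) (s : Bool) (v : ℕ) (l : List ℕ) (a : Arr) (c : ℕ) : List ℕ :=
  if a = own s ∧ c ∈ l then v :: L a c else L a c

/-- The time bound is a potential: treating a biclique costs 30, the loop test included, and each
biclique put into the queue costs 14. The number `M` bounds every queue that can arise, so `M - h`
is also the measure for termination. -/
theorem halts_traverse (hD : IsDiagram adj side W p mem I) (hL : Describes L p mem) {s : Bool}
    {b M : ℕ} (hM : ∀ h Q, IsQueue p mem s b h Q → Q.length ≤ M) (m : ℕ) :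
    ∀ (σ : Memory Reg Arr) (h : ℕ) (Q : List ℕ), M - h = m → IsQueue p mem s b h Q →
      HoldsQueue σ Q → σ.reg .qh = h → σ.reg .qt = Q.length →
      HoldsLists σ p (addToAll L s (σ.reg .v) (Q.take h)) →
      Halts (.whileNe (.reg .qh) (.reg .qt) (.block [
          .assign .c (.get .queue (.reg .qh)),
          .assign .qh (.succ (.reg .qh)),
          push (own s) (.reg .c) (.reg .v),
          .assign .cur (.get (fwd s) (.reg .c)),
          .whileNe (.reg .cur) (.const 0) (.block [
            .write .queue (.reg .qt) (.get .item (.reg .cur)),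
            .assign .qt (.succ (.reg .qt)),
            .assign .cur (.get .link (.reg .cur))])])) σ
        (30 * (M - h) + 14 * (M - Q.length) + 3)
        (fun σ' => Agree σ σ' ∧ ∃ Q', IsQueue p mem s b Q'.length Q' ∧
          HoldsLists σ' p (addToAll L s (σ.reg .v) Q')) := by
  induction m with
  | zero =>
    intro σ h Q hm hQ hq hqh hqt hl
    have h1 := hQ.le
    have h2 := hM h Q hQ
    have h3 : h = Q.length := by omega
    subst h3
    rw [List.take_length] at hl
    refine (Halts.whileNe_done (by simp [Expr.eval, hqh, hqt]) ?_).mono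
      (by simp only [Expr.cost]; omega) fun _ h => h
    exact ⟨.of_eq (fun _ _ _ _ _ _ => rfl) fun _ _ _ _ _ => rfl, Q, hQ, hl⟩
  | succ m ih =>
    intro σ h Q hm hQ hq hqh hqt hl
    by_cases hh : h = Q.length
    · subst hh
      rw [List.take_length] at hl
      refine (Halts.whileNe_done (by simp [Expr.eval, hqh, hqt]) ?_).mono
        (by simp only [Expr.cost]; omega) fun _ h => h
      exact ⟨.of_eq (fun _ _ _ _ _ _ => rfl) fun _ _ _ _ _ => rfl, Q, hQ, hl⟩
    have hlt : h < Q.length := lt_of_le_of_ne hQ.le hh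
    set c := Q[h] with hc
    have hcp : c < p := (hQ.above c (List.getElem_mem hlt)).1
    have hstep := hQ.step hD hlt (hL.nodup_fwd s c hcp) (hL.mem_fwd s c hcp)
    have hlen := hM _ _ hstep
    rw [List.length_append] at hlen
    set σ₀ := (σ.setReg .c c).setReg .qh (h + 1) with hσ₀
    have hcells₀ : KeepsCells σ σ₀ := .of_eq rfl rfl rfl
    set σ₁ := pushed σ₀ (own s) c (σ.reg .v) with hσ₁
    set σ₂ := σ₁.setReg .cur (σ₁.arr (fwd s) c) with hσ₂
    have hcells₂ : KeepsCells σ₁ σ₂ := .of_eq rfl rfl rfl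
    have hag : Agree σ σ₂ := by
      refine Agree.trans (σ' := σ₀) (.of_eq (fun r _ h1 _ _ h2 => ?_) fun _ _ _ _ _ => rfl)
        (Agree.trans (agree_pushed (isHead_own s) c (σ.reg .v))
          (.of_eq (fun _ _ _ _ h _ => Memory.setReg_reg_of_ne h _) fun _ _ _ _ _ => rfl))
      rw [hσ₀, Memory.setReg_reg_of_ne h1, Memory.setReg_reg_of_ne h2]
    -- Since the queue has no repetitions, `v` has not yet been added to `c`, and it is added only
    -- once.
    have hfresh : c ∉ Q.take h := by
      have := hQ.nodup
      rw [← List.take_append_drop (h + 1) Q, List.take_succ_eq_append_getElem hlt] at this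
      have := (List.nodup_append.1 (List.nodup_append.1 this).1).2.2
      exact fun hc' => this _ hc' _ (List.mem_singleton_self _) rfl
    have hl₁ : HoldsLists σ₁ p (addToAll L s (σ.reg .v) (Q.take (h + 1))) := by
      have := (hl.congr hcells₀ fun _ _ => rfl).pushed (isHead_own s) c (σ.reg .v)
      convert this using 1
      funext a d
      rw [List.take_succ_eq_append_getElem hlt]
      simp only [addToAll, pushList, List.mem_append, List.mem_singleton, ← hc]
      by_cases ha : a = own s
      · by_cases hd : d = c
        · subst hd
          simp [ha, hfresh]
        · simp [ha, hd]
      · simp [ha]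
    have hl₂ := hl₁.congr hcells₂ fun _ _ => rfl
    have hchain : IsChain σ₂ (σ₂.reg .cur) (L (fwd s) c) := by
      have := hl₂.chain _ (isHead_fwd s) c hcp
      rw [addToAll, if_neg (fun h => fwd_ne_own s s h.1)] at this
      rw [hσ₂, Memory.setReg_reg_self]
      exact this
    have hqt₂ : σ₂.reg .qt = Q.length := by
      rw [hσ₂, Memory.setReg_reg_of_ne (by decide), hσ₁, pushed_reg (by decide), hσ₀,
        Memory.setReg_reg_of_ne (by decide), Memory.setReg_reg_of_ne (by decide), hqt]
    have hqh₂ : σ₂.reg .qh = h + 1 := by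
      rw [hσ₂, Memory.setReg_reg_of_ne (by decide), hσ₁, pushed_reg (by decide), hσ₀,
        Memory.setReg_reg_self]
    have hqa : σ₂.arr .queue = σ.arr .queue := by
      rw [hσ₂, Memory.setReg_arr, hσ₁, pushed_arr ((isHead_own s).ne id).symm (by decide)
        (by decide)]
      rfl
    have hq₂ : HoldsQueue σ₂ Q := by
      intro j hj
      rw [hqa, hq j hj]
    have hinner := halts_enqueue (L (fwd s) c) σ₂ Q hchain hq₂ hqt₂
    have hbody : Halts (.block [
          .assign .c (.get .queue (.reg .qh)),
          .assign .qh (.succ (.reg .qh)),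
          push (own s) (.reg .c) (.reg .v),
          .assign .cur (.get (fwd s) (.reg .c)),
          .whileNe (.reg .cur) (.const 0) (.block [
            .write .queue (.reg .qt) (.get .item (.reg .cur)),
            .assign .qt (.succ (.reg .qt)),
            .assign .cur (.get .link (.reg .cur))])]) σ (27 + 14 * (L (fwd s) c).length)
        (fun σ' => HoldsQueue σ' (Q ++ L (fwd s) c) ∧
          σ'.reg .qt = (Q ++ L (fwd s) c).length ∧
          (∀ r, r ≠ .qt → r ≠ .cur → σ'.reg r = σ₂.reg r) ∧
          ∀ a, a ≠ .queue → σ'.arr a = σ₂.arr a) := by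
      have e1 : (Expr.get Arr.queue (.reg .qh) : Expr Reg Arr).eval σ = c := by
        simp only [Expr.eval, hqh]
        exact hq h hlt
      have e2 : (Expr.succ (.reg .qh) : Expr Reg Arr).eval (σ.setReg .c c) = h + 1 := by
        simp only [Expr.eval]
        rw [Memory.setReg_reg_of_ne (by decide), hqh]
      have e3 : ∀ τ : Memory Reg Arr, τ.reg = σ₀.reg →
          (Expr.reg .c : Expr Reg Arr).eval τ = c := by
        intro τ hτ
        simp only [Expr.eval, hτ]
        rw [hσ₀, Memory.setReg_reg_of_ne (by decide), Memory.setReg_reg_self]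
      have e4 : (Expr.reg .v : Expr Reg Arr).eval σ₀ = σ.reg .v := by
        simp only [Expr.eval]
        rw [hσ₀, Memory.setReg_reg_of_ne (by decide), Memory.setReg_reg_of_ne (by decide)]
      have e5 : (Expr.get (fwd s) (.reg .c) : Expr Reg Arr).eval σ₁ = σ₁.arr (fwd s) c := by
        have : σ₁.reg .c = c := by
          rw [hσ₁, pushed_reg (by decide)]
          exact e3 σ₀ rfl
        simp only [Expr.eval, this]
      have h2 := Halts.seq hinner (fun σ' h => Halts.skip (T := 0) h)
      have hpush : Halts (push (own s) (.reg .c) (.reg .v)) σ₀ 14 (· = σ₁) := by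
        have := halts_push (σ := σ₀) (isHead_own s) (b := .reg .c) (e := .reg .v) e3
        rw [e4] at this
        exact this
      have h5 := Halts.assign_seq (σ := σ) e1 (Halts.assign_seq (x := .qh) e2
        (Halts.seq_eq hpush (Halts.assign_seq (x := .cur) e5 h2)))
      refine h5.mono ?_ fun _ h => h
      simp only [Expr.cost]
      omega
    refine (Halts.whileNe_step (by simpa [Expr.eval, hqh, hqt] using hh) hbody (Q' := _)
      (T' := 30 * (M - (h + 1)) + 14 * (M - (Q ++ L (fwd s) c).length) + 3) ?_).mono
      (Q := fun σ' => Agree σ σ' ∧ ∃ Q', IsQueue p mem s b Q'.length Q' ∧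
          HoldsLists σ' p (addToAll L s (σ.reg .v) Q')) ?_ fun _ h => h
    · rintro σ₃ ⟨h1, h2, h3, h4⟩
      have hag₃ : Agree σ σ₃ := hag.trans
        (.of_eq (fun r _ _ h h' _ => h3 r h h') fun a _ _ _ h => h4 a h)
      have hv₃ : σ₃.reg .v = σ.reg .v := hag₃.v
      refine (ih σ₃ (h + 1) (Q ++ L (fwd s) c) (by omega) hstep h1
        ((h3 _ (by decide) (by decide)).trans hqh₂) h2 ?_).mono le_rfl ?_
      · rw [hv₃, List.take_append_of_le_length hlt]
        exact hl₂.congr (.of_eq (h3 _ (by decide) (by decide)) (h4 _ (by decide))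
          (h4 _ (by decide))) fun a ha => h4 a (ha.ne id)
      · rintro σ' ⟨h5, h6⟩
        rw [hv₃] at h6
        exact ⟨hag₃.trans h5, h6⟩
    · simp only [Expr.cost, List.length_append]
      omega

theorem halts_addTwin (hD : IsDiagram adj side W p mem I) (hF : IsCredit adj side W p mem I F)
    (hS : IsShoring adj side) (hT : TwinAt adj W v k) (hσ : Holds side W p mem I σ)
    (hb : σ.reg .b = I k) (hv : σ.reg .v = v) (hk : σ.reg .k = k)
    (hshore : σ.arr .shore v = (side v).toNat) :
    Halts (addTwin (own (side k)) (fwd (side k))) σ (88 * (nb adj W k).card + 20)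
      (fun σ' => Holds side (insert v W) p (twinMem mem v k) (Function.update I v (I k)) σ' ∧
        SameInput σ σ') := by
  obtain ⟨hp, ⟨L, hL, hd⟩, hI, hsh⟩ := hσ
  set σ₁ := ((σ.setArr .queue 0 (I k)).setReg .qh 0).setReg .qt 1 with hσ₁
  have hag : Agree σ σ₁ := by
    refine .of_eq (fun r _ h1 h2 _ _ => ?_) fun a _ _ _ h => ?_
    · rw [hσ₁, Memory.setReg_reg_of_ne h2, Memory.setReg_reg_of_ne h1, Memory.setArr_reg]
    · rw [hσ₁, Memory.setReg_arr, Memory.setReg_arr, Memory.setArr_arr_of_ne h]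
  have hL₁ : HoldsLists σ₁ p (addToAll L (side k) (σ₁.reg .v) ([I k].take 0)) := by
    have : addToAll L (side k) (σ₁.reg .v) ([I k].take 0) = L := by
      funext a c
      simp [addToAll]
    rw [this]
    exact hL.congr (.of_eq rfl rfl rfl) fun a ha => Memory.setArr_arr_of_ne (ha.ne id) _ _
  have hIk := hD.introd_lt k hT.mem
  -- For `M` equal to twice the degree of `k`, the initial potential is at most 88 times that
  -- degree, plus 3.
  have hloop := halts_traverse hD hd (s := side k) (b := I k) (M := 2 * (nb adj W k).card)
    (fun h Q hQ => hQ.length_le_degree hF hS hD hT.mem) _ σ₁ 0 [I k] rfl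
    (isQueue_singleton _ hIk)
    (by
      intro j hj
      have : j = 0 := by simpa using hj
      subst this
      simp [hσ₁])
    (by rw [hσ₁, Memory.setReg_reg_of_ne (by decide), Memory.setReg_reg_self])
    (by rw [hσ₁, Memory.setReg_reg_self]; rfl) hL₁
  have hfin : ∀ σ₂, (Agree σ₁ σ₂ ∧ ∃ Q, IsQueue p mem (side k) (I k) Q.length Q ∧
      HoldsLists σ₂ p (addToAll L (side k) (σ₁.reg .v) Q)) →
      Halts (.seq (.write .introd (.reg .v) (.get .introd (.reg .k))) .skip) σ₂ (4 + (0 + 1))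
        (fun σ' => Holds side (insert v W) p (twinMem mem v k) (Function.update I v (I k)) σ' ∧
          SameInput σ σ') := by
    rintro σ₂ ⟨hag₂, Q, hQ, hL₂⟩
    refine Halts.write_seq rfl rfl (Halts.skip (T := 0) ?_)
    have hagg := hag.trans hag₂
    simp only [Expr.eval]
    rw [hagg.v, hagg.k, hagg.introd, hv, hk, hI k hT.mem]
    have harr : ∀ a, a ≠ .introd → (σ₂.setArr .introd v (I k)).arr a = σ₂.arr a :=
      fun a ha => Memory.setArr_arr_of_ne ha _ _
    refine ⟨⟨hagg.p.trans hp, ⟨_, hL₂.congr (.of_eq rfl (harr _ (by decide)) (harr _ (by decide)))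
      fun a ha => harr a (ha.ne id), ?_⟩, ?_, ?_⟩,
      ⟨hagg.n, hagg.i, (harr _ (by decide)).trans hagg.inV, (harr _ (by decide)).trans hagg.inC,
        (harr _ (by decide)).trans hagg.inK⟩⟩
    · rw [hag.v, hv]
      -- Lying above the introducer of `k` means containing `k`, so the traversal meets exactly the
      -- bicliques that `twinMem` enlarges.
      have hmQ : ∀ b < p, b ∈ Q ↔ k ∈ mem (side k) b := by
        intro b hb
        rw [hQ.mem_iff hD, ← hD.introd_subset_iff hS hT.mem hb]
        exact and_iff_right hb
      have hvm : ∀ s, ∀ b < p, v ∉ mem s b := fun s b hb hv => hT.notMem (hD.subset s b hb hv)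
      have hmem : ∀ s, ∀ b < p, addToAll L (side k) v Q (own s) b =
          if k ∈ mem s b then v :: L (own s) b else L (own s) b := by
        intro s b hb
        rw [addToAll]
        refine if_congr ?_ rfl rfl
        rw [own_inj]
        constructor
        · rintro ⟨rfl, h⟩
          exact (hmQ b hb).1 h
        · intro h
          have := hD.side_eq s b hb k h
          subst this
          exact ⟨rfl, (hmQ b hb).2 h⟩
      have hfwd : ∀ s b, addToAll L (side k) v Q (fwd s) b = L (fwd s) b := by
        intro s b
        rw [addToAll, if_neg fun h => fwd_ne_own _ _ h.1]
      refine ⟨?_, ?_, ?_, ?_⟩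
      · intro s b hb
        rw [hmem s b hb]
        split_ifs
        · refine List.nodup_cons.2 ⟨?_, hd.nodup_own s b hb⟩
          rw [hd.mem_own s b hb]
          exact hvm s b hb
        · exact hd.nodup_own s b hb
      · intro s b hb u
        rw [hmem s b hb, mem_twinMem, ← hd.mem_own s b hb u]
        split_ifs with h
        · simp [h, or_comm]
        · simp [h]
      · intro s b hb
        rw [hfwd]
        exact hd.nodup_fwd s b hb
      · intro s b hb c
        rw [hfwd, hD.cov_twin hS hT]
        exact hd.mem_fwd s b hb c
    · intro u hu
      rw [Memory.setArr_arr_self, hagg.introd]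
      rcases eq_or_ne u v with rfl | huv
      · simp
      · rw [Function.update_of_ne huv, Function.update_of_ne huv]
        exact hI u ((Finset.mem_insert.1 hu).resolve_left huv)
    · intro u hu
      rw [harr _ (by decide), hagg.shore]
      rcases Finset.mem_insert.1 hu with rfl | hu
      · exact hshore
      · exact hsh u hu
  refine (Halts.write_seq (σ := σ) (a := .queue) (i := .const 0) (e := .reg .b) rfl hb (Halts.assign_seq (x := .qh) (c := 0) rfl
    (Halts.assign_seq (x := .qt) (c := 1) rfl (hloop.seq hfin)))).mono ?_ fun _ h => h
  simp only [Expr.cost, List.length_singleton]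
  omega

end Steps

section PendingSteps

variable {adj : ℕ → ℕ → Prop} [DecidableRel adj] {side : ℕ → Bool} {W F : Finset ℕ} {p : ℕ}
  {mem : Bool → ℕ → Finset ℕ} {I : ℕ → ℕ} {v k : ℕ} {σ σ' : Memory Reg Arr}
  {L : Arr → ℕ → List ℕ}

/-! #### Pending vertices -/

/-- The test for shores with a single element. -/
theorem Describes.link_eq_zero_iff (hd : Describes L p mem) (hL : HoldsLists σ p L) (s : Bool)
    {b : ℕ} (hb : b < p) (hk : k ∈ mem s b) :
    σ.arr .link (σ.arr (own s) b) = 0 ↔ mem s b = {k} := by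
  have hc := hL.chain _ (isHead_own s) b hb
  have hm := hd.mem_own s b hb
  have hn := hd.nodup_own s b hb
  generalize L (own s) b = l at hc hm hn
  match l, hc, hm, hn with
  | [], _, hm, _ => simpa using (hm k).2 hk
  | [x], hc, hm, _ =>
    have hx : k = x := by simpa using (hm k).2 hk
    subst hx
    refine ⟨fun _ => ?_, fun _ => hc.2.2.2⟩
    ext u
    rw [← hm u]
    simp
  -- The reference to a second cell is nonzero, and a list without repetitions then gives two
  -- distinct vertices of the shore.
  | x :: y :: l, hc, hm, hn =>
    refine ⟨fun h => absurd h hc.2.2.2.1, fun h => ?_⟩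
    have hx := (hm x).1 (by simp)
    have hy := (hm y).1 (by simp)
    rw [h, Finset.mem_singleton] at hx hy
    subst hx hy
    simp at hn

/-- The shore of the introducer of `k` on the side of `v` is N(k), so a single push turns it into
the biclique with shores N(k) ∪ {v} and {k}; no arc changes. -/
theorem halts_addPending_introd (hD : IsDiagram adj side W p mem I) (hS : IsShoring adj side)
    (hP : PendingAt adj W v k) (he : mem (side k) (I k) = {k}) (hσ : Holds side W p mem I σ)
    (hb : σ.reg .b = I k) (hv : σ.reg .v = v) (hk : σ.reg .k = k)
    (hshore : σ.arr .shore v = (side v).toNat) :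
    Halts (addPending (own (side v)) (own (!side v)) (fwd (side v)) (fwd (!side v))) σ 30
      (fun σ' => Holds side (insert v W) p (pendingMem side mem (nb adj W k) v k (I k))
        (Function.update (Function.update I k (I k)) v (I k)) σ' ∧ SameInput σ σ') := by
  obtain ⟨hp, ⟨L, hL, hd⟩, hI, hsh⟩ := hσ
  have hkW := hP.mem
  have hIk := hD.introd_lt k hkW
  have hsk := hP.side_eq hS
  have hmk := hD.mem_introd hS hkW
  have hvm : ∀ s, ∀ b < p, v ∉ mem s b := fun s b hb hv => hP.notMem (hD.subset s b hb hv)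
  have htest : σ.arr .link (σ.arr (own (!side v)) (I k)) = 0 := by
    rw [← hsk]
    exact (hd.link_eq_zero_iff hL (side k) hIk hmk).2 he
  have hown := isHead_own (side v)
  have hpush : Halts (push (own (side v)) (.reg .b) (.reg .v)) σ 14
      (· = pushed σ (own (side v)) (I k) v) := by
    have := halts_push (σ := σ) hown (b := .reg .b) (e := .reg .v) (b₀ := I k)
      (fun τ hτ => by simp only [Expr.eval, hτ, hb])
    simp only [Expr.eval, hv] at this
    exact this
  set σ₁ := pushed σ (own (side v)) (I k) v with hσ₁
  have hag : Agree σ σ₁ := agree_pushed hown _ _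
  have e1 : (Expr.reg .v : Expr Reg Arr).eval σ₁ = v := hag.v.trans hv
  have e2 : (Expr.get .introd (.reg .k) : Expr Reg Arr).eval σ₁ = I k := by
    simp only [Expr.eval]
    rw [hag.introd, hag.k, hk, hI k hkW]
  refine (Halts.ifEq_pos ?_ (Halts.seq_eq hpush (Halts.write_seq e1 e2
    (Halts.skip (T := 0) ?_)))).mono (by simp only [Expr.cost]; omega) fun _ h => h
  · simpa only [Expr.eval, hb] using htest
  have harr : ∀ a, a ≠ .introd → (σ₁.setArr .introd v (I k)).arr a = σ₁.arr a :=
    fun a ha => Memory.setArr_arr_of_ne ha _ _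
  refine ⟨⟨hag.p.trans hp, ⟨_, (hL.pushed hown (I k) v).congr
    (.of_eq rfl (harr _ (by decide)) (harr _ (by decide))) fun a ha => harr a (ha.ne id), ?_⟩,
      ?_, ?_⟩, ⟨hag.n, hag.i, (harr _ (by decide)).trans hag.inV,
        (harr _ (by decide)).trans hag.inC, (harr _ (by decide)).trans hag.inK⟩⟩
  · have hmem : ∀ s b, pushList L (own (side v)) (I k) v (own s) b =
        if s = side v ∧ b = I k then v :: L (own s) b else L (own s) b := by
      intro s b
      rw [pushList]
      exact if_congr (and_congr_left fun _ => own_inj) rfl rfl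
    have hmem' : ∀ s, ∀ b < p, pendingMem side mem (nb adj W k) v k (I k) s b =
        if s = side v ∧ b = I k then insert v (mem s b) else mem s b := by
      intro s b hb
      rw [pendingMem]
      by_cases hbI : b = I k
      · subst hbI
        by_cases hs : s = side v
        · subst hs
          simp only [if_true, and_self]
          rw [← hD.introd_opp k hkW, hsk, Bool.not_not]
        · have hs' : s = side k := by
            rw [hsk]
            exact (Bool.eq_or_eq_not s (side v)).resolve_left hs
          simp only [hs, if_true, if_false, false_and]
          rw [hs', he]
      · simp [hbI]
    have hfwd : ∀ s b, pushList L (own (side v)) (I k) v (fwd s) b = L (fwd s) b := by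
      intro s b
      rw [pushList, if_neg fun h => fwd_ne_own _ _ h.1]
    refine ⟨?_, ?_, ?_, ?_⟩
    · intro s b hb
      rw [hmem s b]
      split_ifs
      · refine List.nodup_cons.2 ⟨?_, hd.nodup_own s b hb⟩
        rw [hd.mem_own s b hb]
        exact hvm s b hb
      · exact hd.nodup_own s b hb
    · intro s b hb u
      rw [hmem s b, hmem' s b hb]
      split_ifs
      · rw [List.mem_cons, Finset.mem_insert, hd.mem_own s b hb u]
      · exact hd.mem_own s b hb u
    · intro s b hb
      rw [hfwd]
      exact hd.nodup_fwd s b hb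
    · intro s b hb c
      rw [hfwd, hD.cov_pending_introd hS hP he]
      exact hd.mem_fwd s b hb c
  · intro u hu
    rw [Memory.setArr_arr_self, hag.introd, Function.update_eq_self]
    rcases eq_or_ne u v with rfl | huv
    · simp
    · rw [Function.update_of_ne huv, Function.update_of_ne huv]
      exact hI u ((Finset.mem_insert.1 hu).resolve_left huv)
  · intro u hu
    rw [harr _ (by decide), hag.shore]
    rcases Finset.mem_insert.1 hu with rfl | hu
    · exact hshore
    · exact hsh u hu

/-- The lists after the addition of a vertex `v` of kind `t` pending at `k` which creates a new
biclique, covering `b`. -/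
def pendingList (L : Arr → ℕ → List ℕ) (p : ℕ) (t : Bool) (b v k : ℕ) : Arr → ℕ → List ℕ :=
  pushList (pushList (pushList (pushList
    (fun a d => if a = own t ∧ d = p then (L (own t) b).reverse ++ newList L p a d
      else newList L p a d) (own t) p v) (own (!t)) p k) (fwd t) b p) (fwd (!t)) p b

theorem describes_pendingList (hd : Describes L p mem) (hD : IsDiagram adj side W p mem I)
    (hS : IsShoring adj side) (hP : PendingAt adj W v k) (he : mem (side k) (I k) ≠ {k}) :
    Describes (pendingList L p (side v) (I k) v k) (p + 1)
      (pendingMem side mem (nb adj W k) v k p) := by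
  have hD' := hD.pending hS hP (hD.isSlot_new hP.mem he)
  have hkW := hP.mem
  have hIk := hD.introd_lt k hkW
  have hsk := hP.side_eq hS
  have hvm : ∀ s, ∀ b < p, v ∉ mem s b := fun s b hb hv => hP.notMem (hD.subset s b hb hv)
  have hIm : mem (side v) (I k) = nb adj W k := by
    rw [← hD.introd_opp k hkW, hsk, Bool.not_not]
  have hcov := hD.cov_pending_new hS hP
  have hcov' : ∀ b c, Cov (p + 1) (pendingMem side mem (nb adj W k) v k p) (!side v) b c ↔
      Cov p mem (!side v) b c ∨ c = I k ∧ b = p := by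
    intro b c
    rw [hD'.cov_not, hcov, hD.cov_not]
  have hlt : ∀ {s b c}, Cov p mem s b c → b < p ∧ c < p := fun h => ⟨h.1, h.2.1⟩
  have m1 : ∀ b, pendingMem side mem (nb adj W k) v k p (side v) b =
      if b = p then insert v (nb adj W k) else mem (side v) b := by
    intro b
    simp [pendingMem]
  have m2 : ∀ b, pendingMem side mem (nb adj W k) v k p (!side v) b =
      if b = p then {k} else mem (!side v) b := by
    intro b
    simp [pendingMem]
  generalize side v = t at *
  have hot : own t ≠ own (!t) := fun h => by simpa using own_inj.1 h
  have hft : fwd t ≠ fwd (!t) := fun h => by simpa using fwd_inj.1 h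
  have l1 : ∀ b, pendingList L p t (I k) v k (own t) b =
      if b = p then v :: (L (own t) (I k)).reverse else L (own t) b := by
    intro b
    by_cases hbp : b = p <;>
      simp [pendingList, pushList, newList, hot, (fwd_ne_own _ _).symm, hbp]
  have l2 : ∀ b, pendingList L p t (I k) v k (own (!t)) b =
      if b = p then [k] else L (own (!t)) b := by
    intro b
    by_cases hbp : b = p <;>
      simp [pendingList, pushList, newList, hot.symm, (fwd_ne_own _ _).symm, hbp]
  -- The number `I k` is less than `p`, so the new arc goes into an old list and the list of `p`
  -- stays empty: the new biclique is maximal in this direction.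
  have l3 : ∀ b, pendingList L p t (I k) v k (fwd t) b =
      if b = p then [] else if b = I k then p :: L (fwd t) b else L (fwd t) b := by
    intro b
    by_cases hbp : b = p
    · simp [pendingList, pushList, newList, hft, fwd_ne_own, hbp, hIk.ne']
    · simp [pendingList, pushList, newList, hft, fwd_ne_own, hbp]
  have l4 : ∀ b, pendingList L p t (I k) v k (fwd (!t)) b =
      if b = p then [I k] else L (fwd (!t)) b := by
    intro b
    by_cases hbp : b = p <;>
      simp [pendingList, pushList, newList, hft.symm, fwd_ne_own, hbp]
  have hle : ∀ {b}, b < p + 1 → b ≠ p → b < p := fun h1 h2 => by omega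
  refine ⟨?_, ?_, ?_, ?_⟩
  · intro s b hb
    rcases Bool.eq_or_eq_not s t with rfl | rfl
    · rw [l1]
      split_ifs with hbp
      · refine List.nodup_cons.2 ⟨?_, List.nodup_reverse.2 (hd.nodup_own s _ hIk)⟩
        rw [List.mem_reverse, hd.mem_own s _ hIk]
        exact hvm s _ hIk
      · exact hd.nodup_own s b (hle hb hbp)
    · rw [l2]
      split_ifs with hbp
      · exact List.nodup_singleton k
      · exact hd.nodup_own _ b (hle hb hbp)
  · intro s b hb u
    rcases Bool.eq_or_eq_not s t with rfl | rfl
    · rw [l1, m1]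
      split_ifs with hbp
      · rw [List.mem_cons, List.mem_reverse, hd.mem_own s _ hIk, hIm, Finset.mem_insert]
      · exact hd.mem_own s b (hle hb hbp) u
    · rw [l2, m2]
      split_ifs with hbp
      · rw [List.mem_singleton, Finset.mem_singleton]
      · exact hd.mem_own _ b (hle hb hbp) u
  · intro s b hb
    rcases Bool.eq_or_eq_not s t with rfl | rfl
    · rw [l3]
      split_ifs with hbp hbI
      · exact List.nodup_nil
      · refine List.nodup_cons.2 ⟨?_, hd.nodup_fwd s b (hle hb hbp)⟩
        rw [hd.mem_fwd s b (hle hb hbp)]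
        exact fun h => (hlt h).2.ne rfl
      · exact hd.nodup_fwd s b (hle hb hbp)
    · rw [l4]
      split_ifs with hbp
      · exact List.nodup_singleton _
      · exact hd.nodup_fwd _ b (hle hb hbp)
  · intro s b hb c
    rcases Bool.eq_or_eq_not s t with rfl | rfl
    · rw [l3, hcov]
      split_ifs with hbp hbI
      · subst hbp
        refine ⟨fun h => absurd h List.not_mem_nil, ?_⟩
        rintro (h | ⟨h, -⟩)
        · exact absurd (hlt h).1 (lt_irrefl _)
        · exact absurd h hIk.ne'
      · rw [List.mem_cons, hd.mem_fwd s b (hle hb hbp), or_comm]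
        simp [hbI]
      · rw [hd.mem_fwd s b (hle hb hbp)]
        simp [hbI]
    · rw [l4, hcov']
      split_ifs with hbp
      · subst hbp
        rw [List.mem_singleton]
        refine ⟨fun h => Or.inr ⟨h, rfl⟩, ?_⟩
        rintro (h | ⟨h, -⟩)
        · exact absurd (hlt h).1 (lt_irrefl _)
        · exact h
      · rw [hd.mem_fwd _ b (hle hb hbp)]
        simp [hbp]

theorem Describes.length_own (hd : Describes L p mem) (s : Bool) {b : ℕ} (hb : b < p) :
    (L (own s) b).length = (mem s b).card := by
  rw [← List.toFinset_card_of_nodup (hd.nodup_own s b hb)]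
  congr 1
  ext u
  rw [List.mem_toFinset, hd.mem_own s b hb]

/-- The copied list is the shore N(k) of the introducer of `k`, at 22 units of time per cell; this
is where the factor 22 of the potential comes from. -/
theorem halts_addPending_new (hD : IsDiagram adj side W p mem I) (hS : IsShoring adj side)
    (hP : PendingAt adj W v k) (he : mem (side k) (I k) ≠ {k}) (hσ : Holds side W p mem I σ)
    (hb : σ.reg .b = I k) (hv : σ.reg .v = v) (hk : σ.reg .k = k)
    (hshore : σ.arr .shore v = (side v).toNat) :
    Halts (addPending (own (side v)) (own (!side v)) (fwd (side v)) (fwd (!side v))) σ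
      (22 * (nb adj W k).card + 110)
      (fun σ' => Holds side (insert v W) (p + 1) (pendingMem side mem (nb adj W k) v k p)
        (Function.update (Function.update I k p) v p) σ' ∧ SameInput σ σ') := by
  obtain ⟨hp, ⟨L, hL, hd⟩, hI, hsh⟩ := hσ
  have hkW := hP.mem
  have hIk := hD.introd_lt k hkW
  have hsk := hP.side_eq hS
  have hmk := hD.mem_introd hS hkW
  have htest : σ.arr .link (σ.arr (own (!side v)) (I k)) ≠ 0 := by
    rw [← hsk]
    exact fun h => he ((hd.link_eq_zero_iff hL (side k) hIk hmk).1 h)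
  have hlen : (L (own (side v)) (I k)).length = (nb adj W k).card := by
    rw [hd.length_own _ hIk, ← hD.introd_opp k hkW, hsk, Bool.not_not]
  have hdesc := describes_pendingList hd hD hS hP he
  generalize ht : side v = t at *
  have hown := isHead_own t
  set σ₂ := (σ.setReg .c p).setReg .p (p + 1) with hσ₂
  set σ₃ := created σ₂ p with hσ₃
  set σ₄ := σ₃.setReg .cur (σ.arr (own t) (I k)) with hσ₄
  have hc₂ : KeepsCells σ σ₂ := .of_eq rfl rfl rfl
  have hc₄ : KeepsCells σ₃ σ₄ := .of_eq rfl rfl rfl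
  have hL₃ : HoldsLists σ₃ (p + 1) (newList L p) := (hL.congr hc₂ fun _ _ => rfl).created
  have hL₄ := hL₃.congr hc₄ fun _ _ => rfl
  have hreg₄ : ∀ r, r ≠ .c → r ≠ .p → r ≠ .cur → σ₄.reg r = σ.reg r := by
    intro r h1 h2 h3
    rw [hσ₄, Memory.setReg_reg_of_ne h3, hσ₃, created_reg, hσ₂, Memory.setReg_reg_of_ne h2,
      Memory.setReg_reg_of_ne h1]
  have harr₄ : ∀ a, ¬ IsHead a → σ₄.arr a = σ.arr a := fun a ha => created_arr ha p
  have hc4 : σ₄.reg .c = p := by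
    rw [hσ₄, Memory.setReg_reg_of_ne (by decide), hσ₃, created_reg, hσ₂,
      Memory.setReg_reg_of_ne (by decide), Memory.setReg_reg_self]
  have hp4 : σ₄.reg .p = p + 1 := by
    rw [hσ₄, Memory.setReg_reg_of_ne (by decide), hσ₃, created_reg, hσ₂, Memory.setReg_reg_self]
  have hcur : IsChain σ₄ (σ₄.reg .cur) (L (own t) (I k)) := by
    rw [hσ₄, Memory.setReg_reg_self]
    exact (((hL.chain _ hown _ hIk).mono hc₂).mono (keepsCells_created p)).mono hc₄
  have hloop := halts_copy hown (L (own t) (I k)) σ₄ (newList L p) hcur hL₄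
  rw [hc4] at hloop
  have hfin : ∀ σ₅, (Agree σ₄ σ₅ ∧ σ₅.reg .c = p ∧ HoldsLists σ₅ (p + 1) (fun a d =>
        if a = own t ∧ d = p then (L (own t) (I k)).reverse ++ newList L p a d
        else newList L p a d)) →
      Halts (.block [
        push (own t) (.reg .c) (.reg .v),
        push (own (!t)) (.reg .c) (.reg .k),
        push (fwd t) (.reg .b) (.reg .c),
        push (fwd (!t)) (.reg .c) (.reg .b),
        .write .introd (.reg .k) (.reg .c),
        .write .introd (.reg .v) (.reg .c)]) σ₅ 63
        (fun σ' => Holds side (insert v W) (p + 1) (pendingMem side mem (nb adj W k) v k p)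
          (Function.update (Function.update I k p) v p) σ' ∧ SameInput σ σ') := by
    rintro σ₅ ⟨hag₅, hc5, hL₅⟩
    have hv5 : σ₅.reg .v = v :=
      hag₅.v.trans ((hreg₄ _ (by decide) (by decide) (by decide)).trans hv)
    have hk5 : σ₅.reg .k = k :=
      hag₅.k.trans ((hreg₄ _ (by decide) (by decide) (by decide)).trans hk)
    have hb5 : σ₅.reg .b = I k :=
      hag₅.b.trans ((hreg₄ _ (by decide) (by decide) (by decide)).trans hb)
    have hpush : ∀ (τ : Memory Reg Arr) (hd : Arr) (r r' : Reg) (b e : ℕ), IsHead hd →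
        τ.reg r = b → τ.reg r' = e →
        Halts (push hd (.reg r) (.reg r')) τ 14 (· = pushed τ hd b e) := by
      rintro τ hd r r' b e hhd rfl rfl
      exact halts_push hhd (b := .reg r) (e := .reg r') fun τ' h => by simp only [Expr.eval, h]
    set σ₆ := pushed σ₅ (own t) p v with hσ₆
    set σ₇ := pushed σ₆ (own (!t)) p k with hσ₇
    set σ₈ := pushed σ₇ (fwd t) (I k) p with hσ₈
    set σ₉ := pushed σ₈ (fwd (!t)) p (I k) with hσ₉
    have r6 : ∀ r, r ≠ .free → σ₆.reg r = σ₅.reg r := fun r hr => pushed_reg hr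
    have r7 : ∀ r, r ≠ .free → σ₇.reg r = σ₅.reg r := fun r hr => (pushed_reg hr).trans (r6 r hr)
    have r8 : ∀ r, r ≠ .free → σ₈.reg r = σ₅.reg r := fun r hr => (pushed_reg hr).trans (r7 r hr)
    have r9 : ∀ r, r ≠ .free → σ₉.reg r = σ₅.reg r := fun r hr => (pushed_reg hr).trans (r8 r hr)
    have hag₉ : Agree σ₄ σ₉ :=
      hag₅.trans ((agree_pushed hown _ _).trans ((agree_pushed (isHead_own _) _ _).trans
        ((agree_pushed (isHead_fwd _) _ _).trans (agree_pushed (isHead_fwd _) _ _))))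
    have hL₉ : HoldsLists σ₉ (p + 1) (pendingList L p t (I k) v k) :=
      (((hL₅.pushed hown p v).pushed (isHead_own (!t)) p k).pushed (isHead_fwd t) (I k) p).pushed
        (isHead_fwd (!t)) p (I k)
    refine (Halts.seq_eq (hpush σ₅ _ .c .v p v hown hc5 hv5)
      (Halts.seq_eq (hpush σ₆ _ .c .k p k (isHead_own _) ((r6 _ (by decide)).trans hc5)
        ((r6 _ (by decide)).trans hk5))
      (Halts.seq_eq (hpush σ₇ _ .b .c (I k) p (isHead_fwd _) ((r7 _ (by decide)).trans hb5)
        ((r7 _ (by decide)).trans hc5))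
      (Halts.seq_eq (hpush σ₈ _ .c .b p (I k) (isHead_fwd _) ((r8 _ (by decide)).trans hc5)
        ((r8 _ (by decide)).trans hb5))
      (Halts.write_seq (i := .reg .k) (e := .reg .c) (a := .introd)
        ((r9 _ (by decide)).trans hk5) ((r9 _ (by decide)).trans hc5)
      (Halts.write_seq (i := .reg .v) (e := .reg .c) (a := .introd)
        ((r9 _ (by decide)).trans hv5) ((r9 _ (by decide)).trans hc5)
        (Halts.skip (T := 0) ?_))))))).mono (by simp [Expr.cost]) fun _ h => h
    have harr : ∀ a, a ≠ .introd →
        ((σ₉.setArr .introd k p).setArr .introd v p).arr a = σ₉.arr a := fun a ha => by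
      rw [Memory.setArr_arr_of_ne ha, Memory.setArr_arr_of_ne ha]
    have hin : ∀ a, ¬ IsHead a → a ≠ .introd → σ₉.arr a = σ₄.arr a →
        ((σ₉.setArr .introd k p).setArr .introd v p).arr a = σ.arr a := fun a h1 h2 h3 =>
      (harr a h2).trans (h3.trans (harr₄ a h1))
    refine ⟨⟨hag₉.p.trans hp4, ⟨_, hL₉.congr (.of_eq rfl (harr _ (by decide))
      (harr _ (by decide))) fun a ha => harr a (ha.ne id), hdesc⟩, ?_, ?_⟩,
      ⟨hag₉.n.trans (hreg₄ _ (by decide) (by decide) (by decide)),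
        hag₉.i.trans (hreg₄ _ (by decide) (by decide) (by decide)),
        hin _ id (by decide) hag₉.inV, hin _ id (by decide) hag₉.inC,
        hin _ id (by decide) hag₉.inK⟩⟩
    · intro u hu
      rw [Memory.setArr_arr_self, Memory.setArr_arr_self, hag₉.introd, harr₄ _ id]
      rcases eq_or_ne u v with rfl | huv
      · simp
      rw [Function.update_of_ne huv, Function.update_of_ne huv]
      rcases eq_or_ne u k with rfl | huk
      · simp
      rw [Function.update_of_ne huk, Function.update_of_ne huk]
      exact hI u ((Finset.mem_insert.1 hu).resolve_left huv)
    · intro u hu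
      rw [hin _ id (by decide) hag₉.shore]
      rcases Finset.mem_insert.1 hu with rfl | hu
      · rw [hshore, ht]
      · exact hsh u hu
  have hnew : Halts (newBiclique (.reg .c)) σ₂ 13 (· = σ₃) :=
    halts_newBiclique (b := .reg .c) fun τ hτ => by
      simp only [Expr.eval, hτ]
      rw [hσ₂, Memory.setReg_reg_of_ne (by decide), Memory.setReg_reg_self]
  have e1 : (Expr.succ (.reg .p) : Expr Reg Arr).eval (σ.setReg .c p) = p + 1 := by
    simp only [Expr.eval]
    rw [Memory.setReg_reg_of_ne (by decide), hp]
  have e2 : (Expr.get (own t) (.reg .b) : Expr Reg Arr).eval σ₃ = σ.arr (own t) (I k) := by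
    have : σ₃.reg .b = I k := by
      rw [hσ₃, created_reg, hσ₂, Memory.setReg_reg_of_ne (by decide),
        Memory.setReg_reg_of_ne (by decide), hb]
    simp only [Expr.eval, this]
    rw [hσ₃, created_arr_head hown, Function.update_of_ne hIk.ne]
    rfl
  refine (Halts.ifEq_neg ?_ (Halts.assign_seq (x := .c) (e := .reg .p) hp
    (Halts.assign_seq (x := .p) e1 (Halts.seq_eq hnew (Halts.assign_seq (x := .cur) e2
      (hloop.seq hfin)))))).mono ?_ fun _ h => h
  · simpa only [Expr.eval, hb] using htest
  · simp only [Expr.cost, hlen]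
    omega

end PendingSteps

/-! ### One pass of the main loop, with its account of time, and the starting phase -/

section Loop

variable {adj : ℕ → ℕ → Prop} [DecidableRel adj] {side : ℕ → Bool} {W F : Finset ℕ} {p : ℕ}
  {mem : Bool → ℕ → Finset ℕ} {I : ℕ → ℕ} {v k : ℕ} {σ σ' : Memory Reg Arr}
  {L : Arr → ℕ → List ℕ}

theorem SameInput.of_agree (h : ∀ r, r ≠ Reg.v → r ≠ .k → r ≠ .b → σ'.reg r = σ.reg r)
    (h' : ∀ a, a ≠ Arr.shore → σ'.arr a = σ.arr a) : SameInput σ σ' := by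
  constructor
  all_goals first
    | exact h _ (by decide) (by decide) (by decide)
    | exact h' _ (by decide)

theorem Holds.congr (h : Holds side W p mem I σ)
    (hr : ∀ r, r ≠ Reg.v → r ≠ .k → r ≠ .b → σ'.reg r = σ.reg r)
    (ha : ∀ a, a ≠ Arr.shore → σ'.arr a = σ.arr a)
    (hs : ∀ u ∈ W, σ'.arr .shore u = σ.arr .shore u) : Holds side W p mem I σ' := by
  obtain ⟨hp, ⟨L, hL, hd⟩, hI, hsh⟩ := h
  refine ⟨(hr _ (by decide) (by decide) (by decide)).trans hp, ⟨L, hL.congr (.of_eq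
    (hr _ (by decide) (by decide) (by decide)) (ha _ (by decide)) (ha _ (by decide)))
    fun a h => ha a (h.ne id), hd⟩, ?_, ?_⟩
  · intro u hu
    rw [ha _ (by decide)]
    exact hI u hu
  · intro u hu
    rw [hs u hu]
    exact hsh u hu

/-- The vertex `v` may be added to the graph induced by `W`, with the operation `C` on `k`. -/
def CanAdd (adj : ℕ → ℕ → Prop) (W : Finset ℕ) (v k : ℕ) : StepKind → Prop
  | .pending => PendingAt adj W v k
  | .twin => TwinAt adj W v k

/-- The part of the main loop which depends on the kind of the addition. -/
def addVertex : Prog Reg Arr :=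
  .ifEq (.get .inC (.reg .i)) (.const 1)
    (.ifEq (.get .shore (.reg .k)) (.const 0)
      (.block [.write .shore (.reg .v) (.const 0), addTwin .xs .ups])
      (.block [.write .shore (.reg .v) (.const 1), addTwin .ys .downs]))
    (.ifEq (.get .shore (.reg .k)) (.const 0)
      (.block [.write .shore (.reg .v) (.const 1), addPending .ys .xs .downs .ups])
      (.block [.write .shore (.reg .v) (.const 0), addPending .xs .ys .ups .downs]))

theorem CanAdd.notMem {C : StepKind} (h : CanAdd adj W v k C) : v ∉ W := by
  cases C
  · exact PendingAt.notMem h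
  · exact TwinAt.notMem h

theorem CanAdd.anchor_mem {C : StepKind} (h : CanAdd adj W v k C) : k ∈ W := by
  cases C
  · exact PendingAt.mem h
  · exact TwinAt.mem h

/-- The account is written without subtraction: time plus new credits is at most old credits plus
300 times the increase of the degree sum. The margin of 100 is for the rest of the loop. -/
theorem halts_addVertex (hD : IsDiagram adj side W p mem I) (hF : IsCredit adj side W p mem I F)
    (hS : IsShoring adj side) (hσ : Holds side W p mem I σ) {C : StepKind}
    (hC : CanAdd adj W v k C) (hb : σ.reg .b = I k) (hv : σ.reg .v = v) (hk : σ.reg .k = k)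
    (hc : σ.arr .inC (σ.reg .i) = C.code) :
    ∃ T p' mem' I' F', IsDiagram adj side (insert v W) p' mem' I' ∧
      IsCredit adj side (insert v W) p' mem' I' F' ∧
      Halts addVertex σ T (fun σ' => Holds side (insert v W) p' mem' I' σ' ∧ SameInput σ σ') ∧
      T + 100 + 22 * degSum adj (insert v W) F' + 300 * degSum adj W W ≤
        22 * degSum adj W F + 300 * degSum adj (insert v W) (insert v W) := by
  have hvW := hC.notMem
  have hkW := hC.anchor_mem
  have hdeg := degSum_insert_self (adj := adj) hvW
  have hpos := (hD.nb_nonempty hkW).card_pos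
  have hshk := hσ.shore k hkW
  set σ₁ := σ.setArr .shore v (side v).toNat with hσ₁
  have hσ₁' : Holds side W p mem I σ₁ := hσ.congr (fun _ _ _ _ => rfl)
    (fun a ha => Memory.setArr_arr_of_ne ha _ _) fun u hu => by
      rw [hσ₁, Memory.setArr_arr_self, Function.update_of_ne fun h : u = v => hvW (h ▸ hu)]
  have hin : SameInput σ σ₁ := .of_agree (fun _ _ _ _ => rfl)
    fun a ha => Memory.setArr_arr_of_ne ha _ _
  have hshore : σ₁.arr .shore v = (side v).toNat := by simp [hσ₁]
  have ek : (Expr.get .shore (.reg .k) : Expr Reg Arr).eval σ = (side k).toNat := by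
    simp only [Expr.eval, hk, hshk]
  have ev : (Expr.reg .v : Expr Reg Arr).eval σ = v := hv
  have eC : (Expr.get .inC (.reg .i) : Expr Reg Arr).eval σ = C.code := hc
  cases C with
  | twin =>
    have hT : TwinAt adj W v k := hC
    have hsv := hT.side_eq hS hD
    have hadd := halts_addTwin hD hF hS hT hσ₁' hb hv hk hshore
    have hΦ := hT.degSum_le hS hF.subset
    rw [hT.nb_self hS] at hdeg
    -- If d is the degree of `k`, time and margin take 88d + 140 and the new credits 66d. The degree
    -- sum grows by at least d, and d ≥ 1, so 300d suffices.
    refine ⟨88 * (nb adj W k).card + 40, _, _, _, _, hD.twin hS hT, hF.twin hD hS hT, ?_, by omega⟩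
    refine (Halts.ifEq_pos (e' := .const 1) (T := 88 * (nb adj W k).card + 36) eC ?_).mono
      (by simp only [Expr.cost]; omega) fun _ h => h
    cases hs : side k with
    | false =>
      rw [hs] at hadd hsv
      refine (Halts.ifEq_pos (by rw [ek, hs]; rfl) (Halts.write_seq (e := .const 0) ev
        (by rw [hsv]; rfl) (hadd.seq fun σ' h => Halts.skip (T := 0) ⟨h.1, hin.trans h.2⟩))).mono
          ?_ fun _ h => h
      simp only [Expr.cost]
      omega
    | true =>
      rw [hs] at hadd hsv
      refine (Halts.ifEq_neg (by rw [ek, hs]; exact Nat.one_ne_zero) (Halts.write_seq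
        (e := .const 1) ev (by rw [hsv]; rfl) (hadd.seq fun σ' h => Halts.skip (T := 0)
          ⟨h.1, hin.trans h.2⟩))).mono ?_ fun _ h => h
      simp only [Expr.cost]
      omega
  | pending =>
    have hP : PendingAt adj W v k := hC
    have hsk := hP.side_eq hS
    rw [hP.nb_self hS, Finset.card_singleton] at hdeg
    have hbranch : ∀ {T : ℕ} {Q : Memory Reg Arr → Prop},
        Halts (addPending (own (side v)) (own (!side v)) (fwd (side v)) (fwd (!side v))) σ₁ T Q →
        Halts addVertex σ (T + 12) Q := by
      intro T Q hadd
      refine (Halts.ifEq_neg (e' := .const 1) (T := T + 8)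
        (by rw [eC]; exact Nat.zero_ne_one) ?_).mono (by simp only [Expr.cost]; omega) fun _ h => h
      cases hs : side k with
      | false =>
        have hsv : side v = true := by simpa [hs] using hsk
        rw [hsv] at hadd
        refine (Halts.ifEq_pos (by rw [ek, hs]; rfl) (Halts.write_seq (e := .const 1) ev
          (by rw [hsv]; rfl) (hadd.seq fun σ' h => Halts.skip (T := 0) h))).mono ?_ fun _ h => h
        simp only [Expr.cost]
        omega
      | true =>
        have hsv : side v = false := by simpa [hs] using hsk
        rw [hsv] at hadd
        refine (Halts.ifEq_neg (by rw [ek, hs]; exact Nat.one_ne_zero) (Halts.write_seq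
          (e := .const 0) ev (by rw [hsv]; rfl) (hadd.seq fun σ' h => Halts.skip (T := 0) h))).mono
            ?_ fun _ h => h
        simp only [Expr.cost]
        omega
    by_cases he : mem (side k) (I k) = {k}
    · have hadd := halts_addPending_introd hD hS hP he hσ₁' hb hv hk hshore
      have hslot := hD.isSlot_introd hkW he
      have hΦ := hP.degSum_le hS hF.subset
      exact ⟨42, _, _, _, _, hD.pending hS hP hslot, hF.pending hD hS hP hslot (Or.inr rfl),
        (hbranch hadd).mono le_rfl fun σ' h => ⟨h.1, hin.trans h.2⟩, by omega⟩
    · have hadd := halts_addPending_new hD hS hP he hσ₁' hb hv hk hshore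
      have hslot := hD.isSlot_new hkW he
      -- A copy is made only for a vertex holding a credit. This credit cancels the term in the
      -- degree of `k`, leaving 244 out of the 300 allotted to one new edge.
      have hkF : k ∈ F := by
        by_contra hkF
        exact he (hF.eq_singleton k hkW hkF)
      have hΦ := hP.degSum_add_le hS hF.subset hkF
      exact ⟨22 * (nb adj W k).card + 122, _, _, _, _, hD.pending hS hP hslot,
        hF.pending hD hS hP hslot (Or.inl hkF),
        (hbranch hadd).mono (by omega) fun σ' h => ⟨h.1, hin.trans h.2⟩, by omega⟩

/-- The 3 in the account is the test of the enclosing loop. Together with the 13 units spent outside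
`addVertex`, it is taken from the margin of 100. -/
theorem halts_loopBody (hD : IsDiagram adj side W p mem I) (hF : IsCredit adj side W p mem I F)
    (hS : IsShoring adj side) (hσ : Holds side W p mem I σ) {C : StepKind}
    (hC : CanAdd adj W v k C) (hv : σ.arr .inV (σ.reg .i) = v) (hk : σ.arr .inK (σ.reg .i) = k)
    (hc : σ.arr .inC (σ.reg .i) = C.code) :
    ∃ T p' mem' I' F', IsDiagram adj side (insert v W) p' mem' I' ∧
      IsCredit adj side (insert v W) p' mem' I' F' ∧
      Halts loopBody σ T (fun σ' => Holds side (insert v W) p' mem' I' σ' ∧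
        SameInput (σ.setReg .i (σ.reg .i + 1)) σ') ∧
      T + 3 + 22 * degSum adj (insert v W) F' + 300 * degSum adj W W ≤
        22 * degSum adj W F + 300 * degSum adj (insert v W) (insert v W) := by
  set σ₁ := ((σ.setReg .v v).setReg .k k).setReg .b (I k) with hσ₁
  have hreg : ∀ r, r ≠ .v → r ≠ .k → r ≠ .b → σ₁.reg r = σ.reg r := by
    intro r h1 h2 h3
    rw [hσ₁, Memory.setReg_reg_of_ne h3, Memory.setReg_reg_of_ne h2, Memory.setReg_reg_of_ne h1]
  have hi : σ₁.reg .i = σ.reg .i := hreg _ (by decide) (by decide) (by decide)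
  obtain ⟨T, p', mem', I', F', hD', hF', hrun, hT⟩ := halts_addVertex (σ := σ₁) hD hF hS
    (hσ.congr hreg (fun _ _ => rfl) fun _ _ => rfl) hC (by simp [hσ₁])
    (by rw [hσ₁, Memory.setReg_reg_of_ne (by decide), Memory.setReg_reg_of_ne (by decide),
      Memory.setReg_reg_self])
    (by rw [hσ₁, Memory.setReg_reg_of_ne (by decide), Memory.setReg_reg_self])
    (by rw [hi]; exact hc)
  have e2 : (Expr.get .inK (.reg .i) : Expr Reg Arr).eval (σ.setReg .v v) = k := hk
  have e3 : (Expr.get .introd (.reg .k) : Expr Reg Arr).eval ((σ.setReg .v v).setReg .k k) =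
      I k := by
    simp only [Expr.eval, Memory.setReg_reg_self]
    exact hσ.introd k hC.anchor_mem
  refine ⟨_, p', mem', I', F', hD', hF', Halts.assign_seq (x := .v)
    (e := .get .inV (.reg .i)) hv (Halts.assign_seq (x := .k) e2 (Halts.assign_seq (x := .b) e3
      (hrun.seq (T' := 4) (fun σ₂ h => Halts.assign_seq rfl (Halts.skip (T := 0) ?_))))), ?_⟩
  · obtain ⟨hσ₂, hin⟩ := h
    have hr : ∀ r, r ≠ .i → (σ₂.setReg .i ((Expr.succ (.reg .i) : Expr Reg Arr).eval σ₂)).reg r =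
        σ₂.reg r := fun r h => Memory.setReg_reg_of_ne h _
    obtain ⟨hp, ⟨L, hL, hd⟩, hI, hsh⟩ := hσ₂
    refine ⟨⟨(hr _ (by decide)).trans hp, ⟨L, hL.congr (.of_eq (hr _ (by decide)) rfl rfl)
      fun _ _ => rfl, hd⟩, hI, hsh⟩, ?_, ?_, hin.inV, hin.inC, hin.inK⟩
    · exact (hr _ (by decide)).trans (hin.n.trans ((hreg .n (by decide) (by decide)
        (by decide)).trans (Memory.setReg_reg_of_ne (by decide) _).symm))
    · rw [Memory.setReg_reg_self, Memory.setReg_reg_self]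
      simp only [Expr.eval]
      rw [hin.i, hi]
  · simp only [Expr.cost]
    omega

/-! #### The first biclique -/

/-- The shores of the biclique `({x}, {y})`. -/
def startMem (x y : ℕ) (s : Bool) (_ : ℕ) : Finset ℕ :=
  if s then {y} else {x}

theorem nb_pair_left (hS : IsShoring adj side) {x y : ℕ} (h : adj x y) :
    nb adj {x, y} x = {y} := by
  rw [nb, Finset.filter_insert, if_neg (hS.irrefl x), Finset.filter_singleton, if_pos h]

theorem nb_pair_right (hS : IsShoring adj side) {x y : ℕ} (h : adj x y) :
    nb adj {x, y} y = {x} := by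
  rw [Finset.pair_comm]
  exact nb_pair_left hS (hS.symm h)

theorem isDiagram_start (hS : IsShoring adj side) {x y : ℕ} (h : adj x y) (hx : side x = false) :
    IsDiagram adj side {x, y} 1 (startMem x y) (fun _ => 0) := by
  have hy : side y = true := by rw [hS.side_adj h, hx]; rfl
  refine IsDiagram.of_side false ?_ ?_ ?_ ?_ hS ?_ ?_ ?_ ?_ ?_
  · intro s b _
    cases s <;> simp [startMem]
  · intro s b _ u hu
    cases s <;> simp_all [startMem]
  · intro s b _
    cases s <;> simp [startMem]
  · intro s b _ w
    cases s
    · simp only [startMem, Bool.false_eq_true, if_false, Bool.not_false, if_true,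
        Finset.mem_singleton, Finset.mem_insert, forall_eq]
      constructor
      · rintro rfl
        exact ⟨Or.inl rfl, hS.symm h⟩
      · rintro ⟨rfl | rfl, h'⟩
        · rfl
        · exact absurd h' (hS.irrefl _)
    · simp only [startMem, Bool.false_eq_true, if_false, Bool.not_true, if_true,
        Finset.mem_singleton, Finset.mem_insert, forall_eq]
      constructor
      · rintro rfl
        exact ⟨Or.inr rfl, h⟩
      · rintro ⟨rfl | rfl, h'⟩
        · exact absurd h' (hS.irrefl _)
        · rfl
  · intro A B hA hB hAW hBW hs hadj
    refine ⟨0, one_pos, fun a ha => ?_, fun b hb => ?_⟩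
    · rcases Finset.mem_insert.1 (hAW ha) with rfl | h'
      · simp [startMem]
      · have := hs a ha
        rw [Finset.mem_singleton.1 h', hy] at this
        exact absurd this (by decide)
    · obtain ⟨a, ha⟩ := hA
      have := hS.side_adj (hadj a ha b hb)
      rw [hs a ha] at this
      rcases Finset.mem_insert.1 (hBW hb) with rfl | h'
      · rw [hx] at this
        exact absurd this (by decide)
      · simpa [startMem] using h'
  · intro b hb c hc _
    omega
  · intro _ _
    exact one_pos
  · intro u hu
    rcases Finset.mem_insert.1 hu with rfl | hu
    · rw [hx, nb_pair_left hS h]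
      rfl
    · rw [Finset.mem_singleton] at hu
      subst hu
      rw [hy, nb_pair_right hS h]
      rfl
  · intro b _ c₁ _ c₂ _ d _ _ _ _ _
    exact Or.inl subset_rfl

theorem card_nb_pair (hS : IsShoring adj side) {x y u : ℕ} (h : adj x y)
    (hu : u ∈ ({x, y} : Finset ℕ)) : (nb adj {x, y} u).card = 1 := by
  rcases Finset.mem_insert.1 hu with rfl | hu
  · rw [nb_pair_left hS h, Finset.card_singleton]
  · rw [Finset.mem_singleton] at hu
    subst hu
    rw [nb_pair_right hS h, Finset.card_singleton]

theorem isCredit_start (hS : IsShoring adj side) {x y : ℕ} (h : adj x y) :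
    IsCredit adj side {x, y} 1 (startMem x y) (fun _ => 0) {x, y} where
  subset := subset_rfl
  eq_singleton u hu hu' := absurd hu hu'
  mem_of_card_le u hu _ := hu
  count u hu := by
    have h1 : (bicliquesAt side 1 (startMem x y) u).card ≤ 1 :=
      (Finset.card_filter_le _ _).trans (by simp)
    have h2 := Finset.card_le_card
      (Finset.inter_subset_left : nb adj {x, y} u ∩ {x, y} ⊆ nb adj {x, y} u)
    rw [card_nb_pair hS h hu] at h2 ⊢
    omega

theorem degSum_pair (hS : IsShoring adj side) {x y : ℕ} (h : adj x y) :
    degSum adj {x, y} {x, y} = 2 := by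
  have hxy : x ≠ y := by
    rintro rfl
    exact hS.irrefl x h
  rw [degSum, Finset.sum_congr rfl fun u hu => card_nb_pair hS h hu]
  simp [hxy]

theorem halts_startPhase (hS : IsShoring adj side) {x y : ℕ} (h : adj x y) (hx : side x = false)
    (hk : σ.arr .inK 1 = x) (hv : σ.arr .inV 1 = y) :
    Halts startPhase σ 100 (fun σ' => Holds side {x, y} 1 (startMem x y) (fun _ => 0) σ' ∧
      SameInput σ σ') := by
  have hD := isDiagram_start hS h hx
  have hy : side y = true := by rw [hS.side_adj h, hx]; rfl
  have hxy : x ≠ y := by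
    rintro rfl
    exact hS.irrefl x h
  set σ₁ := ((((σ.setReg .k x).setReg .v y).setArr .shore x 0).setArr .shore y 1).setReg .free 1
    with hσ₁
  have hreg₁ : ∀ r, r ≠ .k → r ≠ .v → r ≠ .free → σ₁.reg r = σ.reg r := by
    intro r h1 h2 h3
    rw [hσ₁, Memory.setReg_reg_of_ne h3, Memory.setArr_reg, Memory.setArr_reg,
      Memory.setReg_reg_of_ne h2, Memory.setReg_reg_of_ne h1]
  have hk₁ : σ₁.reg .k = x := by
    rw [hσ₁, Memory.setReg_reg_of_ne (by decide), Memory.setArr_reg, Memory.setArr_reg,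
      Memory.setReg_reg_of_ne (by decide), Memory.setReg_reg_self]
  have hv₁ : σ₁.reg .v = y := by
    rw [hσ₁, Memory.setReg_reg_of_ne (by decide), Memory.setArr_reg, Memory.setArr_reg,
      Memory.setReg_reg_self]
  have harr₁ : ∀ a, a ≠ .shore → σ₁.arr a = σ.arr a := by
    intro a ha
    rw [hσ₁, Memory.setReg_arr, Memory.setArr_arr_of_ne ha, Memory.setArr_arr_of_ne ha]
    rfl
  have hsh₁ : σ₁.arr .shore = Function.update (Function.update (σ.arr .shore) x 0) y 1 := by
    rw [hσ₁, Memory.setReg_arr, Memory.setArr_arr_self, Memory.setArr_arr_self]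
    rfl
  set σ₂ := created σ₁ 0 with hσ₂
  set σ₃ := σ₂.setReg .p 1 with hσ₃
  set σ₄ := pushed σ₃ .xs 0 x with hσ₄
  set σ₅ := pushed σ₄ .ys 0 y with hσ₅
  -- With no biclique yet, the only content is that `free` starts at 1, since the reference 0 stands
  -- for the empty list.
  have hL₁ : HoldsLists σ₁ 0 (fun _ _ => []) :=
    ⟨by simp [hσ₁], fun _ _ b hb => absurd hb b.not_lt_zero⟩
  have hL₃ : HoldsLists σ₃ 1 (newList (fun _ _ => []) 0) :=
    hL₁.created.congr (.of_eq rfl rfl rfl) fun _ _ => rfl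
  have hL₅ := (hL₃.pushed (hd := .xs) trivial 0 x).pushed (hd := .ys) trivial 0 y
  have hag₅ : Agree σ₃ σ₅ := (agree_pushed (hd := .xs) trivial _ _).trans
    (agree_pushed (hd := .ys) trivial _ _)
  have harr₃ : ∀ a, ¬ IsHead a → σ₃.arr a = σ₁.arr a := fun a ha => created_arr ha 0
  have hreg₃ : ∀ r, r ≠ .p → σ₃.reg r = σ₁.reg r := fun r hr => Memory.setReg_reg_of_ne hr _
  have hpush : ∀ (τ : Memory Reg Arr) (hd : Arr) (r : Reg) (e : ℕ), IsHead hd →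
      τ.reg r = e → Halts (push hd (.const 0) (.reg r)) τ 14 (· = pushed τ hd 0 e) := by
    rintro τ hd r e hhd rfl
    exact halts_push hhd (b := .const 0) (e := .reg r) fun _ _ => rfl
  have hk₅ : σ₅.reg .k = x := hag₅.k.trans ((hreg₃ _ (by decide)).trans hk₁)
  have hv₅ : σ₅.reg .v = y := hag₅.v.trans ((hreg₃ _ (by decide)).trans hv₁)
  have ev : (Expr.get .inV (.const 1) : Expr Reg Arr).eval (σ.setReg .k x) = y := hv
  have ek' : (Expr.reg .k : Expr Reg Arr).eval ((σ.setReg .k x).setReg .v y) = x := by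
    simp only [Expr.eval]
    rw [Memory.setReg_reg_of_ne (by decide), Memory.setReg_reg_self]
  have ev' : (Expr.reg .v : Expr Reg Arr).eval
      (((σ.setReg .k x).setReg .v y).setArr .shore x 0) = y := by
    simp only [Expr.eval, Memory.setArr_reg]
    rw [Memory.setReg_reg_self]
  refine (Halts.assign_seq (e := .get .inK (.const 1)) hk (Halts.assign_seq (x := .v) ev
    (Halts.write_seq (e := .const 0) (c := 0) ek' rfl
    (Halts.write_seq (e := .const 1) (c := 1) ev' rfl
    (Halts.assign_seq (e := .const 1) (c := 1) rfl
    (Halts.seq_eq (halts_newBiclique (σ := σ₁) (b := .const 0) (b₀ := 0) fun _ _ => rfl)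
    (Halts.assign_seq (e := .const 1) (c := 1) rfl
    (Halts.seq_eq (hpush σ₃ .xs .k x trivial ((hreg₃ _ (by decide)).trans hk₁))
    (Halts.seq_eq (hpush σ₄ .ys .v y trivial ((pushed_reg (by decide)).trans
      ((hreg₃ _ (by decide)).trans hv₁)))
    (Halts.write_seq (σ := σ₅) (i := .reg .k) (e := .const 0) (c := 0) hk₅ rfl
    (Halts.write_seq (i := .reg .v) (e := .const 0) (c := 0) hv₅ rfl
    (Halts.skip (T := 0) ?_)))))))))))).mono (by simp [Expr.cost]) fun _ h => h
  have harr : ∀ a, a ≠ .introd →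
      ((σ₅.setArr .introd x 0).setArr .introd y 0).arr a = σ₅.arr a := fun a ha => by
    rw [Memory.setArr_arr_of_ne ha, Memory.setArr_arr_of_ne ha]
  have hin : ∀ a, ¬ IsHead a → a ≠ .introd → a ≠ .shore → σ₅.arr a = σ₃.arr a →
      ((σ₅.setArr .introd x 0).setArr .introd y 0).arr a = σ.arr a := fun a h1 h2 h3 h4 =>
    (harr a h2).trans (h4.trans ((harr₃ a h1).trans (harr₁ a h3)))
  refine ⟨⟨hag₅.p.trans (Memory.setReg_reg_self _ _), ⟨_, hL₅.congr
    (.of_eq rfl (harr _ (by decide)) (harr _ (by decide))) fun a ha => harr a (ha.ne id), ?_⟩,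
      ?_, ?_⟩, ⟨hag₅.n.trans ((hreg₃ _ (by decide)).trans (hreg₁ _ (by decide) (by decide)
        (by decide))), hag₅.i.trans ((hreg₃ _ (by decide)).trans (hreg₁ _ (by decide) (by decide)
        (by decide))), hin _ id (by decide) (by decide) hag₅.inV,
        hin _ id (by decide) (by decide) hag₅.inC, hin _ id (by decide) (by decide) hag₅.inK⟩⟩
  · have hcov : ∀ s b c, ¬ Cov 1 (startMem x y) s b c := fun s b c h => h.2.2.1.ne rfl
    refine ⟨?_, ?_, ?_, ?_⟩
    · intro s b hb
      obtain rfl : b = 0 := by omega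
      cases s <;> simp [own, pushList, newList]
    · intro s b hb u
      obtain rfl : b = 0 := by omega
      cases s <;> simp [own, pushList, newList, startMem]
    · intro s b hb
      obtain rfl : b = 0 := by omega
      cases s <;> simp [fwd, pushList, newList]
    · intro s b hb c
      obtain rfl : b = 0 := by omega
      simp only [hcov, iff_false]
      cases s <;> simp [fwd, pushList, newList]
  · intro u hu
    rw [Memory.setArr_arr_self, Memory.setArr_arr_self]
    rcases Finset.mem_insert.1 hu with rfl | hu
    · rw [Function.update_of_ne hxy, Function.update_self]
    · rw [Finset.mem_singleton.1 hu, Function.update_self]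
  · intro u hu
    rw [harr _ (by decide), hag₅.shore, harr₃ _ id, hsh₁]
    rcases Finset.mem_insert.1 hu with rfl | hu
    · rw [Function.update_of_ne hxy, Function.update_self, hx]
      rfl
    · rw [Finset.mem_singleton.1 hu, Function.update_self, hy]
      rfl

end Loop

/-! ### From pruning sequences to stages, and the whole main loop -/

section Graph

variable {n : ℕ} {G : SimpleGraph (Fin n)} {X Y : Set (Fin n)} {v : Fin n → Fin n}
  {C : Fin n → StepKind} {k : Fin n → Fin n} {σ σ' : Memory Reg Arr}

/-- Adjacency of vertices given by natural numbers. -/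
def natAdj (G : SimpleGraph (Fin n)) (u w : ℕ) : Prop :=
  ∃ (hu : u < n) (hw : w < n), G.Adj ⟨u, hu⟩ ⟨w, hw⟩

open Classical in
/-- The indicator of the shore `Y`, for vertices given by natural numbers. -/
noncomputable def natSide (Y : Set (Fin n)) (u : ℕ) : Bool :=
  decide (∃ hu : u < n, (⟨u, hu⟩ : Fin n) ∈ Y)

/-- The vertices `v 0, …, v (i - 1)`. -/
def stage (v : Fin n → Fin n) (i : ℕ) : Finset ℕ :=
  (Finset.univ.filter fun j : Fin n => j.val < i).image fun j => (v j).val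

@[simp] theorem natAdj_val {u w : Fin n} : natAdj G u w ↔ G.Adj u w :=
  ⟨fun ⟨_, _, h⟩ => h, fun h => ⟨u.2, w.2, h⟩⟩

theorem natSide_val {u : Fin n} : natSide Y u = true ↔ u ∈ Y := by
  simp [natSide]

theorem isShoring_natAdj (hb : G.IsBipartiteWith X Y) : IsShoring (natAdj G) (natSide Y) where
  symm := fun ⟨hu, hw, h⟩ => ⟨hw, hu, h.symm⟩
  side_adj := by
    rintro u w ⟨hu, hw, h⟩
    have key : natSide Y w = true ↔ ¬ natSide Y u = true := by
      have h1 := natSide_val (Y := Y) (u := ⟨u, hu⟩)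
      have h2 := natSide_val (Y := Y) (u := ⟨w, hw⟩)
      rw [h1, h2]
      have hd := Set.disjoint_left.1 hb.disjoint
      rcases hb.mem_of_adj h with ⟨h3, h4⟩ | ⟨h3, h4⟩
      · exact ⟨fun _ => hd h3, fun _ => h4⟩
      · exact ⟨fun h5 => absurd h5 (hd h4), fun h5 => absurd h3 h5⟩
    cases h1 : natSide Y u <;> cases h2 : natSide Y w <;> simp_all

theorem mem_stage {i u : ℕ} : u ∈ stage v i ↔ ∃ j : Fin n, j.val < i ∧ (v j).val = u := by
  simp [stage]

theorem stage_succ (i : Fin n) : stage v (i + 1) = insert (v i).val (stage v i) := by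
  ext u
  simp only [mem_stage, Finset.mem_insert]
  constructor
  · rintro ⟨j, hj, rfl⟩
    rcases Nat.lt_succ_iff_lt_or_eq.1 hj with hj | hj
    · exact Or.inr ⟨j, hj, rfl⟩
    · exact Or.inl (by rw [Fin.ext hj])
  · rintro (rfl | ⟨j, hj, rfl⟩)
    · exact ⟨i, Nat.lt_succ_self _, rfl⟩
    · exact ⟨j, hj.trans (Nat.lt_succ_self _), rfl⟩

theorem stage_subset {i j : ℕ} (h : i ≤ j) : stage v i ⊆ stage v j := by
  intro u hu
  obtain ⟨l, hl, rfl⟩ := mem_stage.1 hu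
  exact mem_stage.2 ⟨l, hl.trans_le h, rfl⟩

theorem stage_top (hv : Function.Bijective v) : stage v n = Finset.range n := by
  ext u
  rw [mem_stage, Finset.mem_range]
  constructor
  · rintro ⟨j, -, rfl⟩
    exact (v j).2
  · intro hu
    obtain ⟨j, hj⟩ := hv.2 ⟨u, hu⟩
    exact ⟨j, j.2, by rw [hj]⟩

/-- There is a shift of indices: `stage v i` stops before `v i`, whereas `stageNbhd` at `i` includes
it. Only the earlier vertices have to be compared. -/
theorem canAdd_stage (hP : IsReversePruningSequence G v C k) {i : Fin n} (hi : 0 < i.val) :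
    CanAdd (natAdj G) (stage v i) (v i) (v (k i)) (C i) := by
  have hnot : (v i).val ∉ stage v i := by
    rw [mem_stage]
    rintro ⟨j, hj, hji⟩
    rw [hP.bijective.1 (Fin.ext hji)] at hj
    exact lt_irrefl _ hj
  have hmem : (v (k i)).val ∈ stage v i := mem_stage.2 ⟨k i, hP.anchor_lt i hi, rfl⟩
  have hst : ∀ u, ∀ j : Fin n, j.val < i → (G.Adj u (v j) ↔ v j ∈ stageNbhd G v i u) := by
    intro u j hj
    exact ⟨fun h => ⟨h, j, le_of_lt hj, rfl⟩, fun h => h.1⟩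
  cases hC : C i with
  | pending =>
    refine ⟨hnot, hmem, fun w hw => ?_⟩
    obtain ⟨j, hj, rfl⟩ := mem_stage.1 hw
    rw [natAdj_val, hst _ j hj, hP.pending i hi hC, Set.mem_singleton_iff, Fin.ext_iff]
  | twin =>
    refine ⟨hnot, hmem, fun w hw => ?_⟩
    obtain ⟨j, hj, rfl⟩ := mem_stage.1 hw
    rw [natAdj_val, natAdj_val, hst _ j hj, hst _ j hj, (hP.twin i hi hC).1]

/-- Otherwise the first two vertices would be nonadjacent, and neither a pending vertex nor a twin
ever joins two components. The obstruction is carried along as a two-valued function that is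
constant on edges and separates the two vertices; each new vertex takes the value at its anchor. -/
theorem kind_one_of_connected (hP : IsReversePruningSequence G v C k) (hG : G.Connected)
    (hb : G.IsBipartiteWith X Y) (hn : 1 < n) : C ⟨1, hn⟩ = .pending := by
  classical
  have hS := isShoring_natAdj hb
  cases hC : C ⟨1, hn⟩ with
  | pending => rfl
  | twin =>
  exfalso
  set x : Fin n := v ⟨0, zero_lt_one.trans hn⟩ with hx
  set y : Fin n := v ⟨1, hn⟩ with hy
  have hk0 : k ⟨1, hn⟩ = ⟨0, zero_lt_one.trans hn⟩ := by
    have := hP.anchor_lt ⟨1, hn⟩ one_pos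
    rw [Fin.lt_def] at this
    exact Fin.ext (by simpa using this)
  have hst1 : stage v 1 = {x.val} := by
    ext u
    rw [mem_stage, Finset.mem_singleton]
    constructor
    · rintro ⟨j, hj, rfl⟩
      have : j = ⟨0, zero_lt_one.trans hn⟩ := Fin.ext (by simpa using hj)
      rw [this]
    · rintro rfl
      exact ⟨_, one_pos, rfl⟩
  have key : ∀ i, 2 ≤ i → i ≤ n → ∃ f : ℕ → Bool, f x = false ∧ f y = true ∧
      ∀ u ∈ stage v i, ∀ w ∈ stage v i, natAdj G u w → f u = f w := by
    intro i hi2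
    induction i, hi2 using Nat.le_induction with
    | base =>
      intro _
      have hT := canAdd_stage hP (i := ⟨1, hn⟩) one_pos
      rw [hC, hk0] at hT
      have hxy : ¬ natAdj G y x := fun h => hS.irrefl _ ((TwinAt.adj_iff hT x
        (by rw [hst1]; exact Finset.mem_singleton_self _)).1 h)
      have hne : (x.val : ℕ) ≠ y := by
        intro h
        have := hP.bijective.1 (Fin.ext h)
        simp at this
      refine ⟨fun u => decide (u = y.val), by simpa using hne, by simp, ?_⟩
      have hst2 : stage v 2 = {y.val, x.val} := by
        rw [← hst1]
        exact stage_succ (⟨1, hn⟩ : Fin n)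
      rw [hst2]
      intro u hu w hw ha
      simp only [Finset.mem_insert, Finset.mem_singleton] at hu hw
      rcases hu with rfl | rfl <;> rcases hw with rfl | rfl
      · rfl
      · exact absurd ha hxy
      · exact absurd (hS.symm ha) hxy
      · rfl
    | succ i hi ih =>
      intro hin
      obtain ⟨f, hfx, hfy, hf⟩ := ih (by omega)
      have hadd := canAdd_stage hP (i := ⟨i, hin⟩) (by simp; omega)
      have hnot := hadd.notMem
      have hxs : x.val ∈ stage v i := mem_stage.2 ⟨_, by simp; omega, rfl⟩
      have hys : y.val ∈ stage v i := mem_stage.2 ⟨⟨1, hn⟩, by simp; omega, rfl⟩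
      have hsucc : stage v (i + 1) = insert (v ⟨i, hin⟩).val (stage v i) :=
        stage_succ (⟨i, hin⟩ : Fin n)
      have hnew : ∀ w ∈ stage v i, natAdj G (v ⟨i, hin⟩) w → f (v (k ⟨i, hin⟩)) = f w := by
        intro w hw ha
        cases hCi : C ⟨i, hin⟩ with
        | pending =>
          rw [hCi] at hadd
          rw [(PendingAt.adj_iff hadd w hw).1 ha]
        | twin =>
          rw [hCi] at hadd
          exact hf _ hadd.mem w hw ((TwinAt.adj_iff hadd w hw).1 ha)
      have hne : ∀ u ∈ stage v i, u ≠ v ⟨i, hin⟩ := fun u hu h => hnot (h ▸ hu)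
      refine ⟨Function.update f (v ⟨i, hin⟩) (f (v (k ⟨i, hin⟩))), ?_, ?_, ?_⟩
      · rw [Function.update_of_ne (hne _ hxs), hfx]
      · rw [Function.update_of_ne (hne _ hys), hfy]
      · rw [hsucc]
        intro u hu w hw ha
        rcases Finset.mem_insert.1 hu with rfl | hu
        · rcases Finset.mem_insert.1 hw with rfl | hw
          · rfl
          · rw [Function.update_self, Function.update_of_ne (hne w hw)]
            exact hnew w hw ha
        · rcases Finset.mem_insert.1 hw with rfl | hw
          · rw [Function.update_self, Function.update_of_ne (hne u hu)]
            exact (hnew u hu (hS.symm ha)).symm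
          · rw [Function.update_of_ne (hne w hw), Function.update_of_ne (hne u hu)]
            exact hf u hu w hw ha
  obtain ⟨f, hfx, hfy, hf⟩ := key n hn le_rfl
  rw [stage_top hP.bijective] at hf
  have hwalk : ∀ {a b : Fin n}, G.Walk a b → f a = f b := by
    intro a b p
    induction p with
    | nil => rfl
    | cons h _ ih =>
      rw [← ih]
      exact hf _ (Finset.mem_range.2 (Fin.is_lt _)) _ (Finset.mem_range.2 (Fin.is_lt _))
        (natAdj_val.2 h)
  obtain ⟨p⟩ := hG.preconnected x y
  rw [hwalk p, hfy] at hfx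
  exact absurd hfx (by decide)

theorem HoldsInput.congr (h : HoldsInput v C k σ) (hn : σ'.reg .n = σ.reg .n)
    (hV : σ'.arr .inV = σ.arr .inV) (hC : σ'.arr .inC = σ.arr .inC)
    (hK : σ'.arr .inK = σ.arr .inK) : HoldsInput v C k σ' where
  size := hn.trans h.size
  vertex := by rw [hV]; exact h.vertex
  kind := by rw [hC]; exact h.kind
  anchor := by rw [hK]; exact h.anchor

theorem degSum_mono {adj : ℕ → ℕ → Prop} [DecidableRel adj] {W W' : Finset ℕ} (h : W ⊆ W') :
    degSum adj W W ≤ degSum adj W' W' :=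
  (Finset.sum_le_sum fun u _ => Finset.card_le_card (nb_mono h u)).trans
    (Finset.sum_le_sum_of_subset h)

/-- The budget `T` has to cover the stored credits, the edges still to come, and the last test of
the loop. -/
theorem halts_mainLoop [DecidableRel (natAdj G)] {side : ℕ → Bool}
    (hP : IsReversePruningSequence G v C k) (hS : IsShoring (natAdj G) side) (m : ℕ) :
    ∀ (σ : Memory Reg Arr) (i p : ℕ) (mem : Bool → ℕ → Finset ℕ) (I : ℕ → ℕ) (F : Finset ℕ)
      (T : ℕ), n - i = m → 0 < i → i ≤ n → HoldsInput v C k σ → σ.reg .i = i →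
      IsDiagram (natAdj G) side (stage v i) p mem I →
      IsCredit (natAdj G) side (stage v i) p mem I F → Holds side (stage v i) p mem I σ →
      22 * degSum (natAdj G) (stage v i) F + 300 * degSum (natAdj G) (stage v n) (stage v n) + 3 ≤
        T + 300 * degSum (natAdj G) (stage v i) (stage v i) →
      Halts (.whileNe (.reg .i) (.reg .n) loopBody) σ T (fun σ' => ∃ p mem I,
        IsDiagram (natAdj G) side (stage v n) p mem I ∧ Holds side (stage v n) p mem I σ') := by
  induction m with
  | zero =>
    intro σ i p mem I F T hm hi0 hin hσ hi hD hF hH hT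
    obtain rfl : i = n := by omega
    refine (Halts.whileNe_done (by simp only [Expr.eval, hi, hσ.size]) ?_).mono
      (by simp only [Expr.cost]; omega) fun _ h => h
    exact ⟨p, mem, I, hD, hH⟩
  | succ m ih =>
    intro σ i p mem I F T hm hi0 hin hσ hi hD hF hH hT
    have hlt : i < n := by omega
    have hadd := canAdd_stage hP (i := ⟨i, hlt⟩) hi0
    obtain ⟨T₁, p', mem', I', F', hD', hF', hrun, hT₁⟩ := halts_loopBody hD hF hS hH hadd
      (by rw [hi]; exact hσ.vertex ⟨i, hlt⟩ hi0) (by rw [hi]; exact hσ.anchor ⟨i, hlt⟩ hi0)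
      (by rw [hi]; exact hσ.kind ⟨i, hlt⟩ hi0)
    have hsucc : stage v (i + 1) = insert (v ⟨i, hlt⟩).val (stage v i) :=
      stage_succ (⟨i, hlt⟩ : Fin n)
    have hmono : degSum (natAdj G) (stage v (i + 1)) (stage v (i + 1)) ≤
        degSum (natAdj G) (stage v n) (stage v n) := degSum_mono (stage_subset hlt)
    simp only [← hsucc] at hD' hF' hrun hT₁
    -- The subtraction is not truncated: by the account of this pass and `hmono`, the budget exceeds
    -- `T₁ + 3`.
    refine (Halts.whileNe_step (T' := T - (T₁ + 3)) (by simp only [Expr.eval, hi, hσ.size]; omega)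
      hrun ?_).mono ?_ fun _ h => h
    · rintro σ₁ ⟨hH₁, hin₁⟩
      refine ih σ₁ (i + 1) p' mem' I' F' _ (by omega) (by omega) hlt
        (hσ.congr (hin₁.n.trans (Memory.setReg_reg_of_ne (by decide) _)) hin₁.inV hin₁.inC
          hin₁.inK) ?_ hD' hF' hH₁ (by omega)
      rw [hin₁.i, Memory.setReg_reg_self, hi]
    · simp only [Expr.cost]
      omega

theorem degSum_range [DecidableRel (natAdj G)] :
    degSum (natAdj G) (Finset.range n) (Finset.range n) = 2 * G.edgeSet.ncard := by
  classical
  have h1 : G.edgeSet.ncard = G.edgeFinset.card := by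
    rw [← SimpleGraph.coe_edgeFinset, Set.ncard_coe_finset]
  rw [h1, ← G.sum_degrees_eq_twice_card_edges, degSum, Finset.sum_range]
  refine Finset.sum_congr rfl fun u _ => ?_
  rw [← SimpleGraph.card_neighborFinset_eq_degree,
    ← Finset.card_image_of_injective _ Fin.val_injective]
  congr 1
  ext w
  simp only [mem_nb, Finset.mem_range, Finset.mem_image, SimpleGraph.mem_neighborFinset]
  constructor
  · rintro ⟨hw, _, _, h⟩
    exact ⟨⟨w, hw⟩, h, rfl⟩
  · rintro ⟨w, h, rfl⟩
    exact ⟨w.2, natAdj_val.2 h⟩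

end Graph

/-! ### From the final invariant to the Hasse diagram of maximal bicliques -/

section Output

variable {n : ℕ} {G : SimpleGraph (Fin n)} {X Y : Set (Fin n)} {σ : Memory Reg Arr} {p : ℕ}
  {mem : Bool → ℕ → Finset ℕ} {I : ℕ → ℕ}

/-- The vertices in a set of natural numbers. -/
def vertexSet (n : ℕ) (A : Finset ℕ) : Set (Fin n) :=
  {x | x.val ∈ A}

theorem image_vertexSet {A : Finset ℕ} (hA : A ⊆ Finset.range n) (u : ℕ) :
    u ∈ Fin.val '' vertexSet n A ↔ u ∈ A :=
  ⟨fun ⟨_, hx, hxu⟩ => hxu ▸ hx, fun hu => ⟨⟨u, Finset.mem_range.1 (hA hu)⟩, hu, rfl⟩⟩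

theorem vertexSet_subset {A B : Finset ℕ} (hA : A ⊆ Finset.range n) :
    vertexSet n A ⊆ vertexSet n B ↔ A ⊆ B :=
  ⟨fun h u hu => h (a := ⟨u, Finset.mem_range.1 (hA hu)⟩) hu, fun h _ hx => h hx⟩

theorem mem_shores_of_adj (hb : G.IsBipartiteWith X Y) {x y : Fin n}
    (hx : natSide Y x = false) (h : G.Adj x y) : x ∈ X ∧ y ∈ Y := by
  have hxY : x ∉ Y := fun h' => by simp [natSide_val.2 h'] at hx
  exact (hb.mem_of_adj h).resolve_right fun h' => hxY h'.1

variable [DecidableRel (natAdj G)]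

/-- A vertex of a larger biclique is adjacent to the entire opposite shore, hence already present by
`closed`. -/
theorem IsDiagram.maximal (hD : IsDiagram (natAdj G) (natSide Y) (Finset.range n) p mem I)
    (hb : G.IsBipartiteWith X Y) {b : ℕ} (hbp : b < p) :
    Maximal (IsBiclique G X Y) (vertexSet n (mem false b), vertexSet n (mem true b)) := by
  have hadj : ∀ x y : Fin n, x.val ∈ mem false b → y.val ∈ mem true b → G.Adj x y := by
    intro x y hx hy
    exact (natAdj_val.1 (((hD.closed false b hbp x).1 hx).2 y hy)).symm
  have hsh : ∀ x y : Fin n, x.val ∈ mem false b → y.val ∈ mem true b → x ∈ X ∧ y ∈ Y :=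
    fun x y hx hy => mem_shores_of_adj hb (hD.side_eq _ b hbp _ hx) (hadj x y hx hy)
  have hne : ∀ s, ∃ x : Fin n, x.val ∈ mem s b := fun s => by
    obtain ⟨u, hu⟩ := hD.nonempty s b hbp
    exact ⟨⟨u, Finset.mem_range.1 (hD.subset s b hbp hu)⟩, hu⟩
  obtain ⟨x₀, hx₀⟩ := hne false
  obtain ⟨y₀, hy₀⟩ := hne true
  refine ⟨⟨fun x hx => (hsh x y₀ hx hy₀).1, fun y hy => (hsh x₀ y hx₀ hy).2, ⟨x₀, hx₀⟩, ⟨y₀, hy₀⟩,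
    fun x hx y hy => hadj x y hx hy⟩, fun B hB hle => ⟨fun x hx => ?_, fun y hy => ?_⟩⟩
  · refine (hD.closed false b hbp x).2 ⟨Finset.mem_range.2 x.2, fun u hu => ?_⟩
    have hu' := Finset.mem_range.1 (hD.subset _ b hbp hu)
    exact ⟨hu', x.2, (hB.adj x hx ⟨u, hu'⟩ (hle.2 hu)).symm⟩
  · refine (hD.closed true b hbp y).2 ⟨Finset.mem_range.2 y.2, fun u hu => ?_⟩
    have hu' := Finset.mem_range.1 (hD.subset _ b hbp hu)
    exact ⟨hu', y.2, hB.adj ⟨u, hu'⟩ (hle.1 hu) y hy⟩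

theorem IsDiagram.holdsDiagram
    (hD : IsDiagram (natAdj G) (natSide Y) (Finset.range n) p mem I)
    (hb : G.IsBipartiteWith X Y) (hH : Holds (natSide Y) (Finset.range n) p mem I σ) :
    HoldsDiagram G X Y σ := by
  classical
  have hS := isShoring_natAdj hb
  obtain ⟨rfl, ⟨L, hL, hd⟩, hI, -⟩ := hH
  set f : Fin (σ.reg .p) → MaxBiclique G X Y := fun b => ⟨_, hD.maximal hb b.2⟩ with hf
  have hsub : ∀ s, ∀ b : Fin (σ.reg .p), mem s b ⊆ Finset.range n := fun s b =>
    hD.subset s b b.2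
  have hle : ∀ b c : Fin (σ.reg .p), f b ≤ f c ↔ mem false b ⊆ mem false c := fun b c =>
    vertexSet_subset (hsub false b)
  have hlt : ∀ b c : Fin (σ.reg .p), f b < f c ↔ mem false b ⊂ mem false c := fun b c => by
    rw [lt_iff_le_not_ge, hle, hle, ssubset_iff_subset_not_subset]
  have hinj : Function.Injective f := fun b c h => Fin.ext (hD.inj false b b.2 c c.2
    (Finset.Subset.antisymm ((hle b c).1 h.le) ((hle c b).1 h.ge)))
  have hsurj : Function.Surjective f := by
    rintro ⟨⟨A, B⟩, hAB⟩
    have hprop := hAB.prop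
    have himg : ∀ (S : Set (Fin n)) (u : Fin n),
        u.val ∈ (Finset.univ.filter (· ∈ S)).image Fin.val ↔ u ∈ S := by
      intro S u
      simp [Fin.val_inj]
    have hran : ∀ S : Set (Fin n),
        (Finset.univ.filter (· ∈ S)).image Fin.val ⊆ Finset.range n := by
      intro S u hu
      obtain ⟨w, -, rfl⟩ := Finset.mem_image.1 hu
      exact Finset.mem_range.2 w.2
    obtain ⟨a, ha⟩ := hprop.left_nonempty
    obtain ⟨y, hy⟩ := hprop.right_nonempty
    obtain ⟨b, hbp, h1, h2⟩ := hD.complete false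
      ((Finset.univ.filter (· ∈ A)).image Fin.val) ((Finset.univ.filter (· ∈ B)).image Fin.val)
      ⟨a, (himg A a).2 ha⟩ ⟨y, (himg B y).2 hy⟩ (hran A) (hran B)
      (fun u hu => by
        obtain ⟨w, hw, rfl⟩ := Finset.mem_image.1 hu
        rw [← Bool.not_eq_true, natSide_val]
        exact Set.disjoint_left.1 hb.disjoint
          (hprop.left_subset (Finset.mem_filter.1 hw).2))
      (fun u hu w hw => by
        obtain ⟨u, hu', rfl⟩ := Finset.mem_image.1 hu
        obtain ⟨w, hw', rfl⟩ := Finset.mem_image.1 hw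
        exact natAdj_val.2
          (hprop.adj u (Finset.mem_filter.1 hu').2 w (Finset.mem_filter.1 hw').2))
    -- By `complete`, a maximal biclique lies in a listed one, and maximality makes them equal.
    refine ⟨⟨b, hbp⟩, Subtype.ext (hAB.eq_of_le (hD.maximal hb hbp).prop ⟨?_, ?_⟩).symm⟩
    · exact fun x hx => h1 ((himg A x).2 hx)
    · exact fun x hx => h2 ((himg B x).2 hx)
  have hcov : ∀ b c : Fin (σ.reg .p), f b ⋖ f c ↔ Cov (σ.reg .p) mem false b c := by
    intro b c
    constructor
    · rintro ⟨h1, h2⟩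
      refine ⟨b.2, c.2, (hlt b c).1 h1, fun d hdp h3 h4 => ?_⟩
      exact h2 ((hlt b ⟨d, hdp⟩).2 h3) ((hlt ⟨d, hdp⟩ c).2 h4)
    · rintro ⟨-, -, h1, h2⟩
      refine ⟨(hlt b c).2 h1, fun D h3 h4 => ?_⟩
      obtain ⟨d, rfl⟩ := hsurj D
      exact h2 d d.2 ((hlt b d).1 h3) ((hlt d c).1 h4)
  have himage : ∀ (R : ℕ → Prop) (S : Fin (σ.reg .p) → Prop), (∀ c, R c → c < σ.reg .p) →
      (∀ c : Fin (σ.reg .p), S c ↔ R c) → ∀ c, R c ↔ c ∈ Fin.val '' {c | S c} := by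
    intro R S h1 h2 c
    exact ⟨fun h => ⟨⟨c, h1 c h⟩, (h2 _).2 h, rfl⟩, fun ⟨d, hd, hdc⟩ => hdc ▸ (h2 d).1 hd⟩
  have hch := fun s (b : Fin (σ.reg .p)) => (hL.chain _ (isHead_own s) b b.2).isLinkedList
  have hch' := fun s (b : Fin (σ.reg .p)) => (hL.chain _ (isHead_fwd s) b b.2).isLinkedList
  refine ⟨Equiv.ofBijective f ⟨hinj, hsurj⟩, fun b => ?_, fun b => ?_, fun b => ?_, fun b => ?_,
    fun u => ?_⟩
  · refine ⟨_, hch false b, hd.nodup_own _ b b.2, fun u => ?_⟩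
    rw [hd.mem_own _ b b.2]
    exact (image_vertexSet (hsub false b) u).symm
  · refine ⟨_, hch true b, hd.nodup_own _ b b.2, fun u => ?_⟩
    rw [hd.mem_own _ b b.2]
    exact (image_vertexSet (hsub true b) u).symm
  · refine ⟨_, hch' false b, hd.nodup_fwd _ b b.2, fun u => ?_⟩
    rw [hd.mem_fwd _ b b.2]
    exact himage _ _ (fun c h => h.2.1) (fun c => hcov b c) u
  · refine ⟨_, hch' true b, hd.nodup_fwd _ b b.2, fun u => ?_⟩
    rw [hd.mem_fwd _ b b.2]
    -- The downward list holds the covers in the order of the `Y` shores, which is the reversed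
    -- order.
    exact himage _ _ (fun c h => h.2.1) (fun c => (hcov c b).trans (hD.cov_not false).symm) u
  · have huW : u.val ∈ Finset.range n := Finset.mem_range.2 u.2
    have hIu := hD.introd_lt u huW
    refine ⟨⟨I u, hIu⟩, hI u huW, ?_⟩
    have hmem := hD.mem_introd hS huW
    have hiff := fun c : Fin (σ.reg .p) => hD.introd_subset_iff hS huW c.2
    obtain ⟨w, hw⟩ := hD.nb_nonempty huW
    obtain ⟨-, hu', hw', hadj⟩ := mem_nb.1 hw
    cases hs : natSide Y u with
    | false =>
      rw [hs] at hmem hiff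
      refine Or.inl ⟨(mem_shores_of_adj hb hs hadj).1, hmem, fun D hD' => ?_⟩
      obtain ⟨d, rfl⟩ := hsurj D
      exact (hle ⟨I u, hIu⟩ d).2 ((hiff d).2 hD')
    | true =>
      rw [hs] at hmem hiff
      refine Or.inr ⟨natSide_val.1 hs, hmem, fun D hD' => ?_⟩
      obtain ⟨d, rfl⟩ := hsurj D
      exact (hle d ⟨I u, hIu⟩).2 ((hD.opp_subset_iff true hIu d.2).2 ((hiff d).2 hD'))

end Output

end BDH

/-! ### Assembly of the time bound and the output -/

theorem mainTheorem6 :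
    ∃ c : ℕ, ∀ (n : ℕ) (hn : 2 ≤ n) (G : SimpleGraph (Fin n)) (X Y : Set (Fin n))
      (v : Fin n → Fin n) (C : Fin n → BDH.StepKind) (k : Fin n → Fin n),
      BDH.IsBDH G → G.Connected → G.IsBipartiteWith X Y →
      BDH.IsReversePruningSequence G v C k → v ⟨0, by omega⟩ ∈ X →
      ∀ σ : BDH.Memory BDH.Reg BDH.Arr, BDH.HoldsInput v C k σ →
        ∃ (σ' : BDH.Memory BDH.Reg BDH.Arr) (t : ℕ),
          BDH.Runs BDH.computeBDHDiagram σ σ' t ∧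
          t ≤ c * G.edgeSet.ncard ∧
          BDH.HoldsDiagram G X Y σ' := by
  -- The account allows 300 per unit of the degree sum, and the degree sum is 2m.
  refine ⟨600, fun n hn G X Y v C k _ hG hb hP hvX σ hσ => ?_⟩
  classical
  have hn0 : 0 < n := by omega
  have hS := BDH.isShoring_natAdj hb
  have hkind := BDH.kind_one_of_connected hP hG hb hn
  have hadd := BDH.canAdd_stage hP (i := ⟨1, hn⟩) one_pos
  have hk0 : k ⟨1, hn⟩ = ⟨0, hn0⟩ := by
    have := hP.anchor_lt ⟨1, hn⟩ one_pos
    rw [Fin.lt_def] at this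
    exact Fin.ext (by simpa using this)
  rw [hkind, hk0] at hadd
  have hxy := hS.symm (BDH.PendingAt.adj_anchor hadd)
  have hx : BDH.natSide Y (v ⟨0, hn0⟩) = false := by
    rw [← Bool.not_eq_true, BDH.natSide_val]
    exact Set.disjoint_left.1 hb.disjoint hvX
  have hst : BDH.stage v 2 = {(v ⟨0, hn0⟩).val, (v ⟨1, hn⟩).val} := by
    have h0 : BDH.stage v 0 = ∅ := by simp [BDH.stage]
    have h1 : BDH.stage v 1 = insert (v ⟨0, hn0⟩).val (BDH.stage v 0) :=
      BDH.stage_succ (⟨0, hn0⟩ : Fin n)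
    have h2 : BDH.stage v 2 = insert (v ⟨1, hn⟩).val (BDH.stage v 1) :=
      BDH.stage_succ (⟨1, hn⟩ : Fin n)
    rw [h2, h1, h0, insert_empty_eq, Finset.pair_comm]
  have hK := hσ.anchor ⟨1, hn⟩ one_pos
  rw [hk0] at hK
  have hstart := BDH.halts_startPhase hS hxy hx hK (hσ.vertex ⟨1, hn⟩ one_pos)
  have hD := BDH.isDiagram_start hS hxy hx
  have hF := BDH.isCredit_start hS hxy
  have hdeg := BDH.degSum_pair hS hxy
  rw [← hst] at hstart hD hF hdeg
  have hdegn := BDH.degSum_range (G := G)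
  rw [← BDH.stage_top hP.bijective] at hdegn
  have hmono : BDH.degSum (BDH.natAdj G) (BDH.stage v 2) (BDH.stage v 2) ≤
      BDH.degSum (BDH.natAdj G) (BDH.stage v n) (BDH.stage v n) :=
    BDH.degSum_mono (BDH.stage_subset hn)
  -- The first edge has degree sum 2 and is worth 600. Of these, 500 are set aside for the
  -- instructions outside the loop, and the other 100 cover the initial credits 44 and the last
  -- test. The degree sum being at least 2, the subtraction is not truncated.
  obtain ⟨σ', t, hrun, ht, p, mem, I, hD', hH'⟩ := hstart.seq (P' := .seq (.assign .i (.const 2))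
    (.seq (.whileNe (.reg .i) (.reg .n) BDH.loopBody) .skip)) (fun σ₁ ⟨hH₁, hin₁⟩ => by
      refine BDH.Halts.assign_seq (c := 2) rfl ((BDH.halts_mainLoop hP hS _
        (σ₁.setReg .i 2) 2 1 _ _ _ (300 * BDH.degSum (BDH.natAdj G) (BDH.stage v n)
          (BDH.stage v n) - 500) rfl two_pos hn
        (hσ.congr ((BDH.Memory.setReg_reg_of_ne (by decide) _).trans hin₁.n) hin₁.inV hin₁.inC
          hin₁.inK) (BDH.Memory.setReg_reg_self _ _) hD hF ?_ (by omega)).seq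
            fun σ' h => BDH.Halts.skip (T := 0) h)
      obtain ⟨hp, ⟨L, hL, hd⟩, hI, hsh⟩ := hH₁
      exact ⟨(BDH.Memory.setReg_reg_of_ne (by decide) _).trans hp, ⟨L, hL.congr (.of_eq
        (BDH.Memory.setReg_reg_of_ne (by decide) _) rfl rfl) fun _ _ => rfl, hd⟩, hI, hsh⟩)
  refine ⟨σ', t, hrun, ?_, ?_⟩
  · simp only [BDH.Expr.cost] at ht
    omega
  · rw [BDH.stage_top hP.bijective] at hD' hH'
    exact hD'.holdsDiagram hb hH'
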